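/- **Definitions.** Let $(\Omega,\mathcal F,P)$ be a probability space whose measure is separable, i.e. $\mathcal F$ is countably generated modulo $P$-negligible sets (for instance, any Lebesgue space). All relations between $\sigma$-fields and between maps are understood modulo negligible sets. A *noise* $(\Omega,\mathcal F,P),(T_t),(\mathcal F_{s,t})$ consists of a one-parameter group $(T_t)_{t\in\mathbb R}$ of measure preserving transformations of $\Omega$ and of sub-$\sigma$-fields $\mathcal F_{s,t}\subset\mathcal F$ ($-\infty<s\le t<\infty$) such that $T_t$ sends $\mathcal F_{r,s}$ to $\mathcal F_{r+t,s+t}$ for $r\le s$ and all $t$, and, for $r\le s\le t$, $\mathcal F_{r,s}$ and $\mathcal F_{s,t}$ are independent and together generate $\mathcal F_{r,t}$. Let $\mathcal F_{-\infty,\infty}$ be generated by all $\mathcal F_{s,t}$. An *elementary set* is a finite union of intervals $A\subset\mathbb R$, and $\mathcal F_A$ denotes the $\sigma$-field generated by all $\mathcal F_{s,t}$ with $s\le t$ and $(s,t)\subset A$. $L_2$ is over $\mathbb R$ or over $\mathbb C$. Let $\mathcal C$ be the space of all compact subsets of $\mathbb R$, including $\emptyset$, with the Hausdorff metric (in which $\emptyset$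 is isolated) and its Borel $\sigma$-field. A *measurable field of Hilbert spaces* over a measure space $(X,\mu)$ consists of Hilbert spaces $\hat L(x)$, $x\in X$, and a linear space of vector fields, called measurable, such that norms of measurable fields are $\mu$-measurable functions, every vector field whose inner products with all measurable fields are $\mu$-measurable is measurable, and some sequence of measurable fields is total in $\hat L(x)$ at each $x$. Its *direct integral* $\int^\oplus \hat L(x)\,d\mu(x)$ is the Hilbert space of square integrable measurable fields modulo equality $\mu$-a.e., with inner product $\int\langle\xi(x),\eta(x)\rangle\,d\mu(x)$. **Theorem 2.3.** For every noise there are a probability measure $\mu$ on $\mathcal C$ such that (a) $\mu\{C\in\mathcal C: t\in C\}=0$ for all $t\in\mathbb R$, a measurable field of Hilbert spaces $\hat L(C)$, $C\in\mathcal C$, with $\hat L(C)\ne\{0\}$ for $\mu$-almost all $C$, and a direct integral decomposition (a linear inner-product-preserving bijection) (b) $L_2(\Omega,\mathcal F_{-\infty,\infty},P)=\int_{\mathcal C}^{\oplus}\hat L(C)\,d\mu(C)$, $\quad f=\int_{\mathcal C}^\oplus \hat f(C)\,d\mu(C)$, such that for every elementary set $A$ and every $f\in L_2(\Omega,\mathcal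 F_{-\infty,\infty},P)$ (c) $\mathbb E(f\mid\mathcal F_A)=\int_{\mathcal C}^{\oplus}\hat f(C)\,1_{e(A)}(C)\,d\mu(C)$, where $e(A)=\{C\in\mathcal C: C\subset A\}$. The measure $\mu$ is determined by the noise up to equivalence: if $\mu$ and $\nu$ are two probability measures on $\mathcal C$ that admit such decompositions (each satisfying (a)–(c), with fibres nonzero almost everywhere), then $\mu$ and $\nu$ are mutually absolutely continuous. -/

import Mathlib

open MeasureTheory ProbabilityTheory TopologicalSpace Filter

open scoped ENNReal

universe u v

/-- A noise over the probability space `(Ω, P)`: a one-parameter group of measure preserving maps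
`T t` and sub-σ-fields `F s t`, `s ≤ t`, such that `T t` sends `F r s` to `F (r + t) (s + t)`,
and for `r ≤ s ≤ t` the σ-fields `F r s` and `F s t` are independent and together generate `F r t`.
Everything is understood modulo negligible sets: the group law holds almost everywhere, and
equality of σ-fields is equality of their completions `eventuallyMeasurableSpace _ (ae P)`
(so it does not matter whether or not the `F s t` contain the negligible sets).
No regularity of `T t` in `t` is required. -/
structure Noise {Ω : Type u} [mΩ : MeasurableSpace Ω] (P : Measure Ω) where
  T : ℝ → Ω → Ω
  F : ℝ → ℝ → MeasurableSpace Ω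
  measurePreserving : ∀ t, MeasurePreserving (T t) P P
  T_zero : T 0 =ᵐ[P] id
  T_add : ∀ s t, T (s + t) =ᵐ[P] T s ∘ T t
  F_le : ∀ s t, s ≤ t → F s t ≤ mΩ
  shift : ∀ t r s, r ≤ s →
    eventuallyMeasurableSpace ((F (r + t) (s + t)).comap (T t)) (ae P) =
      eventuallyMeasurableSpace (F r s) (ae P)
  indep : ∀ r s t, r ≤ s → s ≤ t → Indep (F r s) (F s t) P
  generate : ∀ r s t, r ≤ s → s ≤ t →
    eventuallyMeasurableSpace (F r s ⊔ F s t) (ae P) = eventuallyMeasurableSpace (F r t) (ae P)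

/-- An elementary subset of the line: a finite union of intervals (bounded or not, with or without
their end points, possibly degenerate). -/
def IsElementary (A : Set ℝ) : Prop :=
  ∃ S : Set (Set ℝ), S.Finite ∧ (∀ I ∈ S, I.OrdConnected) ∧ A = ⋃₀ S

namespace Noise

variable {Ω : Type u} [mΩ : MeasurableSpace Ω] {P : Measure Ω}

/-- The σ-field `F_A` of an elementary set `A`, generated by all `F s t` with `(s, t) ⊆ A`. If `A`
coincides up to finitely many points with `(s₁, t₁) ∪ … ∪ (sₙ, tₙ)`,
`-∞ ≤ s₁ < t₁ < … < sₙ < tₙ ≤ ∞`, this is, modulo negligible sets, the σ-field generated by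
`F_{s₁, t₁}, …, F_{sₙ, tₙ}`. -/
@[reducible]
def fieldOf (N : Noise P) (A : Set ℝ) : MeasurableSpace Ω :=
  ⨆ (s : ℝ) (t : ℝ) (_ : s ≤ t) (_ : Set.Ioo s t ⊆ A), N.F s t

/-- The σ-field `F_{-∞, ∞}`, generated by all `F s t`. -/
@[reducible]
def fieldTop (N : Noise P) : MeasurableSpace Ω :=
  ⨆ (s : ℝ) (t : ℝ) (_ : s ≤ t), N.F s t

theorem fieldOf_le_fieldTop (N : Noise P) (A : Set ℝ) : N.fieldOf A ≤ N.fieldTop :=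
  iSup_le fun s => iSup_le fun t => iSup_le fun h => iSup_le fun _ =>
    le_iSup_of_le s (le_iSup_of_le t (le_iSup_of_le h le_rfl))

/-- The Hilbert space `L₂(Ω, F_{-∞, ∞}, P)` of real (`𝕜 = ℝ`) or complex (`𝕜 = ℂ`) functions. -/
abbrev L2 (N : Noise P) (𝕜 : Type) [RCLike 𝕜] : Submodule 𝕜 (Lp 𝕜 2 P) :=
  lpMeas 𝕜 𝕜 N.fieldTop 2 P

theorem memLp_condExp [IsProbabilityMeasure P] (N : Noise P) {𝕜 : Type} [RCLike 𝕜] (A : Set ℝ)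
    (f : N.L2 𝕜) : MemLp (P[((f : Lp 𝕜 2 P) : Ω → 𝕜)|N.fieldOf A]) 2 P :=
  (Lp.memLp (f : Lp 𝕜 2 P)).condExp (by norm_num)

/-- The conditional expectation `E(f | F_A)`, as an element of `L₂(Ω, F_{-∞, ∞}, P)`. -/
noncomputable def condExpL2 [IsProbabilityMeasure P] (N : Noise P) {𝕜 : Type} [RCLike 𝕜]
    (A : Set ℝ) (f : N.L2 𝕜) : N.L2 𝕜 :=
  ⟨(N.memLp_condExp A f).toLp _, mem_lpMeas_iff_aestronglyMeasurable.2
    ((stronglyMeasurable_condExp.mono (N.fieldOf_le_fieldTop A)).aestronglyMeasurable.congr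
      (N.memLp_condExp A f).coeFn_toLp.symm)⟩

end Noise

/-- A measurable field of Hilbert spaces over the measure space `(X, μ)`: Hilbert spaces
`fiber x`, `x ∈ X`, and a linear space `fields` of vector fields, called measurable, such that
the norm of a measurable field is a measurable function, a vector field whose inner products with
all measurable fields are measurable is itself measurable, and there is a sequence of measurable
fields whose values at each point `x` are total in `fiber x`. (Measurability of scalar functions
is with respect to the completion of `μ`.) -/
structure MeasurableHilbertField (𝕜 : Type) [RCLike 𝕜] {X : Type u} [MeasurableSpace X]
    (μ : Measure X) where
  fiber : X → Type v
  [normed : ∀ x, NormedAddCommGroup (fiber x)]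
  [innerProduct : ∀ x, InnerProductSpace 𝕜 (fiber x)]
  [complete : ∀ x, CompleteSpace (fiber x)]
  fields : Submodule 𝕜 (∀ x, fiber x)
  aemeasurable_norm : ∀ ξ ∈ fields, AEMeasurable (fun x => ‖ξ x‖) μ
  mem_of_aemeasurable_inner : ∀ η : ∀ x, fiber x,
    (∀ ξ ∈ fields, AEMeasurable (fun x => inner 𝕜 (ξ x) (η x)) μ) → η ∈ fields
  exists_total : ∃ ξ : ℕ → ∀ x, fiber x, (∀ n, ξ n ∈ fields) ∧
    ∀ x, (Submodule.span 𝕜 (Set.range fun n => ξ n x)).topologicalClosure = ⊤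

attribute [instance] MeasurableHilbertField.normed MeasurableHilbertField.innerProduct
  MeasurableHilbertField.complete

/-- A decomposition of the inner product space `K` into the direct integral of the measurable field
`H` of Hilbert spaces, `K = ∫^⊕ H(x) dμ(x)`: a linear and inner-product-preserving bijection
`f ↦ (x ↦ coord f x)` of `K` onto the space of classes, modulo equality `μ`-almost everywhere, of
square integrable measurable vector fields. Here `coord f` is a representative of the class. -/
structure DirectIntegralDecomposition (𝕜 : Type) [RCLike 𝕜] {X : Type u} [MeasurableSpace X]
    {μ : Measure X} (H : MeasurableHilbertField.{u, v} 𝕜 μ) (K : Type*) [NormedAddCommGroup K]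
    [InnerProductSpace 𝕜 K] where
  coord : K → ∀ x, H.fiber x
  coord_mem : ∀ f, coord f ∈ H.fields
  memLp_coord : ∀ f, MemLp (fun x => ‖coord f x‖) 2 μ
  coord_add : ∀ f g, ∀ᵐ x ∂μ, coord (f + g) x = coord f x + coord g x
  coord_smul : ∀ (c : 𝕜) (f : K), ∀ᵐ x ∂μ, coord (c • f) x = c • coord f x
  inner_eq : ∀ f g, inner 𝕜 f g = ∫ x, inner 𝕜 (coord f x) (coord g x) ∂μ
  surjective : ∀ ξ ∈ H.fields, MemLp (fun x => ‖ξ x‖) 2 μ →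
    ∃ f, ∀ᵐ x ∂μ, coord f x = ξ x

/-- The Borel σ-field of the space of all compact subsets of the line (including the empty set)
with the Hausdorff metric. -/
noncomputable instance instMeasurableSpaceCompactsReal : MeasurableSpace (Compacts ℝ) := borel (Compacts ℝ)

instance instBorelSpaceCompactsReal : BorelSpace (Compacts ℝ) := ⟨rfl⟩

/-- `μ` is a spectral measure of the noise `N`: a probability measure on the space of compact
subsets of the line for which almost no `C` contains a given point `t`, and over which
`L₂(Ω, F_{-∞, ∞}, P)` decomposes into a direct integral of (almost everywhere nonzero) Hilbert
spaces in such a way that each conditional expectation `E(· | F_A)`, for an elementary set `A`, is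
multiplication by the indicator of `e(A) = {C | C ⊆ A}`. -/
def IsSpectralMeasure (𝕜 : Type) [RCLike 𝕜] {Ω : Type u} [MeasurableSpace Ω] {P : Measure Ω}
    [IsProbabilityMeasure P] (N : Noise P) (μ : Measure (Compacts ℝ)) : Prop :=
  IsProbabilityMeasure μ ∧
  (∀ t : ℝ, μ {C : Compacts ℝ | t ∈ C} = 0) ∧
  ∃ (H : MeasurableHilbertField.{0, v} 𝕜 μ) (D : DirectIntegralDecomposition 𝕜 H (N.L2 𝕜)),
    (∀ᵐ C ∂μ, Nontrivial (H.fiber C)) ∧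
    ∀ A : Set ℝ, IsElementary A → ∀ f : N.L2 𝕜, ∀ᵐ C ∂μ,
      D.coord (N.condExpL2 A f) C =
        Set.indicator {C : Compacts ℝ | (C : Set ℝ) ⊆ A} (fun _ => (1 : 𝕜)) C • D.coord f C

/-!
The conditional expectations `E(· | F_A)`, for `A` cut out of the line by finitely many points, are
commuting projections of `L₂`, and independence of the past and the future turns intersections into
products: `E(E(f | F_A) | F_B) = E(f | F_{A ∩ B})` (`Noise.pr_pr`). The spectral measure of a noise
is the joint spectral measure of these projections, realized on the space of compact sets.

*Spectral measures of vectors.* For `f` in `L₂(F_{-∞, ∞})` there is a finite measure on compact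
sets that gives mass `‖E(f | F_A)‖²` to `e(A) = {C | C ⊆ A}` (`Noise.exists_vectorMeasure`). To
construct it, enumerate the rational closed intervals `I i`. Countably many commuting projections
have a joint distribution in the state `f`, which is written down explicitly by splitting the
interval `[0, ‖f‖²)` again and again (`exists_joint_distribution`); thus there are events `X i`, to
be read as the events that the random set misses `I i`, with the correct joint probabilities. Almost surely these
answers are consistent and come from a compact set (`exists_compacts_of_missed`), because the noise
is continuous: the σ-fields of the complements of small neighbourhoods of a point generate
everything (`Noise.tendsto_pr_compl_Icc`). Continuity follows from separability: a monotone family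
of projections of a separable Hilbert space has at most countably many jumps, and the shifts
carry continuity from one moment of time to all others (`Noise.F_le_iSup_left`). The same continuity
extends the formula for the mass of `e(A)` from complements of rational intervals to all `A`, and
shows that a given point `t` almost surely does not belong to the random set.

*Existence.* The Gram–Schmidt procedure with cyclic subspaces decomposes `L₂(F_{-∞, ∞})` into a
countable orthogonal sum of spaces `L₂(ν n)`, each `ν n` being the spectral measure of a vector, in
which `E(· | F_A)` is multiplication by the indicator of `e(A)`
(`IsSpectralFamily.exists_linearIsometryEquiv`). With a probability measure `μ` equivalent to
`∑ n, ν n`, and `ν n = (w n)² μ`, the map `(z n) ↦ (w n · z n)` identifies this orthogonal sum with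
the direct integral over `μ` of the spaces of square summable sequences supported by
`{n | w n x ≠ 0}` (`componentField.decomposition`).

*Uniqueness.* In every decomposition the measure `‖f̂(C)‖² dμ(C)` gives mass `‖E(f | F_A)‖²` to
`e(A)`. The sets `e(A)` form a π-system that generates the Borel σ-field, so this measure does not
depend on the decomposition. A set is `μ`-negligible if and only if all these measures vanish on it,
since the fibres are nonzero (`IsSpectralMeasure.absolutelyContinuous`).
-/

/-! ### σ-fields modulo negligible sets -/

section AEClosure

variable {Ω : Type*} {mΩ : MeasurableSpace Ω} {P : Measure Ω}

/-- The completion of a σ-field by the sets that are `P`-almost everywhere equal to one of its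
members. -/
@[reducible]
def aeClosure (P : Measure Ω) (m : MeasurableSpace Ω) : MeasurableSpace Ω :=
  eventuallyMeasurableSpace m (ae P)

theorem le_aeClosure {m : MeasurableSpace Ω} : m ≤ aeClosure P m := le_eventuallyMeasurableSpace

theorem aeClosure_le_of_le {m₁ m₂ : MeasurableSpace Ω} (h : m₁ ≤ aeClosure P m₂) :
    aeClosure P m₁ ≤ aeClosure P m₂ := by
  rintro s ⟨t, ht, hst⟩
  obtain ⟨t', ht', h'⟩ := h t ht
  exact ⟨t', ht', hst.trans h'⟩

theorem aeClosure_mono {m₁ m₂ : MeasurableSpace Ω} (h : m₁ ≤ m₂) :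
    aeClosure P m₁ ≤ aeClosure P m₂ := aeClosure_le_of_le (h.trans le_aeClosure)

theorem indep_of_le_aeClosure {m₁ m₂ m₁' m₂' : MeasurableSpace Ω} (h : Indep m₁ m₂ P)
    (h₁ : m₁' ≤ aeClosure P m₁) (h₂ : m₂' ≤ aeClosure P m₂) : Indep m₁' m₂' P := by
  rw [Indep_iff] at h ⊢
  intro s t hs ht
  obtain ⟨s', hs', hss⟩ := h₁ s hs
  obtain ⟨t', ht', htt⟩ := h₂ t ht
  have h1 : P s = P s' := measure_congr hss
  have h2 : P t = P t' := measure_congr htt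
  have h3 : P (s ∩ t) = P (s' ∩ t') := measure_congr (hss.inter htt)
  rw [h1, h2, h3, h s' t' hs' ht']

/-- The intersections `s ∩ t`, `s ∈ m₁`, `t ∈ m₂`, form a π-system that generates `m₁ ⊔ m₂`. -/
theorem sup_eq_generateFrom_inter (m₁ m₂ : MeasurableSpace Ω) :
    m₁ ⊔ m₂ = MeasurableSpace.generateFrom
      {u | ∃ s t, MeasurableSet[m₁] s ∧ MeasurableSet[m₂] t ∧ u = s ∩ t} := by
  apply le_antisymm
  · refine sup_le (fun s hs => ?_) (fun s hs => ?_)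
    · exact MeasurableSpace.measurableSet_generateFrom
        ⟨s, Set.univ, hs, @MeasurableSet.univ _ m₂, by simp⟩
    · exact MeasurableSpace.measurableSet_generateFrom
        ⟨Set.univ, s, @MeasurableSet.univ _ m₁, hs, by simp⟩
  · refine MeasurableSpace.generateFrom_le ?_
    rintro _ ⟨s, t, hs, ht, rfl⟩
    exact @MeasurableSet.inter _ (m₁ ⊔ m₂) _ _ ((le_sup_left : m₁ ≤ m₁ ⊔ m₂) _ hs)
      ((le_sup_right : m₂ ≤ m₁ ⊔ m₂) _ ht)

theorem isPiSystem_inter (m₁ m₂ : MeasurableSpace Ω) :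
    IsPiSystem {u | ∃ s t, MeasurableSet[m₁] s ∧ MeasurableSet[m₂] t ∧ u = s ∩ t} := by
  rintro _ ⟨s, t, hs, ht, rfl⟩ _ ⟨s', t', hs', ht', rfl⟩ -
  exact ⟨s ∩ s', t ∩ t', @MeasurableSet.inter _ m₁ _ _ hs hs', @MeasurableSet.inter _ m₂ _ _ ht ht',
    Set.inter_inter_inter_comm _ _ _ _⟩

/-- If `a₁ ∨ b₁` is independent of `a₂ ∨ b₂`, `a₁` of `b₁`, and `a₂` of `b₂`, then
`a₁ ∨ a₂` is independent of `b₁ ∨ b₂`. -/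
theorem indep_sup_sup [IsProbabilityMeasure P] {a₁ a₂ b₁ b₂ : MeasurableSpace Ω}
    (ha₁ : a₁ ≤ mΩ) (ha₂ : a₂ ≤ mΩ) (hb₁ : b₁ ≤ mΩ) (hb₂ : b₂ ≤ mΩ)
    (h₁ : Indep a₁ b₁ P) (h₂ : Indep a₂ b₂ P) (h : Indep (a₁ ⊔ b₁) (a₂ ⊔ b₂) P) :
    Indep (a₁ ⊔ a₂) (b₁ ⊔ b₂) P := by
  refine IndepSets.indep (sup_le ha₁ ha₂) (sup_le hb₁ hb₂) (isPiSystem_inter a₁ a₂)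
    (isPiSystem_inter b₁ b₂) (sup_eq_generateFrom_inter _ _) (sup_eq_generateFrom_inter _ _) ?_
  rw [IndepSets_iff]
  rw [Indep_iff] at h₁ h₂ h
  rintro _ _ ⟨s₁, s₂, hs₁, hs₂, rfl⟩ ⟨t₁, t₂, ht₁, ht₂, rfl⟩
  have e₁ : MeasurableSet[a₁ ⊔ b₁] s₁ := (le_sup_left : a₁ ≤ a₁ ⊔ b₁) _ hs₁
  have e₂ : MeasurableSet[a₂ ⊔ b₂] s₂ := (le_sup_left : a₂ ≤ a₂ ⊔ b₂) _ hs₂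
  have e₃ : MeasurableSet[a₁ ⊔ b₁] t₁ := (le_sup_right : b₁ ≤ a₁ ⊔ b₁) _ ht₁
  have e₄ : MeasurableSet[a₂ ⊔ b₂] t₂ := (le_sup_right : b₂ ≤ a₂ ⊔ b₂) _ ht₂
  rw [Set.inter_inter_inter_comm, h _ _ (@MeasurableSet.inter _ (a₁ ⊔ b₁) _ _ e₁ e₃)
    (@MeasurableSet.inter _ (a₂ ⊔ b₂) _ _ e₂ e₄),
    h₁ _ _ hs₁ ht₁, h₂ _ _ hs₂ ht₂, h _ _ e₁ e₂, h _ _ e₃ e₄]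
  ring

end AEClosure

/-! ### Subspaces of square integrable functions measurable with respect to a σ-field -/

section LpMeas

variable {Ω : Type*} {m m₁ m₂ a b c d : MeasurableSpace Ω} {mΩ : MeasurableSpace Ω}
  {P : Measure Ω} {𝕜 : Type*} [RCLike 𝕜]

/-- A square integrable function whose integrals over a generating π-system and over the whole
space vanish has vanishing integrals over all sets of the generated σ-field. -/
theorem setIntegral_eq_zero_of_isPiSystem {f : Ω → 𝕜}
    (hf : Integrable f P) (hm : m ≤ mΩ)
    {𝒮 : Set (Set Ω)} (hgen : m = MeasurableSpace.generateFrom 𝒮) (hπ : IsPiSystem 𝒮)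
    (huniv : ∫ x, f x ∂P = 0) (h : ∀ s ∈ 𝒮, ∫ x in s, f x ∂P = 0) {s : Set Ω}
    (hs : MeasurableSet[m] s) : ∫ x in s, f x ∂P = 0 := by
  refine MeasurableSpace.induction_on_inter (m := m) (C := fun s _ => ∫ x in s, f x ∂P = 0)
    hgen hπ (by simp) h ?_ ?_ s hs
  · intro t ht h
    have := integral_add_compl (hm t ht) hf
    rw [h, huniv, zero_add] at this
    exact this
  · intro g hg hgm h
    rw [integral_iUnion (fun i => hm _ (hgm i)) hg hf.integrableOn]
    simp [h]

theorem isClosed_lpMeas (hm : m ≤ mΩ) :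
    IsClosed (lpMeas 𝕜 𝕜 m 2 P : Set (Lp 𝕜 2 P)) :=
  isClosed_aestronglyMeasurable hm

variable [IsFiniteMeasure P]

/-- The indicators of a π-system, together with the constants, are total in the space of square
integrable functions that are measurable with respect to the generated σ-field. -/
theorem lpMeas_le_of_isPiSystem (hm : m ≤ mΩ)
    {𝒮 : Set (Set Ω)} (hgen : m = MeasurableSpace.generateFrom 𝒮) (hπ : IsPiSystem 𝒮)
    (K : Submodule 𝕜 (Lp 𝕜 2 P)) (hK : IsClosed (K : Set (Lp 𝕜 2 P)))
    (huniv : indicatorConstLp 2 MeasurableSet.univ (measure_ne_top P _) (1 : 𝕜) ∈ K)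
    (h : ∀ s ∈ 𝒮, ∀ hs : MeasurableSet s,
      indicatorConstLp 2 hs (measure_ne_top P _) (1 : 𝕜) ∈ K) :
    lpMeas 𝕜 𝕜 m 2 P ≤ K := by
  have key : ∀ s (hs : MeasurableSet[m] s),
      indicatorConstLp 2 (hm s hs) (measure_ne_top P _) (1 : 𝕜) ∈ K := by
    intro s hs
    have hKc : K.topologicalClosure = K := hK.submodule_topologicalClosure_eq
    rw [← hKc, ← Submodule.orthogonal_orthogonal_eq_closure, Submodule.mem_orthogonal']
    intro g hg
    rw [L2.inner_indicatorConstLp_one]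
    have hgi : Integrable g P := (Lp.memLp g).integrable (by norm_num)
    refine setIntegral_eq_zero_of_isPiSystem hgi hm hgen hπ ?_ ?_ hs
    · have := (Submodule.mem_orthogonal _ _).1 hg _ huniv
      rwa [L2.inner_indicatorConstLp_one, Measure.restrict_univ] at this
    · intro t ht
      have htm : MeasurableSet[m] t := by
        rw [hgen]; exact MeasurableSpace.measurableSet_generateFrom ht
      have := (Submodule.mem_orthogonal _ _).1 hg _ (h t ht (hm t htm))
      rwa [L2.inner_indicatorConstLp_one] at this
  intro f hf
  refine Lp.induction_stronglyMeasurable hm (by norm_num) (fun f => f ∈ K) ?_ ?_ ?_ f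
    (mem_lpMeas_iff_aestronglyMeasurable.1 hf)
  · intro c s hs hμs
    have h1 : (Lp.simpleFunc.indicatorConst 2 (hm s hs) hμs.ne c : Lp 𝕜 2 P) =
        c • indicatorConstLp 2 (hm s hs) (measure_ne_top P _) (1 : 𝕜) := by
      rw [Lp.simpleFunc.coe_indicatorConst]
      refine Lp.ext (indicatorConstLp_coeFn.trans ?_)
      refine EventuallyEq.trans ?_ (Lp.coeFn_smul _ _).symm
      filter_upwards [indicatorConstLp_coeFn (p := 2) (hs := hm s hs) (hμs := measure_ne_top P s)
        (c := (1 : 𝕜))] with x hx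
      rw [Pi.smul_apply, hx]
      by_cases hxs : x ∈ s <;> simp [hxs]
    rw [h1]
    exact K.smul_mem _ (key s hs)
  · intro f g _ _ _ _ _ h1 h2
    exact K.add_mem h1 h2
  · exact hK.preimage continuous_subtype_val

theorem indicatorConstLp_mem_lpMeas {s : Set Ω}
    (hs : MeasurableSet s) (h : MeasurableSet[aeClosure P m] s) :
    indicatorConstLp 2 hs (measure_ne_top P _) (1 : 𝕜) ∈ lpMeas 𝕜 𝕜 m 2 P := by
  obtain ⟨t, ht, hst⟩ := h
  rw [mem_lpMeas_iff_aestronglyMeasurable]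
  refine ⟨t.indicator fun _ => (1 : 𝕜), (@stronglyMeasurable_const _ _ m _ _).indicator ht, ?_⟩
  exact indicatorConstLp_coeFn.trans (indicator_ae_eq_of_ae_eq_set hst)

/-- The subspace depends on the σ-field only modulo negligible sets. -/
theorem lpMeas_mono_of_le_aeClosure (h₁ : m₁ ≤ mΩ) (h₂ : m₂ ≤ mΩ)
    (h : m₁ ≤ aeClosure P m₂) : lpMeas 𝕜 𝕜 m₁ 2 P ≤ lpMeas 𝕜 𝕜 m₂ 2 P := by
  refine lpMeas_le_of_isPiSystem h₁ (@MeasurableSpace.generateFrom_measurableSet _ m₁).symm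
    (@MeasurableSpace.isPiSystem_measurableSet _ m₁) _ (isClosed_lpMeas h₂)
    (indicatorConstLp_mem_lpMeas _ .univ) fun s hs hs' => indicatorConstLp_mem_lpMeas _ (h s hs)

/-- The converse of `indicatorConstLp_mem_lpMeas`. -/
theorem measurableSet_aeClosure_of_indicatorConstLp_mem {s : Set Ω}
    (hs : MeasurableSet s)
    (h : indicatorConstLp 2 hs (measure_ne_top P _) (1 : 𝕜) ∈ lpMeas 𝕜 𝕜 m 2 P) :
    MeasurableSet[aeClosure P m] s := by
  rw [mem_lpMeas_iff_aestronglyMeasurable] at h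
  obtain ⟨g, hg, hfg⟩ := h
  refine ⟨g ⁻¹' {1}, hg.measurable (measurableSet_singleton _), ?_⟩
  filter_upwards [hfg, indicatorConstLp_coeFn (p := 2) (hs := hs) (hμs := measure_ne_top P s)
    (c := (1 : 𝕜))] with x hx hx'
  rw [hx'] at hx
  refine propext ⟨fun hxs => ?_, fun hxg => ?_⟩
  · have hxs' : x ∈ s := hxs
    have : g x = 1 := by rw [← hx, Set.indicator_of_mem hxs']
    exact this
  · have hxg' : g x = 1 := hxg
    by_contra hxs
    have hxs' : x ∉ s := hxs
    rw [hxg', Set.indicator_of_notMem hxs'] at hx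
    exact zero_ne_one hx

theorem inner_indicatorConstLp_indicatorConstLp {s t : Set Ω} (hs : MeasurableSet s)
    (ht : MeasurableSet t) :
    inner 𝕜 (indicatorConstLp 2 hs (measure_ne_top P _) (1 : 𝕜))
      (indicatorConstLp 2 ht (measure_ne_top P _) (1 : 𝕜)) = ((P.real (s ∩ t) : ℝ) : 𝕜) := by
  rw [L2.inner_indicatorConstLp_one, setIntegral_congr_ae (g := t.indicator fun _ => (1 : 𝕜)) hs
    (indicatorConstLp_coeFn.mono fun x hx _ => hx), setIntegral_indicator ht]
  simp [Measure.real, RCLike.real_smul_eq_coe_mul]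

/-- Let `a` be contained in `b` and let `c` be independent of `b`. Then the orthogonal projection
onto the `b`-measurable functions maps the `a ∨ c`-measurable functions to the `a`-measurable ones:
this is `E(gh | b) = g E(h)` for `g ∈ L₂(a)`, `h ∈ L₂(c)`. -/
theorem starProjection_mem_lpMeas [IsProbabilityMeasure P] (hb : b ≤ mΩ) (hc : c ≤ mΩ)
    (hd : d ≤ mΩ) (hab : a ≤ b)
    (hdac : d ≤ aeClosure P (a ⊔ c)) (hcb : Indep c b P)
    [(lpMeas 𝕜 𝕜 b 2 P).HasOrthogonalProjection] {f : Lp 𝕜 2 P} (hf : f ∈ lpMeas 𝕜 𝕜 d 2 P) :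
    (lpMeas 𝕜 𝕜 b 2 P).starProjection f ∈ lpMeas 𝕜 𝕜 a 2 P := by
  have ha : a ≤ mΩ := hab.trans hb
  have hac : a ⊔ c ≤ mΩ := sup_le ha hc
  let K : Submodule 𝕜 (Lp 𝕜 2 P) :=
    (lpMeas 𝕜 𝕜 a 2 P).comap (lpMeas 𝕜 𝕜 b 2 P).starProjection.toLinearMap
  have hK : IsClosed (K : Set (Lp 𝕜 2 P)) :=
    (isClosed_lpMeas ha).preimage (lpMeas 𝕜 𝕜 b 2 P).starProjection.continuous
  suffices h : lpMeas 𝕜 𝕜 (a ⊔ c) 2 P ≤ K from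
    h (lpMeas_mono_of_le_aeClosure hd hac hdac hf)
  have main : ∀ s t (hs : MeasurableSet[a] s) (ht : MeasurableSet[c] t)
      (hst : MeasurableSet (s ∩ t)),
      indicatorConstLp 2 hst (measure_ne_top P _) (1 : 𝕜) ∈ K := by
    intro s t hs ht hst
    have hsa : indicatorConstLp 2 (ha s hs) (measure_ne_top P _) (1 : 𝕜) ∈ lpMeas 𝕜 𝕜 a 2 P :=
      indicatorConstLp_mem_lpMeas _ (le_aeClosure s hs)
    have hproj : (lpMeas 𝕜 𝕜 b 2 P).starProjection
        (indicatorConstLp 2 hst (measure_ne_top P _) (1 : 𝕜)) =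
        ((P.real t : ℝ) : 𝕜) • indicatorConstLp 2 (ha s hs) (measure_ne_top P _) (1 : 𝕜) := by
      refine Submodule.eq_starProjection_of_mem_of_inner_eq_zero (K := lpMeas 𝕜 𝕜 b 2 P) ?_ ?_
      · exact Submodule.smul_mem _ _
          (lpMeas_mono_of_le_aeClosure ha hb (hab.trans le_aeClosure) hsa)
      · set w := indicatorConstLp 2 hst (measure_ne_top P _) (1 : 𝕜) -
          ((P.real t : ℝ) : 𝕜) • indicatorConstLp 2 (ha s hs) (measure_ne_top P _) (1 : 𝕜) with hw
        have hind : ∀ r (hr : MeasurableSet[b] r),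
            indicatorConstLp 2 (hb r hr) (measure_ne_top P _) (1 : 𝕜) ∈ (𝕜 ∙ w)ᗮ := by
          intro r hr
          rw [Submodule.mem_orthogonal_singleton_iff_inner_left, hw, inner_sub_right,
            inner_smul_right, inner_indicatorConstLp_indicatorConstLp,
            inner_indicatorConstLp_indicatorConstLp]
          have h1 := (Indep_iff _ _ _).1 hcb t (r ∩ s) ht
            (@MeasurableSet.inter _ b _ _ hr (hab s hs))
          have h2 : r ∩ (s ∩ t) = t ∩ (r ∩ s) := by
            rw [← Set.inter_assoc, Set.inter_comm]
          rw [h2, Measure.real, h1, ENNReal.toReal_mul]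
          simp [Measure.real]
        have hle : lpMeas 𝕜 𝕜 b 2 P ≤ (𝕜 ∙ w)ᗮ :=
          lpMeas_le_of_isPiSystem hb (@MeasurableSpace.generateFrom_measurableSet _ b).symm
            (@MeasurableSpace.isPiSystem_measurableSet _ b) _ (Submodule.isClosed_orthogonal _)
            (hind _ (@MeasurableSet.univ _ b)) fun r hr _ => hind r hr
        intro v hv
        exact (Submodule.mem_orthogonal_singleton_iff_inner_right).1 (hle hv)
    change (lpMeas 𝕜 𝕜 b 2 P).starProjection _ ∈ lpMeas 𝕜 𝕜 a 2 P
    rw [hproj]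
    exact Submodule.smul_mem _ _ hsa
  refine lpMeas_le_of_isPiSystem hac (sup_eq_generateFrom_inter a c) (isPiSystem_inter a c) K hK
    ?_ ?_
  · have := main Set.univ Set.univ (@MeasurableSet.univ _ a) (@MeasurableSet.univ _ c) (by simp)
    simpa using this
  · rintro _ ⟨s, t, hs, ht, rfl⟩ hst
    exact main s t hs ht hst

end LpMeas

/-! ### Sets cut into intervals by finitely many points -/

/-- A set of reals is determined by a finite set of cut points if every interval that avoids these
points lies inside the set or is disjoint from it. Elementary sets have this property, and, unlike
the definition by finite unions of intervals, it is visibly stable under complements. -/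
def HasFiniteCuts (A : Set ℝ) : Prop :=
  ∃ T : Finset ℝ, ∀ I : Set ℝ, I.OrdConnected → Disjoint I ↑T → I ⊆ A ∨ Disjoint I A

theorem HasFiniteCuts.compl {A : Set ℝ} (h : HasFiniteCuts A) : HasFiniteCuts Aᶜ := by
  obtain ⟨T, hT⟩ := h
  refine ⟨T, fun I hI hd => ?_⟩
  rcases hT I hI hd with h | h
  · exact Or.inr (Set.disjoint_compl_right_iff_subset.2 h)
  · exact Or.inl (Set.subset_compl_iff_disjoint_right.2 h)

theorem HasFiniteCuts.union {A B : Set ℝ} (hA : HasFiniteCuts A) (hB : HasFiniteCuts B) :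
    HasFiniteCuts (A ∪ B) := by
  obtain ⟨T, hT⟩ := hA
  obtain ⟨T', hT'⟩ := hB
  refine ⟨T ∪ T', fun I hI hd => ?_⟩
  rw [Finset.coe_union, Set.disjoint_union_right] at hd
  rcases hT I hI hd.1 with h | h
  · exact Or.inl (h.trans Set.subset_union_left)
  rcases hT' I hI hd.2 with h' | h'
  · exact Or.inl (h'.trans Set.subset_union_right)
  · exact Or.inr (Set.disjoint_union_right.2 ⟨h, h'⟩)

theorem HasFiniteCuts.inter {A B : Set ℝ} (hA : HasFiniteCuts A) (hB : HasFiniteCuts B) :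
    HasFiniteCuts (A ∩ B) := by
  rw [← compl_compl (A ∩ B), Set.compl_inter]
  exact (hA.compl.union hB.compl).compl

theorem hasFiniteCuts_empty : HasFiniteCuts ∅ := ⟨∅, fun _ _ _ => Or.inr (Set.disjoint_empty _)⟩

theorem hasFiniteCuts_univ : HasFiniteCuts Set.univ := ⟨∅, fun _ _ _ => Or.inl (Set.subset_univ _)⟩

theorem hasFiniteCuts_of_ordConnected {A : Set ℝ} (hA : A.OrdConnected) : HasFiniteCuts A := by
  -- For an unbounded `A` one of these cut points is the junk value `0`, which does no harm.
  refine ⟨{sInf A, sSup A}, fun I hI hd => ?_⟩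
  rw [or_iff_not_imp_right, Set.not_disjoint_iff]
  rintro ⟨x, hxI, hxA⟩ y hyI
  by_contra hyA
  rcases lt_trichotomy x y with hxy | hxy | hxy
  · have hb : ∀ z ∈ A, z ≤ y := fun z hz => by
      by_contra! hlt
      exact hyA (hA.out hxA hz ⟨hxy.le, hlt.le⟩)
    have h1 : x ≤ sSup A := le_csSup ⟨y, hb⟩ hxA
    have h2 : sSup A ≤ y := csSup_le ⟨x, hxA⟩ hb
    exact Set.disjoint_left.1 hd (hI.out hxI hyI ⟨h1, h2⟩) (by simp)
  · exact hyA (hxy ▸ hxA)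
  · have hb : ∀ z ∈ A, y ≤ z := fun z hz => by
      by_contra! hlt
      exact hyA (hA.out hz hxA ⟨hlt.le, hxy.le⟩)
    have h1 : sInf A ≤ x := csInf_le ⟨y, hb⟩ hxA
    have h2 : y ≤ sInf A := le_csInf ⟨x, hxA⟩ hb
    exact Set.disjoint_left.1 hd (hI.out hyI hxI ⟨h2, h1⟩) (by simp)

theorem IsElementary.hasFiniteCuts {A : Set ℝ} (hA : IsElementary A) : HasFiniteCuts A := by
  obtain ⟨S, hS, hI, rfl⟩ := hA
  induction S, hS using Set.Finite.induction_on with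
  | empty => simpa using hasFiniteCuts_empty
  | @insert I S _ _ ih =>
    rw [Set.sUnion_insert]
    exact (hasFiniteCuts_of_ordConnected (hI I (Set.mem_insert _ _))).union
      (ih fun J hJ => hI J (Set.mem_insert_of_mem _ hJ))

namespace Noise

variable {Ω : Type u} {m : MeasurableSpace Ω} [mΩ : MeasurableSpace Ω] {P : Measure Ω} (N : Noise P)

/-! ### The σ-fields of a noise and the projections onto them -/

theorem fieldTop_le : N.fieldTop ≤ mΩ :=
  iSup_le fun s => iSup_le fun t => iSup_le fun h => N.F_le s t h

theorem fieldOf_le (A : Set ℝ) : N.fieldOf A ≤ mΩ := (N.fieldOf_le_fieldTop A).trans N.fieldTop_le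

theorem F_le_fieldOf {s t : ℝ} {A : Set ℝ} (h : s ≤ t) (hA : Set.Ioo s t ⊆ A) :
    N.F s t ≤ N.fieldOf A :=
  le_iSup_of_le s (le_iSup_of_le t (le_iSup_of_le h (le_iSup_of_le hA le_rfl)))

theorem fieldOf_le_iff {A : Set ℝ} :
    N.fieldOf A ≤ m ↔ ∀ s t, s ≤ t → Set.Ioo s t ⊆ A → N.F s t ≤ m := by
  simp only [fieldOf, iSup_le_iff]

theorem fieldOf_mono {A B : Set ℝ} (h : A ⊆ B) : N.fieldOf A ≤ N.fieldOf B :=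
  N.fieldOf_le_iff.2 fun _ _ hst hA => N.F_le_fieldOf hst (hA.trans h)

theorem fieldOf_univ : N.fieldOf Set.univ = N.fieldTop := by
  simp [fieldOf, fieldTop]

/-- Being independent of itself, the σ-field `F s s` consists of sets of measure `0` or `1`. -/
theorem F_self_le [IsProbabilityMeasure P] (s : ℝ) :
    N.F s s ≤ aeClosure P m := by
  intro x hx
  have h := (Indep_iff _ _ _).1 (N.indep s s s le_rfl le_rfl) x x hx hx
  rw [Set.inter_self] at h
  have hm : MeasurableSet x := N.F_le s s le_rfl x hx
  rcases eq_or_ne (P x) 0 with h0 | h0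
  · exact ⟨∅, @MeasurableSet.empty _ m, ae_eq_empty.2 h0⟩
  · have h1 : P x = 1 := by
      have := (ENNReal.mul_eq_left h0 (measure_ne_top P x)).1 h.symm
      exact this
    exact ⟨Set.univ, @MeasurableSet.univ _ m,
      ae_eq_univ.2 ((prob_compl_eq_zero_iff hm).2 h1)⟩

theorem F_le_aeClosure_F {a s t b : ℝ} (has : a ≤ s) (hst : s ≤ t) (htb : t ≤ b) :
    N.F s t ≤ aeClosure P (N.F a b) := by
  have h1 : N.F s t ≤ aeClosure P (N.F s b) :=
    (le_sup_left.trans le_aeClosure).trans (N.generate s t b hst htb).le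
  have h2 : N.F s b ≤ aeClosure P (N.F a b) :=
    (le_sup_right.trans le_aeClosure).trans (N.generate a s b has (hst.trans htb)).le
  exact h1.trans (aeClosure_le_of_le h2)

/-- Removing a point from `A` does not diminish its σ-field: for `r ≤ t ≤ s` the σ-field
`F r s` is generated by `F r t` and `F t s`. -/
theorem fieldOf_le_sup_of_cut (A : Set ℝ) (t : ℝ) :
    N.fieldOf A ≤
      aeClosure P (N.fieldOf (A ∩ Set.Iio t) ⊔ N.fieldOf (A ∩ Set.Ioi t)) := by
  refine N.fieldOf_le_iff.2 fun r s hrs hA => ?_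
  rcases le_total s t with h | h
  · exact ((N.F_le_fieldOf hrs (Set.subset_inter hA
      (fun x hx => hx.2.trans_le h))).trans le_sup_left).trans le_aeClosure
  rcases le_total t r with h' | h'
  · exact ((N.F_le_fieldOf hrs (Set.subset_inter hA
      (fun x hx => h'.trans_lt hx.1))).trans le_sup_right).trans le_aeClosure
  · have h1 : N.F r t ≤ N.fieldOf (A ∩ Set.Iio t) := N.F_le_fieldOf h'
      fun x hx => ⟨hA ⟨hx.1, hx.2.trans_le h⟩, hx.2⟩
    have h2 : N.F t s ≤ N.fieldOf (A ∩ Set.Ioi t) := N.F_le_fieldOf h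
      fun x hx => ⟨hA ⟨h'.trans_lt hx.1, hx.2⟩, hx.1⟩
    exact (le_aeClosure.trans (N.generate r t s h' h).ge).trans
      (aeClosure_mono (sup_le_sup h1 h2))

theorem fieldOf_eq_iSup_of_monotone {A : Set ℝ} {B : ℕ → Set ℝ} (hBA : ∀ n, B n ⊆ A)
    (h : ∀ s t, s < t → Set.Ioo s t ⊆ A → ∃ n, Set.Ioo s t ⊆ B n) :
    N.fieldOf A = ⨆ n, N.fieldOf (B n) := by
  refine le_antisymm (N.fieldOf_le_iff.2 fun s t hst hA => ?_)
    (iSup_le fun n => N.fieldOf_mono (hBA n))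
  rcases hst.eq_or_lt with rfl | hlt
  · exact le_iSup_of_le 0 (N.F_le_fieldOf le_rfl (by simp))
  · obtain ⟨n, hn⟩ := h s t hlt hA
    exact le_iSup_of_le n (N.F_le_fieldOf hst hn)

/-- Cutting the line at finitely many points, a bound on the σ-fields of the pieces of `A` gives
a bound on the σ-field of `A`. -/
theorem fieldOf_inter_le_of_cuts {A : Set ℝ} (T : Finset ℝ) :
    ∀ J : Set ℝ, J.OrdConnected → (∀ I ⊆ J, I.OrdConnected → Disjoint I ↑T →
      N.fieldOf (A ∩ I) ≤ aeClosure P m) → N.fieldOf (A ∩ J) ≤ aeClosure P m := by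
  induction T using Finset.induction_on with
  | empty => exact fun J hJ h => h J subset_rfl hJ (by simp)
  | @insert t T _ ih =>
    intro J hJ h
    refine (N.fieldOf_le_sup_of_cut _ t).trans (aeClosure_le_of_le (sup_le ?_ ?_))
    · rw [Set.inter_assoc]
      refine ih _ (hJ.inter Set.ordConnected_Iio) fun I hIJ hI hd => ?_
      refine h I (hIJ.trans Set.inter_subset_left) hI ?_
      rw [Finset.coe_insert, Set.disjoint_insert_right]
      exact ⟨fun ht => lt_irrefl t (hIJ ht).2, hd⟩
    · rw [Set.inter_assoc]
      refine ih _ (hJ.inter Set.ordConnected_Ioi) fun I hIJ hI hd => ?_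
      refine h I (hIJ.trans Set.inter_subset_left) hI ?_
      rw [Finset.coe_insert, Set.disjoint_insert_right]
      exact ⟨fun ht => lt_irrefl t (hIJ ht).2, hd⟩

theorem fieldOf_le_of_cuts {A : Set ℝ} (T : Finset ℝ)
    (h : ∀ I : Set ℝ, I.OrdConnected → Disjoint I ↑T → N.fieldOf (A ∩ I) ≤ aeClosure P m) :
    N.fieldOf A ≤ aeClosure P m := by
  have := N.fieldOf_inter_le_of_cuts T Set.univ Set.ordConnected_univ fun I _ => h I
  rwa [Set.inter_univ] at this

/-- `F_A` is generated by `F_{A ∩ B}` and `F_{A \ B}`, if `B` is cut out by finitely many points. -/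
theorem fieldOf_le_sup_of_hasFiniteCuts (A : Set ℝ) {B : Set ℝ} (hB : HasFiniteCuts B) :
    N.fieldOf A ≤ aeClosure P (N.fieldOf (A ∩ B) ⊔ N.fieldOf (A \ B)) := by
  obtain ⟨T, hT⟩ := hB
  refine N.fieldOf_le_of_cuts T fun I hI hd => ?_
  rcases hT I hI hd with h | h
  · exact ((N.fieldOf_mono (Set.inter_subset_inter_right _ h)).trans le_sup_left).trans
      le_aeClosure
  · refine ((N.fieldOf_mono ?_).trans le_sup_right).trans le_aeClosure
    exact fun x hx => ⟨hx.1, Set.disjoint_left.1 h hx.2⟩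

instance factFieldOfLe (A : Set ℝ) : Fact (N.fieldOf A ≤ mΩ) := ⟨N.fieldOf_le A⟩

variable {𝕜 : Type} [RCLike 𝕜]

/-- The orthogonal projection of `L₂(Ω, P)` onto the functions measurable with respect to `F_A`,
that is, the conditional expectation `E(· | F_A)`. -/
noncomputable def pr (𝕜 : Type) [RCLike 𝕜] (A : Set ℝ) : Lp 𝕜 2 P →L[𝕜] Lp 𝕜 2 P :=
  (lpMeas 𝕜 𝕜 (N.fieldOf A) 2 P).starProjection

theorem pr_mem (A : Set ℝ) (f : Lp 𝕜 2 P) : N.pr 𝕜 A f ∈ lpMeas 𝕜 𝕜 (N.fieldOf A) 2 P :=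
  Submodule.starProjection_apply_mem _ _

theorem pr_eq_self {A : Set ℝ} {f : Lp 𝕜 2 P} (hf : f ∈ lpMeas 𝕜 𝕜 (N.fieldOf A) 2 P) :
    N.pr 𝕜 A f = f :=
  Submodule.starProjection_eq_self_iff.2 hf

theorem inner_pr_left (A : Set ℝ) (f g : Lp 𝕜 2 P) :
    inner 𝕜 (N.pr 𝕜 A f) g = inner 𝕜 f (N.pr 𝕜 A g) :=
  Submodule.inner_starProjection_left_eq_right _ _ _

variable [IsProbabilityMeasure P]

theorem fieldOf_Ioo_le {a b : ℝ} : N.fieldOf (Set.Ioo a b) ≤ aeClosure P (N.F a b) := by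
  refine N.fieldOf_le_iff.2 fun s t hst hA => ?_
  rcases hst.eq_or_lt with rfl | hlt
  · exact N.F_self_le _
  · obtain ⟨h1, h2⟩ := (Set.Ioo_subset_Ioo_iff hlt).1 hA
    exact N.F_le_aeClosure_F h1 hst h2

theorem fieldOf_empty_le : N.fieldOf ∅ ≤ aeClosure P m := by
  refine N.fieldOf_le_iff.2 fun s t hst hA => ?_
  rw [Set.subset_empty_iff, Set.Ioo_eq_empty_iff, not_lt] at hA
  obtain rfl := le_antisymm hst hA
  exact N.F_self_le _

theorem indep_fieldOf_Iio_Ioi (t : ℝ) :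
    Indep (N.fieldOf (Set.Iio t)) (N.fieldOf (Set.Ioi t)) P := by
  have h1 : N.fieldOf (Set.Iio t) = ⨆ n : ℕ, N.fieldOf (Set.Ioo (t - n) t) := by
    refine N.fieldOf_eq_iSup_of_monotone (fun n x hx => hx.2) fun r s hrs hA => ?_
    obtain ⟨n, hn⟩ := exists_nat_ge (t - r)
    exact ⟨n, fun x hx => ⟨by linarith [hx.1], hA hx⟩⟩
  have h2 : N.fieldOf (Set.Ioi t) = ⨆ n : ℕ, N.fieldOf (Set.Ioo t (t + n)) := by
    refine N.fieldOf_eq_iSup_of_monotone (fun n x hx => hx.1) fun r s hrs hA => ?_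
    obtain ⟨n, hn⟩ := exists_nat_ge (s - t)
    exact ⟨n, fun x hx => ⟨hA hx, by linarith [hx.2]⟩⟩
  rw [h1, h2]
  refine indep_iSup_of_monotone (fun n => ?_) (fun n => N.fieldOf_le _) (iSup_le fun n =>
    N.fieldOf_le _) fun n m hnm => N.fieldOf_mono (Set.Ioo_subset_Ioo_left ?_)
  · refine (indep_iSup_of_monotone (fun k => ?_) (fun n => N.fieldOf_le _)
      (N.fieldOf_le _) fun k m hkm => N.fieldOf_mono (Set.Ioo_subset_Ioo_right ?_)).symm
    · exact (indep_of_le_aeClosure (N.indep (t - n) t (t + k) (by simp) (by simp))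
        N.fieldOf_Ioo_le N.fieldOf_Ioo_le).symm
    · have : (k : ℝ) ≤ m := by exact_mod_cast hkm
      linarith
  · have : (n : ℝ) ≤ m := by exact_mod_cast hnm
    linarith

/-- Independence over disjoint sets, by induction on the number of cut points: each cut splits the
line into two half-lines, whose σ-fields are independent. -/
theorem indep_fieldOf_inter_of_cuts {A B : Set ℝ} (hAB : Disjoint A B) (T : Finset ℝ) :
    ∀ J : Set ℝ, J.OrdConnected → (∀ I ⊆ J, I.OrdConnected → Disjoint I ↑T →
      I ⊆ A ∨ Disjoint I A) → Indep (N.fieldOf (A ∩ J)) (N.fieldOf (B ∩ J)) P := by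
  induction T using Finset.induction_on with
  | empty =>
    intro J hJ h
    rcases h J subset_rfl hJ (by simp) with h | h
    · have : B ∩ J = ∅ := by
        rw [Set.inter_comm]; exact (hAB.mono_left h).inter_eq
      rw [this]
      exact indep_of_le_aeClosure (indep_bot_right _) le_aeClosure (N.fieldOf_empty_le)
    · rw [Set.inter_comm, h.inter_eq]
      exact indep_of_le_aeClosure (indep_bot_left _) (N.fieldOf_empty_le) le_aeClosure
  | @insert t T _ ih =>
    intro J hJ h
    refine indep_of_le_aeClosure (indep_sup_sup (N.fieldOf_le _) (N.fieldOf_le _) (N.fieldOf_le _)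
      (N.fieldOf_le _) ?_ ?_ ?_) (N.fieldOf_le_sup_of_cut _ t) (N.fieldOf_le_sup_of_cut _ t)
    · rw [Set.inter_assoc, Set.inter_assoc]
      refine ih _ (hJ.inter Set.ordConnected_Iio) fun I hIJ hI hd => ?_
      refine h I (hIJ.trans Set.inter_subset_left) hI ?_
      rw [Finset.coe_insert, Set.disjoint_insert_right]
      exact ⟨fun ht => lt_irrefl t (hIJ ht).2, hd⟩
    · rw [Set.inter_assoc, Set.inter_assoc]
      refine ih _ (hJ.inter Set.ordConnected_Ioi) fun I hIJ hI hd => ?_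
      refine h I (hIJ.trans Set.inter_subset_left) hI ?_
      rw [Finset.coe_insert, Set.disjoint_insert_right]
      exact ⟨fun ht => lt_irrefl t (hIJ ht).2, hd⟩
    · exact indep_of_le_aeClosure (N.indep_fieldOf_Iio_Ioi t)
        ((sup_le (N.fieldOf_mono Set.inter_subset_right)
          (N.fieldOf_mono Set.inter_subset_right)).trans le_aeClosure)
        ((sup_le (N.fieldOf_mono Set.inter_subset_right)
          (N.fieldOf_mono Set.inter_subset_right)).trans le_aeClosure)

/-- σ-fields of disjoint sets are independent, if one of the sets is cut out by finitely many
points. -/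
theorem indep_fieldOf {A B : Set ℝ} (hA : HasFiniteCuts A) (hAB : Disjoint A B) :
    Indep (N.fieldOf A) (N.fieldOf B) P := by
  obtain ⟨T, hT⟩ := hA
  have := N.indep_fieldOf_inter_of_cuts hAB T Set.univ Set.ordConnected_univ fun I _ => hT I
  rwa [Set.inter_univ, Set.inter_univ] at this

theorem lpMeas_fieldOf_mono {A B : Set ℝ} (h : N.fieldOf A ≤ aeClosure P (N.fieldOf B)) :
    lpMeas 𝕜 𝕜 (N.fieldOf A) 2 P ≤ lpMeas 𝕜 𝕜 (N.fieldOf B) 2 P :=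
  lpMeas_mono_of_le_aeClosure (N.fieldOf_le A) (N.fieldOf_le B) h

/-- The projections multiply as the sets intersect: `F_A` is generated by `F_{A ∩ B} ⊆ F_B` and by
`F_{A \ B}`, which is independent of `F_B`. -/
theorem pr_pr (A : Set ℝ) {B : Set ℝ} (hB : HasFiniteCuts B) (f : Lp 𝕜 2 P) :
    N.pr 𝕜 B (N.pr 𝕜 A f) = N.pr 𝕜 (A ∩ B) f := by
  symm
  refine Submodule.eq_starProjection_of_mem_of_inner_eq_zero ?_ fun w hw => ?_
  · exact starProjection_mem_lpMeas (N.fieldOf_le B) (N.fieldOf_le (A \ B)) (N.fieldOf_le A)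
      (N.fieldOf_mono Set.inter_subset_right) (N.fieldOf_le_sup_of_hasFiniteCuts A hB)
      (N.indep_fieldOf hB Set.disjoint_sdiff_right).symm (N.pr_mem A f)
  · rw [inner_sub_left, inner_pr_left, inner_pr_left, N.pr_eq_self (A := B), N.pr_eq_self (A := A),
      sub_self]
    · exact N.lpMeas_fieldOf_mono
        ((N.fieldOf_mono Set.inter_subset_left).trans le_aeClosure) hw
    · exact N.lpMeas_fieldOf_mono
        ((N.fieldOf_mono Set.inter_subset_right).trans le_aeClosure) hw

theorem coe_condExpL2 (A : Set ℝ) (f : N.L2 𝕜) :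
    ((N.condExpL2 A f : N.L2 𝕜) : Lp 𝕜 2 P) = N.pr 𝕜 A f := by
  refine Lp.ext ((N.memLp_condExp A f).coeFn_toLp.trans ?_)
  have h := (Lp.memLp (f : Lp 𝕜 2 P)).condExpL2_ae_eq_condExp (𝕜 := 𝕜) (N.fieldOf_le A)
  rw [Lp.toLp_coeFn] at h
  exact h.symm

end Noise

/-! ### Continuity of a noise -/

section

variable {Ω : Type*} {m : ℕ → MeasurableSpace Ω} {mΩ : MeasurableSpace Ω} {P : Measure Ω}
  {𝕜 : Type*} [RCLike 𝕜] [IsFiniteMeasure P]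

/-- The union of the subspaces of an increasing sequence of σ-fields is dense in the subspace of the
generated σ-field. -/
theorem lpMeas_iSup_le (hm : ∀ n, m n ≤ mΩ) (hmono : Monotone m)
    (K : Submodule 𝕜 (Lp 𝕜 2 P)) (hK : IsClosed (K : Set (Lp 𝕜 2 P)))
    (h : ∀ n, lpMeas 𝕜 𝕜 (m n) 2 P ≤ K) : lpMeas 𝕜 𝕜 (⨆ n, m n) 2 P ≤ K := by
  refine lpMeas_le_of_isPiSystem (iSup_le hm)
    (MeasurableSpace.generateFrom_iUnion_measurableSet m).symm
    (isPiSystem_iUnion_of_monotone _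
      (fun n => @MeasurableSpace.isPiSystem_measurableSet _ (m n))
      fun i j hij s hs => hmono hij s hs) K hK ?_ ?_
  · exact h 0 (indicatorConstLp_mem_lpMeas _ (@MeasurableSet.univ _ (aeClosure P (m 0))))
  · intro s hs hs'
    obtain ⟨n, hn⟩ := Set.mem_iUnion.1 hs
    exact h n (indicatorConstLp_mem_lpMeas _ (le_aeClosure s hn))

end

/-- For equicontinuous operators, convergence is preserved under limits of the argument. -/
theorem tendsto_of_mem_closure_of_norm_le {𝕜 E ι : Type*} [RCLike 𝕜] [NormedAddCommGroup E]
    [NormedSpace 𝕜 E] {l : Filter ι} {Q : ι → E →L[𝕜] E} {R : E →L[𝕜] E}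
    (hQ : ∀ i x, ‖Q i x‖ ≤ ‖x‖) (hR : ∀ x, ‖R x‖ ≤ ‖x‖) {S : Set E}
    (hS : ∀ x ∈ S, Tendsto (fun i => Q i x) l (nhds (R x))) {x : E} (hx : x ∈ closure S) :
    Tendsto (fun i => Q i x) l (nhds (R x)) := by
  rw [Metric.tendsto_nhds]
  intro ε hε
  obtain ⟨y, hy, hxy⟩ := Metric.mem_closure_iff.1 hx (ε / 3) (by positivity)
  filter_upwards [Metric.tendsto_nhds.1 (hS y hy) (ε / 3) (by positivity)] with i hi
  have h1 : dist (Q i x) (Q i y) ≤ dist x y := by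
    rw [dist_eq_norm, dist_eq_norm, ← map_sub]; exact hQ i _
  have h2 : dist (R y) (R x) ≤ dist x y := by
    rw [dist_comm, dist_eq_norm, dist_eq_norm, ← map_sub]; exact hR _
  calc dist (Q i x) (R x) ≤ dist (Q i x) (Q i y) + dist (Q i y) (R y) + dist (R y) (R x) :=
        dist_triangle4 _ _ _ _
    _ < ε := by linarith

namespace Noise

variable {Ω : Type u} {m : MeasurableSpace Ω} [mΩ : MeasurableSpace Ω] {P : Measure Ω}
  (N : Noise P) {𝕜 : Type} [RCLike 𝕜]

theorem norm_pr_le (A : Set ℝ) (f : Lp 𝕜 2 P) : ‖N.pr 𝕜 A f‖ ≤ ‖f‖ :=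
  Submodule.norm_starProjection_apply_le _ _

theorem norm_sq_eq_norm_pr_sq_add (A : Set ℝ) (f : Lp 𝕜 2 P) :
    ‖f‖ ^ 2 = ‖N.pr 𝕜 A f‖ ^ 2 + ‖f - N.pr 𝕜 A f‖ ^ 2 := by
  have h := (lpMeas 𝕜 𝕜 (N.fieldOf A) 2 P).norm_sq_eq_add_norm_sq_starProjection f
  rw [Submodule.starProjection_orthogonal_val] at h
  exact h

/-- The time reversal of a noise. -/
def reverse : Noise P where
  T t := N.T (-t)
  F s t := N.F (-t) (-s)
  measurePreserving t := N.measurePreserving (-t)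
  T_zero := by rw [neg_zero]; exact N.T_zero
  T_add s t := by rw [neg_add]; exact N.T_add _ _
  F_le s t h := N.F_le _ _ (neg_le_neg h)
  shift t r s h := by
    have := N.shift (-t) (-s) (-r) (neg_le_neg h)
    rwa [← neg_add, ← neg_add] at this
  indep r s t h h' := (N.indep _ _ _ (neg_le_neg h') (neg_le_neg h)).symm
  generate r s t h h' := by
    rw [sup_comm]; exact N.generate _ _ _ (neg_le_neg h') (neg_le_neg h)

theorem pr_univ {f : Lp 𝕜 2 P} (hf : f ∈ lpMeas 𝕜 𝕜 N.fieldTop 2 P) :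
    N.pr 𝕜 Set.univ f = f :=
  N.pr_eq_self (by rwa [N.fieldOf_univ])

variable [IsProbabilityMeasure P]

theorem lpMeas_fieldTop_le_of_iSup {D : ℕ → Set ℝ} (hD : Monotone D)
    (hgen : N.fieldTop ≤ aeClosure P (⨆ n, N.fieldOf (D n)))
    (K : Submodule 𝕜 (Lp 𝕜 2 P)) (hK : IsClosed (K : Set (Lp 𝕜 2 P)))
    (h : ∀ n, lpMeas 𝕜 𝕜 (N.fieldOf (D n)) 2 P ≤ K) : lpMeas 𝕜 𝕜 N.fieldTop 2 P ≤ K :=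
  (lpMeas_mono_of_le_aeClosure N.fieldTop_le (iSup_le fun n => N.fieldOf_le (D n)) hgen).trans
    (lpMeas_iSup_le (fun n => N.fieldOf_le (D n)) (fun _ _ h => N.fieldOf_mono (hD h)) K hK h)

/-- If the σ-fields of an increasing sequence of sets `D n` generate everything, and the sets `B k`
agree with `A` on `D n` for `k ≥ n`, then the projections for `B k` converge to that for `A`. -/
theorem tendsto_pr {D B : ℕ → Set ℝ} {A : Set ℝ} (hD : Monotone D)
    (hgen : N.fieldTop ≤ aeClosure P (⨆ n, N.fieldOf (D n)))
    (hB : ∀ k, HasFiniteCuts (B k)) (hA : HasFiniteCuts A)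
    (h : ∀ n k, n ≤ k → D n ∩ B k = D n ∩ A) {f : Lp 𝕜 2 P}
    (hf : f ∈ lpMeas 𝕜 𝕜 N.fieldTop 2 P) :
    Tendsto (fun k => N.pr 𝕜 (B k) f) atTop (nhds (N.pr 𝕜 A f)) := by
  let V : Submodule 𝕜 (Lp 𝕜 2 P) :=
    { carrier := {f | Tendsto (fun k => N.pr 𝕜 (B k) f) atTop (nhds (N.pr 𝕜 A f))}
      add_mem' := fun {f g} hf hg => by
        simp only [Set.mem_ofPred_eq, map_add] at *; exact hf.add hg
      zero_mem' := by simp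
      smul_mem' := fun c f hf => by
        simp only [Set.mem_ofPred_eq, map_smul] at *; exact hf.const_smul c }
  have hV : IsClosed (V : Set (Lp 𝕜 2 P)) := by
    refine isClosed_of_closure_subset fun x hx => ?_
    exact tendsto_of_mem_closure_of_norm_le (fun k => N.norm_pr_le (B k)) (N.norm_pr_le A)
      (fun y hy => hy) hx
  refine N.lpMeas_fieldTop_le_of_iSup hD hgen V hV (fun n f hf => ?_) hf
  refine tendsto_const_nhds.congr' ?_
  filter_upwards [eventually_ge_atTop n] with k hk
  rw [← N.pr_eq_self hf, N.pr_pr _ (hB k), N.pr_pr _ hA, h n k hk]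

theorem norm_pr_sub_pr_sq {A B : Set ℝ} (hA : HasFiniteCuts A) (hAB : A ⊆ B) (f : Lp 𝕜 2 P) :
    ‖N.pr 𝕜 B f - N.pr 𝕜 A f‖ ^ 2 = ‖N.pr 𝕜 B f‖ ^ 2 - ‖N.pr 𝕜 A f‖ ^ 2 := by
  have h := N.norm_sq_eq_norm_pr_sq_add A (N.pr 𝕜 B f)
  rw [N.pr_pr B hA, Set.inter_eq_right.2 hAB] at h
  linarith

theorem norm_pr_mono {A B : Set ℝ} (hA : HasFiniteCuts A) (hAB : A ⊆ B) (f : Lp 𝕜 2 P) :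
    ‖N.pr 𝕜 A f‖ ^ 2 ≤ ‖N.pr 𝕜 B f‖ ^ 2 := by
  have := N.norm_pr_sub_pr_sq hA hAB f
  nlinarith [sq_nonneg ‖N.pr 𝕜 B f - N.pr 𝕜 A f‖]

/-- The projections for the half-lines `(-∞, s)` are left continuous in `s` at some point `t₀`: for
each vector of a dense sequence the monotone function `s ↦ ‖E(f | F_{(-∞, s)})‖²` has at most
countably many discontinuities. -/
theorem exists_tendsto_pr_Iio [MeasureTheory.IsSeparable P] : ∃ t₀ : ℝ, ∀ f : Lp ℝ 2 P,
    Tendsto (fun s => N.pr ℝ (Set.Iio s) f) (nhdsWithin t₀ (Set.Iio t₀))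
      (nhds (N.pr ℝ (Set.Iio t₀) f)) := by
  have : Fact ((2 : ℝ≥0∞) ≠ ∞) := ⟨by norm_num⟩
  have hcuts : ∀ s : ℝ, HasFiniteCuts (Set.Iio s) := fun s =>
    hasFiniteCuts_of_ordConnected Set.ordConnected_Iio
  let g : ℕ → ℝ → ℝ := fun n s => ‖N.pr ℝ (Set.Iio s) (denseSeq (Lp ℝ 2 P) n)‖ ^ 2
  have hg : ∀ n, Monotone (g n) := fun n s t hst =>
    N.norm_pr_mono (hcuts s) (Set.Iio_subset_Iio hst) _
  have hcount : (⋃ n, {s | ¬ContinuousAt (g n) s}).Countable :=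
    Set.countable_iUnion fun n => (hg n).countable_not_continuousAt
  obtain ⟨t₀, ht₀⟩ : ∃ t₀, t₀ ∉ ⋃ n, {s | ¬ContinuousAt (g n) s} := by
    by_contra! hall
    have : (Set.univ : Set ℝ).Countable := hcount.mono fun x _ => hall x
    exact Cardinal.not_countable_real this
  simp only [Set.mem_iUnion, Set.mem_ofPred_eq, not_exists, not_not] at ht₀
  refine ⟨t₀, fun f => ?_⟩
  refine tendsto_of_mem_closure_of_norm_le (Q := fun s => N.pr ℝ (Set.Iio s))
    (S := Set.range (denseSeq (Lp ℝ 2 P))) (fun k => N.norm_pr_le _)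
    (N.norm_pr_le _) ?_ (denseRange_denseSeq _ f)
  rintro _ ⟨n, rfl⟩
  rw [tendsto_iff_norm_sub_tendsto_zero]
  have h1 : Tendsto (fun s => Real.sqrt (g n t₀ - g n s)) (nhdsWithin t₀ (Set.Iio t₀))
      (nhds 0) := by
    have := (tendsto_const_nhds (x := g n t₀)).sub ((ht₀ n).tendsto.mono_left
      (nhdsWithin_le_nhds (s := Set.Iio t₀)))
    rw [sub_self] at this
    simpa using this.sqrt
  refine h1.congr' ?_
  filter_upwards [self_mem_nhdsWithin] with s hs
  rw [← N.norm_pr_sub_pr_sq (hcuts s) (Set.Iio_subset_Iio (le_of_lt hs)), Real.sqrt_sq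
    (norm_nonneg _), norm_sub_rev]

/-- Left continuity: `F r t` is generated by the `F r s` with `s < t`. -/
theorem F_le_iSup_left [MeasureTheory.IsSeparable P] {r t : ℝ} (hrt : r < t) :
    N.F r t ≤ aeClosure P (⨆ (s : ℝ) (_ : r ≤ s) (_ : s < t), N.F r s) := by
  obtain ⟨t₀, ht₀⟩ := N.exists_tendsto_pr_Iio
  have main : ∀ r < t₀, N.F r t₀ ≤ aeClosure P (⨆ (s : ℝ) (_ : r ≤ s) (_ : s < t₀), N.F r s) := by
    intro r hr x hx
    have hM : (⨆ (s : ℝ) (_ : r ≤ s) (_ : s < t₀), N.F r s) ≤ mΩ :=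
      iSup_le fun s => iSup_le fun h => iSup_le fun _ => N.F_le r s h
    have hxm : MeasurableSet x := N.F_le r t₀ hr.le x hx
    refine measurableSet_aeClosure_of_indicatorConstLp_mem (𝕜 := ℝ) hxm ?_
    set f := indicatorConstLp 2 hxm (measure_ne_top P _) (1 : ℝ)
    have hf : N.pr ℝ (Set.Ioo r t₀) f = f := N.pr_eq_self (indicatorConstLp_mem_lpMeas _
      (le_aeClosure x (N.F_le_fieldOf hr.le subset_rfl x hx)))
    have hlim := ht₀ f
    have hf' : N.pr ℝ (Set.Iio t₀) f = f := by
      rw [← hf, N.pr_pr _ (hasFiniteCuts_of_ordConnected Set.ordConnected_Iio),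
        Set.inter_eq_left.2 fun y hy => hy.2]
    rw [hf'] at hlim
    refine (isClosed_lpMeas hM).mem_of_tendsto hlim ?_
    filter_upwards [Ioo_mem_nhdsLT hr] with s hs
    have h2 : Set.Ioo r t₀ ∩ Set.Iio s = Set.Ioo r s := by
      ext y; simp only [Set.mem_inter_iff, Set.mem_Ioo, Set.mem_Iio]
      exact ⟨fun h => ⟨h.1.1, h.2⟩, fun h => ⟨⟨h.1, h.2.trans hs.2⟩, h.2⟩⟩
    rw [← hf, N.pr_pr _ (hasFiniteCuts_of_ordConnected Set.ordConnected_Iio), h2]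
    refine lpMeas_mono_of_le_aeClosure (N.fieldOf_le _) hM ?_ (N.pr_mem _ _)
    exact N.fieldOf_Ioo_le.trans (aeClosure_mono
      (le_iSup_of_le s (le_iSup_of_le hs.1.le (le_iSup_of_le hs.2 le_rfl))))
  -- The shift by `t₀ - t` carries left continuity from `t₀` to `t`.
  set u := t₀ - t with hu
  have e : t + u = t₀ := by rw [hu]; ring
  have h1 : N.F r t ≤ aeClosure P ((N.F (r + u) t₀).comap (N.T u)) := by
    have := N.shift u r t hrt.le
    rw [e] at this
    exact le_aeClosure.trans this.ge
  refine h1.trans (aeClosure_le_of_le ?_)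
  rintro _ ⟨b, hb, rfl⟩
  obtain ⟨b', hb', hbb⟩ := main (r + u) (by linarith) b hb
  have h2 : (N.T u) ⁻¹' b =ᵐ[P] (N.T u) ⁻¹' b' :=
    (N.measurePreserving u).quasiMeasurePreserving.preimage_ae_eq hbb
  have h3 : (⨆ (s : ℝ) (_ : r + u ≤ s) (_ : s < t₀), N.F (r + u) s).comap (N.T u) ≤
      aeClosure P (⨆ (s : ℝ) (_ : r ≤ s) (_ : s < t), N.F r s) := by
    simp only [MeasurableSpace.comap_iSup, iSup_le_iff]
    intro s hs hst
    have h4 := N.shift u r (s - u) (by linarith)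
    rw [sub_add_cancel] at h4
    refine (le_aeClosure.trans h4.le).trans (aeClosure_mono ?_)
    exact le_iSup_of_le (s - u) (le_iSup_of_le (by linarith) (le_iSup_of_le (by linarith) le_rfl))
  obtain ⟨b'', hb'', h5⟩ := h3 _ ⟨b', hb', rfl⟩
  exact ⟨b'', hb'', h2.trans h5⟩

/-- Right continuity: `F s t` is generated by the `F r t` with `r > s`. -/
theorem F_le_iSup_right [MeasureTheory.IsSeparable P] {s t : ℝ} (hst : s < t) :
    N.F s t ≤ aeClosure P (⨆ (r : ℝ) (_ : r ≤ t) (_ : s < r), N.F r t) := by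
  have h := N.reverse.F_le_iSup_left (neg_lt_neg hst)
  have e : N.reverse.F (-t) (-s) = N.F s t := by simp [reverse]
  rw [e] at h
  refine h.trans (aeClosure_mono (iSup_le fun r => iSup_le fun h1 => iSup_le fun h2 => ?_))
  have e' : N.reverse.F (-t) r = N.F (-r) t := by simp [reverse]
  rw [e']
  exact le_iSup_of_le (-r) (le_iSup_of_le (by linarith) (le_iSup_of_le (by linarith) le_rfl))

/-- `F r s` is generated by the `F r' s'` with `[r', s'] ⊆ (r, s)`. -/
theorem F_le_of_inner [MeasureTheory.IsSeparable P] {r s : ℝ} (hrs : r ≤ s)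
    (h : ∀ r' s', r < r' → r' < s' → s' < s → N.F r' s' ≤ aeClosure P m) :
    N.F r s ≤ aeClosure P m := by
  rcases hrs.eq_or_lt with rfl | hlt
  · exact N.F_self_le _
  refine (N.F_le_iSup_left hlt).trans (aeClosure_le_of_le ?_)
  refine iSup_le fun s' => iSup_le fun hrs' => iSup_le fun hs' => ?_
  rcases hrs'.eq_or_lt with rfl | hlt'
  · exact N.F_self_le _
  refine (N.F_le_iSup_right hlt').trans (aeClosure_le_of_le ?_)
  refine iSup_le fun r' => iSup_le fun hrs'' => iSup_le fun hr' => ?_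
  rcases hrs''.eq_or_lt with rfl | hlt''
  · exact N.F_self_le _
  · exact h r' s' hr' hlt'' hs'

/-- No information is located at a single point. -/
theorem pr_compl_singleton {f : Lp 𝕜 2 P} (hf : f ∈ lpMeas 𝕜 𝕜 N.fieldTop 2 P) (t : ℝ) :
    N.pr 𝕜 {t}ᶜ f = f := by
  refine N.pr_eq_self (lpMeas_mono_of_le_aeClosure N.fieldTop_le (N.fieldOf_le _) ?_ hf)
  rw [← N.fieldOf_univ]
  refine (N.fieldOf_le_sup_of_cut _ t).trans (aeClosure_mono (sup_le ?_ ?_))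
  · exact N.fieldOf_mono fun x hx => (ne_of_lt hx.2 : x ≠ t)
  · exact N.fieldOf_mono fun x hx => (ne_of_gt hx.2 : x ≠ t)

/-- The σ-fields of the complements of small neighbourhoods of a point generate everything, hence
the projections for these complements converge to the identity. -/
theorem tendsto_pr_compl_Icc [MeasureTheory.IsSeparable P] {f : Lp 𝕜 2 P}
    (hf : f ∈ lpMeas 𝕜 𝕜 N.fieldTop 2 P) (t : ℝ) :
    Tendsto (fun k : ℕ => N.pr 𝕜 (Set.Icc (t - 1 / (k + 1)) (t + 1 / (k + 1)))ᶜ f) atTop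
      (nhds f) := by
  have hanti : ∀ {k l : ℕ}, k ≤ l → (1 : ℝ) / (l + 1) ≤ 1 / (k + 1) := fun h =>
    one_div_le_one_div_of_le (by positivity) (by exact_mod_cast Nat.succ_le_succ h)
  have hmono : Monotone fun k : ℕ => (Set.Icc (t - 1 / ((k : ℝ) + 1)) (t + 1 / (k + 1)))ᶜ :=
    fun k l h => Set.compl_subset_compl.2 (Set.Icc_subset_Icc (by linarith [hanti h])
      (by linarith [hanti h]))
  conv => enter [3]; rw [← N.pr_univ hf]
  refine N.tendsto_pr hmono ?_ (fun k => (hasFiniteCuts_of_ordConnected Set.ordConnected_Icc).compl)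
    hasFiniteCuts_univ (fun n k hnk => ?_) hf
  · rw [← N.fieldOf_univ]
    refine N.fieldOf_le_of_cuts {t} fun I hI hd => N.fieldOf_le_iff.2 fun r s hrs hA => ?_
    refine N.F_le_of_inner hrs fun r' s' hr hrs' hs => ?_
    rw [Finset.coe_singleton, Set.disjoint_singleton_right] at hd
    have ht : t ≤ r ∨ s ≤ t := by
      by_contra! hcon
      exact hd (hA hcon).2
    obtain ⟨k, hk⟩ : ∃ k : ℕ, t + 1 / ((k : ℝ) + 1) ≤ r' ∨ s' ≤ t - 1 / ((k : ℝ) + 1) := by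
      rcases ht with ht | ht
      · obtain ⟨k, hk⟩ := exists_nat_one_div_lt (sub_pos.2 (ht.trans_lt hr))
        exact ⟨k, Or.inl (by linarith)⟩
      · obtain ⟨k, hk⟩ := exists_nat_one_div_lt (sub_pos.2 (hs.trans_le ht))
        exact ⟨k, Or.inr (by linarith)⟩
    refine ((N.F_le_fieldOf hrs'.le ?_).trans (le_iSup_of_le k le_rfl)).trans le_aeClosure
    intro x hx hx'
    rcases hk with hk | hk
    · linarith [hx.1, hx'.2]
    · linarith [hx.2, hx'.1]
  · rw [Set.inter_univ, Set.inter_eq_left]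
    exact hmono hnk

theorem tendsto_pr_Ioo {f : Lp 𝕜 2 P} (hf : f ∈ lpMeas 𝕜 𝕜 N.fieldTop 2 P) :
    Tendsto (fun k : ℕ => N.pr 𝕜 (Set.Ioo (-(k : ℝ)) k) f) atTop (nhds f) := by
  have hmono : Monotone fun k : ℕ => Set.Ioo (-(k : ℝ)) k := fun k l h => by
    have : (k : ℝ) ≤ l := by exact_mod_cast h
    exact Set.Ioo_subset_Ioo (by linarith) this
  conv => enter [3]; rw [← N.pr_univ hf]
  refine N.tendsto_pr hmono ?_ (fun k => hasFiniteCuts_of_ordConnected Set.ordConnected_Ioo)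
    hasFiniteCuts_univ (fun n k hnk => ?_) hf
  · rw [← N.fieldOf_univ, N.fieldOf_eq_iSup_of_monotone (fun n => Set.subset_univ _)]
    · exact le_aeClosure
    · intro s t _ _
      obtain ⟨n, hn⟩ := exists_nat_ge (max (-s) t)
      refine ⟨n, Set.Ioo_subset_Ioo ?_ ?_⟩ <;> linarith [le_max_left (-s) t, le_max_right (-s) t]
  · rw [Set.inter_univ, Set.inter_eq_left]
    exact hmono hnk

end Noise

/-! ### Joint distribution of commuting projections -/

section RandomBits

variable {𝕜 H : Type*} [RCLike 𝕜] [NormedAddCommGroup H] [InnerProductSpace 𝕜 H]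

/-- The product of those of the first `K` operators `Q i` for which `S i` holds. -/
noncomputable def selectedProd : (ℕ → H →ₗ[𝕜] H) → (ℕ → Prop) → ℕ → H →ₗ[𝕜] H
  | _, _, 0 => LinearMap.id
  | Q, S, K + 1 => open scoped Classical in
      selectedProd (fun i => Q (i + 1)) (fun i => S (i + 1)) K ∘ₗ
        (if S 0 then Q 0 else LinearMap.id)

/-- Simultaneous simulation of commuting projections `Q i` in a state `g`. The interval
`[0, ‖g‖²)` is split into an initial part of length `‖Q 0 g‖²`, where the bit number `0` is on, and
a rest of length `‖g - Q 0 g‖²`; both parts are split further, with `Q 1`, `Q 2`, … applied to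
`Q 0 g` on the former and to `g - Q 0 g` on the latter. -/
def simulatedBit : (ℕ → H →ₗ[𝕜] H) → ℕ → ℝ → H → Prop
  | Q, 0, r, g => r < ‖Q 0 g‖ ^ 2
  | Q, k + 1, r, g =>
      (r < ‖Q 0 g‖ ^ 2 ∧ simulatedBit (fun i => Q (i + 1)) k r (Q 0 g)) ∨
      (‖Q 0 g‖ ^ 2 ≤ r ∧
        simulatedBit (fun i => Q (i + 1)) k (r - ‖Q 0 g‖ ^ 2) (g - Q 0 g))

theorem measurableSet_simulatedBit (k : ℕ) : ∀ (Q : ℕ → H →ₗ[𝕜] H) (g : H),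
    MeasurableSet {r | simulatedBit Q k r g} := by
  induction k with
  | zero => exact fun Q g => measurableSet_Iio
  | succ k ih =>
    intro Q g
    have h2 : MeasurableSet ((fun r : ℝ => r - ‖Q 0 g‖ ^ 2) ⁻¹'
        {r | simulatedBit (fun i => Q (i + 1)) k r (g - Q 0 g)}) :=
      (measurable_id.sub_const _) (ih _ _)
    exact (measurableSet_Iio.inter (ih (fun i => Q (i + 1)) (Q 0 g))).union
      (measurableSet_Ici.inter h2)

theorem selectedProd_comm (K : ℕ) : ∀ (Q : ℕ → H →ₗ[𝕜] H) (S : ℕ → Prop) (R : H →ₗ[𝕜] H),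
    (∀ i g, Q i (R g) = R (Q i g)) → ∀ g, selectedProd Q S K (R g) = R (selectedProd Q S K g) := by
  induction K with
  | zero => exact fun _ _ _ _ _ => rfl
  | succ K ih =>
    intro Q S R hR g
    simp only [selectedProd, LinearMap.comp_apply]
    split_ifs with h
    · rw [hR, ih _ _ R fun i => hR (i + 1)]
    · exact ih _ _ R (fun i => hR (i + 1)) g

/-- The simulated bits have the joint distribution of the projections. If `S 0` fails, the two parts
of the splitting contribute `‖Q 0 h‖²` and `‖h - Q 0 h‖²`, where `h` is the product of the selected
operators applied to `g`. -/
theorem volume_simulatedBit (K : ℕ) : ∀ (Q : ℕ → H →ₗ[𝕜] H) (S : ℕ → Prop) (g : H),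
    (∀ i j g, Q i (Q j g) = Q j (Q i g)) →
    (∀ i g, ‖g‖ ^ 2 = ‖Q i g‖ ^ 2 + ‖g - Q i g‖ ^ 2) →
    volume {r | r ∈ Set.Ico 0 (‖g‖ ^ 2) ∧ ∀ i < K, S i → simulatedBit Q i r g} =
      ENNReal.ofReal (‖selectedProd Q S K g‖ ^ 2) := by
  induction K with
  | zero =>
    intro Q S g _ _
    have : {r | r ∈ Set.Ico 0 (‖g‖ ^ 2) ∧ ∀ i < 0, S i → simulatedBit Q i r g} =
        Set.Ico 0 (‖g‖ ^ 2) := by ext r; simp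
    rw [this, Real.volume_Ico, sub_zero, selectedProd, LinearMap.id_apply]
  | succ K ih =>
    intro Q S g hcomm hpyth
    set a := ‖Q 0 g‖ ^ 2 with ha
    set c := ‖g - Q 0 g‖ ^ 2 with hc
    have hac : ‖g‖ ^ 2 = a + c := hpyth 0 g
    have ha0 : 0 ≤ a := by positivity
    have hc0 : 0 ≤ c := by positivity
    let Q' : ℕ → H →ₗ[𝕜] H := fun i => Q (i + 1)
    let S' : ℕ → Prop := fun i => S (i + 1)
    let E : H → Set ℝ := fun h =>
      {r | r ∈ Set.Ico 0 (‖h‖ ^ 2) ∧ ∀ i < K, S' i → simulatedBit Q' i r h}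
    have hE : ∀ h, MeasurableSet (E h) := fun h => by
      have : E h = Set.Ico 0 (‖h‖ ^ 2) ∩
          ⋂ (i : ℕ) (_ : i < K) (_ : S' i), {r | simulatedBit Q' i r h} := by
        ext r; simp [E]
      rw [this]
      exact measurableSet_Ico.inter <| MeasurableSet.iInter fun i => MeasurableSet.iInter fun _ =>
        MeasurableSet.iInter fun _ => measurableSet_simulatedBit i Q' h
    have hvol : ∀ h, volume (E h) = ENNReal.ofReal (‖selectedProd Q' S' K h‖ ^ 2) := fun h =>
      ih Q' S' h (fun i j => hcomm (i + 1) (j + 1)) fun i => hpyth (i + 1)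
    by_cases hS : S 0
    · have h1 : {r | r ∈ Set.Ico 0 (‖g‖ ^ 2) ∧ ∀ i < K + 1, S i → simulatedBit Q i r g} =
          E (Q 0 g) := by
        ext r
        simp only [Set.mem_ofPred_eq, Set.mem_Ico, E, hac, ← ha]
        constructor
        · rintro ⟨⟨h0, -⟩, h⟩
          have hra : r < a := h 0 (Nat.succ_pos _) hS
          refine ⟨⟨h0, hra⟩, fun i hi hSi => ?_⟩
          rcases h (i + 1) (by omega) hSi with h | h
          · exact h.2
          · exact absurd h.1 (not_le.2 hra)
        · rintro ⟨⟨h0, hra⟩, h⟩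
          refine ⟨⟨h0, by linarith⟩, fun i hi hSi => ?_⟩
          rcases i with _ | i
          · exact hra
          · exact Or.inl ⟨hra, h i (by omega) hSi⟩
      rw [h1, hvol]
      simp [selectedProd, hS, Q', S']
    · have h1 : {r | r ∈ Set.Ico 0 (‖g‖ ^ 2) ∧ ∀ i < K + 1, S i → simulatedBit Q i r g} =
          E (Q 0 g) ∪ (fun r => r + -a) ⁻¹' E (g - Q 0 g) := by
        ext r
        simp only [Set.mem_ofPred_eq, Set.mem_Ico, Set.mem_union, Set.mem_preimage, E, hac, ← ha,
          ← hc]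
        constructor
        · rintro ⟨⟨h0, hr⟩, h⟩
          rcases lt_or_ge r a with hra | hra
          · refine Or.inl ⟨⟨h0, hra⟩, fun i hi hSi => ?_⟩
            rcases h (i + 1) (by omega) hSi with h | h
            · exact h.2
            · exact absurd h.1 (not_le.2 hra)
          · refine Or.inr ⟨⟨by linarith, by linarith⟩, fun i hi hSi => ?_⟩
            rcases h (i + 1) (by omega) hSi with h | h
            · exact absurd h.1 (not_lt.2 hra)
            · exact h.2
        · rintro (⟨⟨h0, hra⟩, h⟩ | ⟨⟨h0, hra⟩, h⟩)
          · refine ⟨⟨h0, by linarith⟩, fun i hi hSi => ?_⟩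
            rcases i with _ | i
            · exact absurd hSi hS
            · exact Or.inl ⟨hra, h i (by omega) hSi⟩
          · refine ⟨⟨by linarith, by linarith⟩, fun i hi hSi => ?_⟩
            rcases i with _ | i
            · exact absurd hSi hS
            · exact Or.inr ⟨by linarith, h i (by omega) hSi⟩
      have hdisj : Disjoint (E (Q 0 g)) ((fun r => r + -a) ⁻¹' E (g - Q 0 g)) := by
        rw [Set.disjoint_left]
        rintro r ⟨⟨_, h⟩, _⟩ ⟨⟨h', _⟩, _⟩
        rw [← ha] at h
        linarith
      have hQ : selectedProd Q S (K + 1) g = selectedProd Q' S' K g := by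
        simp [selectedProd, hS, Q', S']
      have hR : selectedProd Q' S' K (Q 0 g) = Q 0 (selectedProd Q' S' K g) :=
        selectedProd_comm K Q' S' (Q 0) (fun i => hcomm (i + 1) 0) g
      rw [h1, measure_union hdisj ((hE _).preimage (measurable_id.add_const _)),
        measure_preimage_add_right, hvol, hvol, hQ, map_sub, hR,
        ← ENNReal.ofReal_add (by positivity) (by positivity), ← hpyth 0]

/-- Commuting projections `Q i` have a joint distribution in every state `f`: there are events
`X i` such that the joint probability of some of these events is `‖∏ Q i f‖²`. -/
theorem exists_joint_distribution (Q : ℕ → H →ₗ[𝕜] H)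
    (hcomm : ∀ i j g, Q i (Q j g) = Q j (Q i g))
    (hpyth : ∀ i g, ‖g‖ ^ 2 = ‖Q i g‖ ^ 2 + ‖g - Q i g‖ ^ 2) (f : H) :
    ∃ (m : Measure ℝ) (X : ℕ → Set ℝ), IsFiniteMeasure m ∧ (∀ i, MeasurableSet (X i)) ∧
      ∀ (S : ℕ → Prop) (K : ℕ), m {r | ∀ i < K, S i → r ∈ X i} =
        ENNReal.ofReal (‖selectedProd Q S K f‖ ^ 2) := by
  refine ⟨volume.restrict (Set.Ico 0 (‖f‖ ^ 2)), fun i => {r | simulatedBit Q i r f},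
    ⟨by simp⟩, fun i => measurableSet_simulatedBit i Q f, fun S K => ?_⟩
  rw [Measure.restrict_apply' measurableSet_Ico, ← volume_simulatedBit K Q S f hcomm hpyth,
    Set.inter_comm]
  rfl

end RandomBits

/-! ### The space of compact subsets of the line -/

/-- The set `e(A)` of all compact subsets of `A`. -/
def compactsIn (A : Set ℝ) : Set (Compacts ℝ) := {C | (C : Set ℝ) ⊆ A}

theorem mem_compactsIn {A : Set ℝ} {C : Compacts ℝ} : C ∈ compactsIn A ↔ (C : Set ℝ) ⊆ A := Iff.rfl

theorem compactsIn_inter (A B : Set ℝ) : compactsIn (A ∩ B) = compactsIn A ∩ compactsIn B := by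
  ext C; simp [compactsIn, Set.subset_inter_iff]

theorem compactsIn_univ : compactsIn Set.univ = Set.univ := by
  ext C; simp [compactsIn]

theorem compactsIn_iInter {ι : Sort*} (A : ι → Set ℝ) :
    compactsIn (⋂ i, A i) = ⋂ i, compactsIn (A i) := by
  ext C; simp [compactsIn, Set.subset_iInter_iff]

theorem exists_rat_Icc_subset {U : Set ℝ} (hU : IsOpen U) {x : ℝ} (hx : x ∈ U) :
    ∃ a b : ℚ, (a : ℝ) < x ∧ x < b ∧ Set.Icc (a : ℝ) b ⊆ U := by
  obtain ⟨ε, hε, hball⟩ := Metric.isOpen_iff.1 hU x hx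
  obtain ⟨a, ha, ha'⟩ := exists_rat_btwn (show x - ε < x by linarith)
  obtain ⟨b, hb, hb'⟩ := exists_rat_btwn (show x < x + ε by linarith)
  refine ⟨a, b, ha', hb, fun y hy => hball ?_⟩
  rw [Real.ball_eq_Ioo]
  exact ⟨ha.trans_le hy.1, hy.2.trans_lt hb'⟩

/-- The Borel σ-field of the space of compact sets is generated by the events `C ∩ [a, b] = ∅`
with rational `a` and `b`. -/
theorem measurableSpace_compacts_eq :
    instMeasurableSpaceCompactsReal = MeasurableSpace.generateFrom
      (Set.range fun p : ℚ × ℚ => compactsIn (Set.Icc (p.1 : ℝ) p.2)ᶜ) := by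
  set 𝒢 := Set.range fun p : ℚ × ℚ => compactsIn (Set.Icc (p.1 : ℝ) p.2)ᶜ
  have hopen : ∀ V : Set ℝ, IsOpen V →
      MeasurableSet[MeasurableSpace.generateFrom 𝒢] (compactsIn Vᶜ) := by
    intro V hV
    have : compactsIn Vᶜ = ⋂ (p : ℚ × ℚ) (_ : Set.Icc (p.1 : ℝ) p.2 ⊆ V),
        compactsIn (Set.Icc (p.1 : ℝ) p.2)ᶜ := by
      ext C
      simp only [Set.mem_iInter, mem_compactsIn]
      refine ⟨fun h p hp => h.trans (Set.compl_subset_compl.2 hp), fun h x hxC hxV => ?_⟩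
      obtain ⟨a, b, ha, hb, hab⟩ := exists_rat_Icc_subset hV hxV
      exact h (a, b) hab hxC ⟨ha.le, hb.le⟩
    rw [this]
    exact MeasurableSet.iInter fun p => MeasurableSet.iInter fun _ =>
      MeasurableSpace.measurableSet_generateFrom ⟨p, rfl⟩
  apply le_antisymm
  -- A subbase of the topology consists of `{C | C ⊆ U}` and `{C | C ∩ V ≠ ∅}` with open `U`, `V`.
  · have htop : (inferInstance : TopologicalSpace (Compacts ℝ)) = generateFrom
        ((fun s => ((↑) : Compacts ℝ → Set ℝ) ⁻¹' s) '' (Set.powerset '' {U | IsOpen U} ∪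
          (fun V => {s | (s ∩ V).Nonempty}) '' {V | IsOpen V})) :=
      induced_generateFrom_eq
    refine (borel_eq_generateFrom_of_subbasis htop).le.trans (MeasurableSpace.generateFrom_le ?_)
    rintro _ ⟨_, ⟨U, hU, rfl⟩ | ⟨V, hV, rfl⟩, rfl⟩
    · have : ((↑) : Compacts ℝ → Set ℝ) ⁻¹' U.powerset =
          ⋃ n : ℕ, compactsIn (Metric.thickening (1 / ((n : ℝ) + 1)) Uᶜ)ᶜ := by
        ext C
        simp only [Set.mem_preimage, Set.mem_powerset_iff, Set.mem_iUnion, mem_compactsIn]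
        constructor
        · intro h
          obtain ⟨δ, hδ, hd⟩ := (Set.disjoint_compl_right_iff_subset.2 h).exists_thickenings
            C.isCompact (IsOpen.isClosed_compl hU)
          obtain ⟨n, hn⟩ := exists_nat_one_div_lt hδ
          refine ⟨n, Set.subset_compl_iff_disjoint_right.2 ?_⟩
          exact hd.mono (Metric.self_subset_thickening hδ _) (Metric.thickening_mono hn.le _)
        · rintro ⟨n, hn⟩ x hx
          by_contra hxU
          exact hn hx (Metric.self_subset_thickening (by positivity) _ hxU)
      beta_reduce
      rw [this]
      exact MeasurableSet.iUnion fun n => hopen _ Metric.isOpen_thickening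
    · have : ((↑) : Compacts ℝ → Set ℝ) ⁻¹' {s | (s ∩ V).Nonempty} = (compactsIn Vᶜ)ᶜ := by
        ext C
        simp only [Set.mem_preimage, Set.mem_ofPred_eq, Set.mem_compl_iff, mem_compactsIn,
          Set.subset_compl_iff_disjoint_right, Set.not_disjoint_iff_nonempty_inter]
      beta_reduce
      rw [this]
      exact (hopen V hV).compl
  · refine MeasurableSpace.generateFrom_le ?_
    rintro _ ⟨p, rfl⟩
    exact (Compacts.isOpen_subsets_of_isOpen isClosed_Icc.isOpen_compl).measurableSet

theorem measurableSet_compactsIn_compl_Icc (a b : ℝ) :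
    MeasurableSet (compactsIn (Set.Icc a b)ᶜ) :=
  (Compacts.isOpen_subsets_of_isOpen isClosed_Icc.isOpen_compl).measurableSet

theorem measurableSet_compactsIn_compl_singleton (t : ℝ) : MeasurableSet (compactsIn {t}ᶜ) := by
  rw [← Set.Icc_self]
  exact measurableSet_compactsIn_compl_Icc t t

/-- An enumeration of the rational closed intervals. -/
noncomputable def ratIcc (i : ℕ) : Set ℝ :=
  Set.Icc (((Denumerable.eqv (ℚ × ℚ)).symm i).1 : ℝ) ((Denumerable.eqv (ℚ × ℚ)).symm i).2

theorem ratIcc_eqv (a b : ℚ) : ratIcc (Denumerable.eqv (ℚ × ℚ) (a, b)) = Set.Icc (a : ℝ) b := by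
  simp [ratIcc]

/-- The complement of the union of those of the first `k` rational closed intervals that are
disjoint from `A`; as `k` grows, these sets decrease to `A`, up to finitely many points. -/
def outerApprox (A : Set ℝ) (k : ℕ) : Set ℝ :=
  ⋂ (i : ℕ) (_ : i < k ∧ ratIcc i ⊆ Aᶜ), (ratIcc i)ᶜ

theorem subset_outerApprox (A : Set ℝ) (k : ℕ) : A ⊆ outerApprox A k :=
  Set.subset_iInter fun _ => Set.subset_iInter fun h => Set.subset_compl_comm.1 h.2

theorem outerApprox_antitone (A : Set ℝ) : Antitone (outerApprox A) := by
  intro k l hkl x hx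
  simp only [outerApprox, Set.mem_iInter] at hx ⊢
  exact fun i hi => hx i ⟨hi.1.trans_le hkl, hi.2⟩

theorem iInter_outerApprox_subset {A : Set ℝ} {T : Finset ℝ}
    (hT : ∀ I : Set ℝ, I.OrdConnected → Disjoint I ↑T → I ⊆ A ∨ Disjoint I A) :
    ⋂ k, outerApprox A k ⊆ A ∪ ↑T := by
  intro x hx
  by_contra hxA
  rw [Set.mem_union, not_or] at hxA
  obtain ⟨a, b, ha, hb, hab⟩ := exists_rat_Icc_subset (T.finite_toSet.isClosed.isOpen_compl) hxA.2
  have hd : ratIcc (Denumerable.eqv (ℚ × ℚ) (a, b)) ⊆ Aᶜ := by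
    rw [ratIcc_eqv]
    rcases hT _ Set.ordConnected_Icc (Set.subset_compl_iff_disjoint_right.1 hab) with h | h
    · exact absurd (h ⟨ha.le, hb.le⟩) hxA.1
    · exact Set.subset_compl_iff_disjoint_right.2 h
  have h1 := Set.mem_iInter.1 hx (Denumerable.eqv (ℚ × ℚ) (a, b) + 1)
  simp only [outerApprox, Set.mem_iInter] at h1
  refine h1 _ ⟨Nat.lt_succ_self _, hd⟩ ?_
  rw [ratIcc_eqv]
  exact ⟨ha.le, hb.le⟩

theorem hasFiniteCuts_iInter_compl_ratIcc (s : Finset ℕ) :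
    HasFiniteCuts (⋂ i ∈ s, (ratIcc i)ᶜ) := by
  induction s using Finset.induction_on with
  | empty => simpa using hasFiniteCuts_univ
  | @insert i s _ ih =>
    rw [Finset.set_biInter_insert]
    exact (hasFiniteCuts_of_ordConnected Set.ordConnected_Icc).compl.inter ih

open scoped Classical in
theorem outerApprox_eq (A : Set ℝ) (k : ℕ) :
    outerApprox A k = ⋂ i ∈ (Finset.range k).filter fun i => ratIcc i ⊆ Aᶜ, (ratIcc i)ᶜ := by
  simp [outerApprox]

theorem hasFiniteCuts_outerApprox (A : Set ℝ) (k : ℕ) : HasFiniteCuts (outerApprox A k) := by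
  classical
  rw [outerApprox_eq]
  exact hasFiniteCuts_iInter_compl_ratIcc _

theorem measurableSet_compactsIn_iInter (s : Finset ℕ) :
    MeasurableSet (compactsIn (⋂ i ∈ s, (ratIcc i)ᶜ)) := by
  simp only [compactsIn_iInter]
  exact MeasurableSet.iInter fun i => MeasurableSet.iInter fun _ =>
    measurableSet_compactsIn_compl_Icc _ _

/-- The set `e(A)` is Borel: it is cut out of the limit of `e(outerApprox A k)` by the condition
that finitely many given points are avoided. -/
theorem HasFiniteCuts.measurableSet_compactsIn {A : Set ℝ} (hA : HasFiniteCuts A) :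
    MeasurableSet (compactsIn A) := by
  classical
  obtain ⟨T, hT⟩ := hA
  have h : compactsIn A = (⋂ k, compactsIn (outerApprox A k)) ∩
      ⋂ (t : ℝ) (_ : t ∈ (T.filter fun t => t ∉ A)), compactsIn {t}ᶜ := by
    simp only [← compactsIn_iInter, ← compactsIn_inter]
    congr 1
    apply subset_antisymm
    · refine Set.subset_inter (Set.subset_iInter fun k => subset_outerApprox A k) ?_
      intro x hx
      simp only [Set.mem_iInter, Finset.mem_filter]
      rintro t ⟨_, ht⟩ rfl
      exact ht hx
    · rintro x ⟨hx, hx'⟩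
      rcases iInter_outerApprox_subset hT hx with h | h
      · exact h
      · by_contra hxA
        simp only [Set.mem_iInter] at hx'
        exact hx' x (Finset.mem_filter.2 ⟨h, hxA⟩) rfl
  rw [h]
  refine (MeasurableSet.iInter fun k => ?_).inter ?_
  · rw [outerApprox_eq]
    exact measurableSet_compactsIn_iInter _
  · exact Finset.measurableSet_biInter _ fun t _ => measurableSet_compactsIn_compl_singleton t

/-- A consistent specification of which rational closed intervals are missed is realized by a
compact set, the complement of the union of the corresponding open intervals. -/
theorem exists_compacts_of_missed {x : ℚ → ℚ → Prop}
    (hmono : ∀ a b c d : ℚ, Set.Icc (c : ℝ) d ⊆ Set.Icc (a : ℝ) b → x a b → x c d)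
    (hglue : ∀ a b c, a ≤ b → b ≤ c → x a b → x b c → x a c)
    (hpoint : ∀ q, ∃ a b, a < q ∧ q < b ∧ x a b)
    (hbdd : ∃ n : ℚ, ∀ k : ℕ, x n k ∧ x (-k) (-n)) :
    ∃ C : Compacts ℝ, ∀ a b : ℚ, C ∈ compactsIn (Set.Icc (a : ℝ) b)ᶜ ↔ x a b := by
  let ι := {p : ℚ × ℚ // x p.1 p.2}
  let c : ι → Set ℝ := fun p => Set.Ioo (p.1.1 : ℝ) p.1.2
  have hc : ∀ i, IsOpen (c i) := fun i => isOpen_Ioo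
  obtain ⟨n, hn⟩ := hbdd
  have hcompact : IsCompact (⋃ i, c i)ᶜ := by
    refine (isCompact_Icc (a := (-n : ℝ)) (b := n)).of_isClosed_subset
      (isOpen_iUnion hc).isClosed_compl ?_
    rw [Set.compl_subset_comm]
    intro y hy
    rw [Set.mem_compl_iff, Set.mem_Icc, not_and_or, not_le, not_le] at hy
    rw [Set.mem_iUnion]
    rcases hy with hy | hy
    · obtain ⟨k, hk⟩ := exists_nat_gt (-y)
      refine ⟨⟨(-k, -n), (hn k).2⟩, ?_⟩
      simp only [c, Set.mem_Ioo]
      push_cast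
      constructor <;> linarith
    · obtain ⟨k, hk⟩ := exists_nat_gt y
      refine ⟨⟨(n, k), (hn k).1⟩, ?_⟩
      simp only [c, Set.mem_Ioo]
      push_cast
      constructor <;> linarith
  refine ⟨⟨(⋃ i, c i)ᶜ, hcompact⟩, fun a b => ?_⟩
  rw [mem_compactsIn, Compacts.coe_mk, Set.compl_subset_compl]
  constructor
  · intro hcover
    rcases lt_or_ge b a with hab | hab
    · obtain ⟨a', b', -, -, h⟩ := hpoint 0
      refine hmono a' b' a b ?_ h
      rw [Set.Icc_eq_empty (by simpa using hab)]
      exact Set.empty_subset _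
    -- Subdivide `[a, b]` into intervals shorter than a Lebesgue number of the cover.
    obtain ⟨δ, hδ, hball⟩ := lebesgue_number_lemma_of_metric isCompact_Icc hc hcover
    have hsmall : ∀ p q : ℚ, a ≤ p → p ≤ b → (q : ℝ) - p < δ → x p q := by
      intro p q hap hpb hpq
      obtain ⟨i, hi⟩ := hball p ⟨by exact_mod_cast hap, by exact_mod_cast hpb⟩
      refine hmono _ _ p q ((?_ : Set.Icc (p : ℝ) q ⊆ c i).trans Set.Ioo_subset_Icc_self) i.2
      intro y hy
      refine hi ?_
      rw [Metric.mem_ball, Real.dist_eq, abs_of_nonneg (by linarith [hy.1])]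
      linarith [hy.2]
    obtain ⟨M, hM⟩ := exists_nat_gt (((b : ℝ) - a) / δ)
    have hab' : (a : ℝ) ≤ b := by exact_mod_cast hab
    have hM0 : (0 : ℝ) < M := lt_of_le_of_lt (div_nonneg (by linarith) hδ.le) hM
    have hM0' : (0 : ℚ) < M := by exact_mod_cast hM0
    have hstep : ((b : ℝ) - a) / M < δ := by
      rw [div_lt_iff₀ hM0]; rw [div_lt_iff₀ hδ] at hM; linarith
    set h : ℚ := (b - a) / M with hh
    have hh0 : 0 ≤ h := div_nonneg (by linarith) hM0'.le
    have hhR : (h : ℝ) < δ := by rw [hh]; push_cast; exact hstep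
    have hle : ∀ j : ℕ, j ≤ M → a + j * h ≤ b := by
      intro j hj
      have h1 : (j : ℚ) * h ≤ M * h := by gcongr
      have h2 : (M : ℚ) * h = b - a := by rw [hh]; field_simp
      linarith
    have hind : ∀ j : ℕ, j ≤ M → x a (a + j * h) := by
      intro j
      induction j with
      | zero => exact fun _ => hsmall _ _ le_rfl hab (by push_cast; linarith)
      | succ j ih =>
        intro hj
        have hpos : 0 ≤ (j : ℚ) * h := by positivity
        refine hglue a (a + j * h) _ (by linarith) (by push_cast; linarith) (ih (by omega)) ?_
        exact hsmall _ _ (by linarith) (hle j (by omega)) (by push_cast; linarith)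
    have := hind M le_rfl
    rwa [hh, mul_div_cancel₀ _ hM0'.ne', add_sub_cancel] at this
  · intro hx y hy
    have key : ∀ q : ℚ, (q : ℝ) ∈ ⋃ i, c i := fun q => by
      obtain ⟨a', b', h1, h2, h⟩ := hpoint q
      exact Set.mem_iUnion.2 ⟨⟨(a', b'), h⟩, by exact_mod_cast h1, by exact_mod_cast h2⟩
    rcases hy.1.eq_or_lt with h1 | h1
    · exact h1 ▸ key a
    rcases hy.2.eq_or_lt with h2 | h2
    · exact h2 ▸ key b
    · exact Set.mem_iUnion.2 ⟨⟨(a, b), hx⟩, h1, h2⟩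

/-! ### Spectral measures of vectors -/

namespace Noise

variable {Ω : Type u} [mΩ : MeasurableSpace Ω] {P : Measure Ω} (N : Noise P)
  {𝕜 : Type} [RCLike 𝕜] [IsProbabilityMeasure P]

theorem pr_mem_fieldTop (A : Set ℝ) (f : Lp 𝕜 2 P) :
    N.pr 𝕜 A f ∈ lpMeas 𝕜 𝕜 N.fieldTop 2 P :=
  lpMeas_mono_of_le_aeClosure (N.fieldOf_le A) N.fieldTop_le
    ((N.fieldOf_le_fieldTop A).trans le_aeClosure) (N.pr_mem A f)

/-- The product of the projections for sets `A i` is the projection for the intersection. -/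
theorem selectedProd_pr (K : ℕ) : ∀ (A : ℕ → Set ℝ) (S : ℕ → Prop) (f : Lp 𝕜 2 P),
    (∀ i, HasFiniteCuts (A i)) → f ∈ lpMeas 𝕜 𝕜 N.fieldTop 2 P →
    selectedProd (fun i => (N.pr 𝕜 (A i)).toLinearMap) S K f =
      N.pr 𝕜 (⋂ (i : ℕ) (_ : i < K ∧ S i), A i) f := by
  suffices h : ∀ (A : ℕ → Set ℝ) (S : ℕ → Prop) (f : Lp 𝕜 2 P),
      (∀ i, HasFiniteCuts (A i)) → f ∈ lpMeas 𝕜 𝕜 N.fieldTop 2 P →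
      HasFiniteCuts (⋂ (i : ℕ) (_ : i < K ∧ S i), A i) ∧
      selectedProd (fun i => (N.pr 𝕜 (A i)).toLinearMap) S K f =
        N.pr 𝕜 (⋂ (i : ℕ) (_ : i < K ∧ S i), A i) f from
    fun A S f hA hf => (h A S f hA hf).2
  induction K with
  | zero =>
    intro A S f _ hf
    simp [selectedProd, N.pr_univ hf, hasFiniteCuts_univ]
  | succ K ih =>
    intro A S f hA hf
    by_cases hS : S 0
    · obtain ⟨h1, h2⟩ := ih (fun i => A (i + 1)) (fun i => S (i + 1)) (N.pr 𝕜 (A 0) f)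
        (fun i => hA (i + 1)) (N.pr_mem_fieldTop _ _)
      have e : ⋂ (i : ℕ) (_ : i < K + 1 ∧ S i), A i =
          A 0 ∩ ⋂ (i : ℕ) (_ : i < K ∧ S (i + 1)), A (i + 1) := by
        ext x
        simp only [Set.mem_iInter, Set.mem_inter_iff]
        refine ⟨fun h => ⟨h 0 ⟨by omega, hS⟩, fun i hi => h (i + 1) ⟨by omega, hi.2⟩⟩, ?_⟩
        rintro ⟨h0, h⟩ (_ | i) hi
        · exact h0
        · exact h i ⟨by omega, hi.2⟩
      rw [e]
      refine ⟨(hA 0).inter h1, ?_⟩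
      rw [← N.pr_pr _ h1, ← h2]
      simp [selectedProd, hS]
    · obtain ⟨h1, h2⟩ := ih (fun i => A (i + 1)) (fun i => S (i + 1)) f (fun i => hA (i + 1)) hf
      have e : ⋂ (i : ℕ) (_ : i < K + 1 ∧ S i), A i =
          ⋂ (i : ℕ) (_ : i < K ∧ S (i + 1)), A (i + 1) := by
        ext x
        simp only [Set.mem_iInter]
        refine ⟨fun h => fun i hi => h (i + 1) ⟨by omega, hi.2⟩, ?_⟩
        rintro h (_ | i) hi
        · exact absurd hi.2 hS
        · exact h i ⟨by omega, hi.2⟩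
      rw [e]
      refine ⟨h1, ?_⟩
      rw [← h2]
      simp [selectedProd, hS]

/-- The joint distribution, in the state `f`, of the projections for the complements of the rational
closed intervals; `X i` is to be thought of as the event that a random compact set misses the
interval number `i`. -/
theorem exists_missing_events {f : Lp 𝕜 2 P} (hf : f ∈ lpMeas 𝕜 𝕜 N.fieldTop 2 P) :
    ∃ (m : Measure ℝ) (X : ℕ → Set ℝ), IsFiniteMeasure m ∧ (∀ i, MeasurableSet (X i)) ∧
      ∀ s : Finset ℕ, m (⋂ i ∈ s, X i) =
        ENNReal.ofReal (‖N.pr 𝕜 (⋂ i ∈ s, (ratIcc i)ᶜ) f‖ ^ 2) := by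
  have hcuts : ∀ i, HasFiniteCuts (ratIcc i)ᶜ := fun i =>
    (hasFiniteCuts_of_ordConnected Set.ordConnected_Icc).compl
  obtain ⟨m, X, hm, hX, h⟩ := exists_joint_distribution
    (fun i => (N.pr 𝕜 (ratIcc i)ᶜ).toLinearMap)
    (fun i j g => by
      change N.pr 𝕜 _ (N.pr 𝕜 _ g) = N.pr 𝕜 _ (N.pr 𝕜 _ g)
      rw [N.pr_pr _ (hcuts i), N.pr_pr _ (hcuts j), Set.inter_comm])
    (fun i g => N.norm_sq_eq_norm_pr_sq_add _ g) f
  refine ⟨m, X, hm, hX, fun s => ?_⟩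
  obtain ⟨K, hK⟩ : ∃ K, ∀ i ∈ s, i < K := ⟨s.sup id + 1, fun i hi =>
    Nat.lt_succ_of_le (Finset.le_sup (f := id) hi)⟩
  have h1 := h (fun i => i ∈ s) K
  rw [N.selectedProd_pr K _ _ f hcuts hf] at h1
  have e1 : {r | ∀ i < K, i ∈ s → r ∈ X i} = ⋂ i ∈ s, X i := by
    ext r
    simp only [Set.mem_ofPred_eq, Set.mem_iInter]
    exact ⟨fun h i hi => h i (hK i hi) hi, fun h i _ hi => h i hi⟩
  have e2 : ⋂ (i : ℕ) (_ : i < K ∧ i ∈ s), (ratIcc i)ᶜ = ⋂ i ∈ s, (ratIcc i)ᶜ := by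
    ext r
    simp only [Set.mem_iInter]
    exact ⟨fun h i hi => h i ⟨hK i hi, hi⟩, fun h i hi => h i hi.2⟩
  rwa [e1, e2] at h1

variable [MeasureTheory.IsSeparable P]

theorem exists_rat_lt_norm_pr_sq {f : Lp 𝕜 2 P} (hf : f ∈ lpMeas 𝕜 𝕜 N.fieldTop 2 P) (t : ℝ)
    {c : ℝ} (hc : c < ‖f‖ ^ 2) :
    ∃ a b : ℚ, (a : ℝ) < t ∧ t < b ∧ c < ‖N.pr 𝕜 (Set.Icc (a : ℝ) b)ᶜ f‖ ^ 2 := by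
  have h := ((N.tendsto_pr_compl_Icc hf t).norm.pow 2).eventually (lt_mem_nhds hc)
  obtain ⟨k, hk⟩ := h.exists
  have hpos : (0 : ℝ) < 1 / ((k : ℝ) + 1) := by positivity
  obtain ⟨a, ha, ha'⟩ := exists_rat_btwn (show t - 1 / ((k : ℝ) + 1) < t by linarith)
  obtain ⟨b, hb, hb'⟩ := exists_rat_btwn (show t < t + 1 / ((k : ℝ) + 1) by linarith)
  refine ⟨a, b, ha', hb, hk.trans_le (N.norm_pr_mono
    (hasFiniteCuts_of_ordConnected Set.ordConnected_Icc).compl ?_ f)⟩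
  exact Set.compl_subset_compl.2 (Set.Icc_subset_Icc ha.le hb'.le)

/-- The projections for the outer approximations of `A` converge to that for `A`: the complements of
the approximations exhaust the complement of `A`, up to finitely many points. -/
theorem tendsto_pr_outerApprox {f : Lp 𝕜 2 P} (hf : f ∈ lpMeas 𝕜 𝕜 N.fieldTop 2 P) {A : Set ℝ}
    (hA : HasFiniteCuts A) :
    Tendsto (fun k => N.pr 𝕜 (outerApprox A k) f) atTop (nhds (N.pr 𝕜 A f)) := by
  have hmono : Monotone fun n => A ∪ (outerApprox A n)ᶜ := fun k l h =>
    Set.union_subset_union_right _ (Set.compl_subset_compl.2 (outerApprox_antitone A h))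
  refine N.tendsto_pr hmono ?_ (hasFiniteCuts_outerApprox A) hA (fun n k hnk => ?_) hf
  · obtain ⟨T, hT⟩ := hA
    rw [← N.fieldOf_univ]
    refine N.fieldOf_le_of_cuts T fun I hI hd => ?_
    rw [Set.univ_inter]
    rcases hT I hI hd with h | h
    · exact ((N.fieldOf_mono (h.trans Set.subset_union_left)).trans
        (le_iSup_of_le 0 le_rfl)).trans le_aeClosure
    refine N.fieldOf_le_iff.2 fun r s hrs hI' => N.F_le_of_inner hrs fun r' s' hr hrs' hs => ?_
    obtain ⟨a, ha, ha'⟩ := exists_rat_btwn hr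
    obtain ⟨b, hb, hb'⟩ := exists_rat_btwn hs
    set i := Denumerable.eqv (ℚ × ℚ) (a, b)
    have hi : ratIcc i = Set.Icc (a : ℝ) b := ratIcc_eqv a b
    have hiA : ratIcc i ⊆ Aᶜ := by
      rw [hi]
      refine Set.Subset.trans (fun x hx => ?_) (Set.subset_compl_iff_disjoint_right.2 h)
      exact hI' ⟨ha.trans_le hx.1, hx.2.trans_lt hb'⟩
    refine ((N.F_le_fieldOf hrs'.le fun x hx => Or.inr fun hx' => ?_).trans
      (le_iSup_of_le (i + 1) le_rfl)).trans le_aeClosure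
    simp only [outerApprox, Set.mem_iInter] at hx'
    refine hx' i ⟨Nat.lt_succ_self _, hiA⟩ ?_
    rw [hi]
    exact ⟨by linarith [hx.1], by linarith [hx.2]⟩
  · rw [Set.union_inter_distrib_right, Set.union_inter_distrib_right, Set.inter_self,
      Set.inter_eq_left.2 (subset_outerApprox A k)]
    have h1 : (outerApprox A n)ᶜ ∩ outerApprox A k = ∅ :=
      Set.disjoint_iff_inter_eq_empty.1
        (disjoint_compl_left.mono_right (outerApprox_antitone A hnk))
    have h2 : (outerApprox A n)ᶜ ∩ A = ∅ :=
      Set.disjoint_iff_inter_eq_empty.1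
        (disjoint_compl_left.mono_right (subset_outerApprox A n))
    rw [h1, h2]

/-- Almost surely, the events `X i` specify the rational closed intervals missed by some compact
set. Each of the countably many consistency conditions holds almost surely, since the corresponding
relation holds between the projections. -/
theorem ae_exists_compacts {f : Lp 𝕜 2 P} (hf : f ∈ lpMeas 𝕜 𝕜 N.fieldTop 2 P)
    {m : Measure ℝ} [IsFiniteMeasure m] {X : ℕ → Set ℝ} (hX : ∀ i, MeasurableSet (X i))
    (hm : ∀ s : Finset ℕ, m (⋂ i ∈ s, X i) =
        ENNReal.ofReal (‖N.pr 𝕜 (⋂ i ∈ s, (ratIcc i)ᶜ) f‖ ^ 2)) :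
    ∀ᵐ r ∂m, ∃ C : Compacts ℝ, ∀ a b : ℚ,
      C ∈ compactsIn (Set.Icc (a : ℝ) b)ᶜ ↔ r ∈ X (Denumerable.eqv (ℚ × ℚ) (a, b)) := by
  -- An interval covered by missed ones is missed.
  have himp : ∀ (s : Finset ℕ) (j : ℕ), ⋂ i ∈ s, (ratIcc i)ᶜ ⊆ (ratIcc j)ᶜ →
      ∀ᵐ r ∂m, (∀ i ∈ s, r ∈ X i) → r ∈ X j := by
    intro s j hsj
    have h1 : (⋂ i ∈ insert j s, X i) =ᵐ[m] (⋂ i ∈ s, X i : Set ℝ) := by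
      refine ae_eq_of_subset_of_measure_ge ?_ ?_
        (Finset.measurableSet_biInter _ fun i _ => hX i).nullMeasurableSet (measure_ne_top _ _)
      · rw [Finset.set_biInter_insert]; exact Set.inter_subset_right
      · rw [hm, hm, Finset.set_biInter_insert, Set.inter_eq_right.2 hsj]
    filter_upwards [h1.mem_iff] with r hr hrs
    have := hr.2 (by simpa using hrs)
    rw [Finset.set_biInter_insert] at this
    exact this.1
  have htotal : m Set.univ = ENNReal.ofReal (‖f‖ ^ 2) := by
    have := hm ∅
    simpa [N.pr_univ hf] using this
  -- An event whose probability exceeds every `c < ‖f‖²` is almost sure.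
  have hfull : ∀ E : Set ℝ, MeasurableSet E → (∀ c < ‖f‖ ^ 2, ENNReal.ofReal c ≤ m E) →
      ∀ᵐ r ∂m, r ∈ E := by
    intro E hE h
    have h1 : m Set.univ ≤ m E := by
      rw [htotal]
      refine le_of_forall_lt fun d hd => ?_
      have hd' : d ≠ ∞ := hd.ne_top
      rw [← ENNReal.ofReal_toReal hd', ENNReal.ofReal_lt_ofReal_iff_of_nonneg
        ENNReal.toReal_nonneg] at hd
      obtain ⟨c, hc, hc'⟩ := exists_between hd
      refine lt_of_lt_of_le ?_ (h c hc')
      rwa [← ENNReal.ofReal_toReal hd', ENNReal.ofReal_lt_ofReal_iff_of_nonneg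
        ENNReal.toReal_nonneg]
    have h2 : E =ᵐ[m] Set.univ := ae_eq_of_subset_of_measure_ge (Set.subset_univ _) h1
      hE.nullMeasurableSet (measure_ne_top _ _)
    filter_upwards [h2.mem_iff] with r hr using hr.2 trivial
  have hsingle : ∀ i, m (X i) = ENNReal.ofReal (‖N.pr 𝕜 (ratIcc i)ᶜ f‖ ^ 2) := fun i => by
    simpa using hm {i}
  set ε := Denumerable.eqv (ℚ × ℚ)
  have hmono : ∀ᵐ r ∂m, ∀ a b c d : ℚ, Set.Icc (c : ℝ) d ⊆ Set.Icc (a : ℝ) b →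
      r ∈ X (ε (a, b)) → r ∈ X (ε (c, d)) := by
    simp only [ae_all_iff]
    intro a b c d h
    have := himp {ε (a, b)} (ε (c, d)) (by
      simp only [Finset.mem_singleton, Set.iInter_iInter_eq_left, ε, ratIcc_eqv]
      exact Set.compl_subset_compl.2 h)
    simpa using this
  have hglue : ∀ᵐ r ∂m, ∀ a b c : ℚ, a ≤ b → b ≤ c → r ∈ X (ε (a, b)) → r ∈ X (ε (b, c)) →
      r ∈ X (ε (a, c)) := by
    simp only [ae_all_iff]
    intro a b c hab hbc
    have := himp {ε (a, b), ε (b, c)} (ε (a, c)) (by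
      rw [Finset.set_biInter_insert, Finset.set_biInter_singleton, ratIcc_eqv, ratIcc_eqv,
        ratIcc_eqv, ← Set.compl_union, Set.Icc_union_Icc_eq_Icc (by exact_mod_cast hab)
        (by exact_mod_cast hbc)])
    filter_upwards [this] with r hr h1 h2
    exact hr (by simp [h1, h2])
  have hpoint : ∀ᵐ r ∂m, ∀ q : ℚ, ∃ a b : ℚ, a < q ∧ q < b ∧ r ∈ X (ε (a, b)) := by
    rw [ae_all_iff]
    intro q
    have := hfull (⋃ (a : ℚ) (b : ℚ) (_ : a < q) (_ : q < b), X (ε (a, b)))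
      (MeasurableSet.iUnion fun a => MeasurableSet.iUnion fun b => MeasurableSet.iUnion fun _ =>
        MeasurableSet.iUnion fun _ => hX _) fun c hc => by
        obtain ⟨a, b, ha, hb, h⟩ := N.exists_rat_lt_norm_pr_sq hf q hc
        refine le_trans ?_ (measure_mono (Set.subset_iUnion_of_subset a
          (Set.subset_iUnion_of_subset b (Set.subset_iUnion_of_subset (by exact_mod_cast ha)
          (Set.subset_iUnion_of_subset (by exact_mod_cast hb) subset_rfl)))))
        rw [hsingle, ratIcc_eqv]
        exact ENNReal.ofReal_le_ofReal h.le
    filter_upwards [this] with r hr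
    simpa only [Set.mem_iUnion, exists_prop] using hr
  have hbdd : ∀ᵐ r ∂m, ∃ n : ℚ, ∀ k : ℕ, r ∈ X (ε (n, k)) ∧ r ∈ X (ε (-k, -n)) := by
    have := hfull (⋃ n : ℕ, ⋂ k : ℕ, (X (ε (n, k)) ∩ X (ε (-k, -n))))
      (MeasurableSet.iUnion fun n => MeasurableSet.iInter fun k => (hX _).inter (hX _))
      fun c hc => by
        obtain ⟨n, hn⟩ :=
          (((N.tendsto_pr_Ioo hf).norm.pow 2).eventually (lt_mem_nhds hc)).exists
        refine le_trans ?_ (measure_mono (Set.subset_iUnion _ n))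
        -- The finite intersections have at least the required measure.
        let s : ℕ → Finset ℕ := fun K => (Finset.range K).image (fun k : ℕ => ε ((n : ℚ), (k : ℚ)))
          ∪ (Finset.range K).image (fun k : ℕ => ε (-(k : ℚ), -(n : ℚ)))
        have hs : ∀ K, ENNReal.ofReal c ≤ m (⋂ i ∈ s K, X i) := fun K => by
          rw [hm]
          refine ENNReal.ofReal_le_ofReal (hn.le.trans (N.norm_pr_mono
            (hasFiniteCuts_of_ordConnected Set.ordConnected_Ioo) ?_ f))
          refine Set.subset_iInter₂ fun i hi => ?_
          simp only [s, Finset.mem_union, Finset.mem_image] at hi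
          rcases hi with ⟨k, _, rfl⟩ | ⟨k, _, rfl⟩
          · rw [ratIcc_eqv]
            intro x hx hx'
            have := hx'.1
            push_cast at this
            linarith [hx.2]
          · rw [ratIcc_eqv]
            intro x hx hx'
            have := hx'.2
            push_cast at this
            linarith [hx.1]
        have e : ⋂ k : ℕ, (X (ε (n, k)) ∩ X (ε (-k, -n))) = ⋂ K, ⋂ i ∈ s K, X i := by
          ext r
          simp only [Set.mem_iInter, Set.mem_inter_iff, s, Finset.mem_union, Finset.mem_image,
            Finset.mem_range]
          constructor
          · rintro h K i (⟨k, _, rfl⟩ | ⟨k, _, rfl⟩)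
            · exact (h k).1
            · exact (h k).2
          · exact fun h k => ⟨h (k + 1) _ (Or.inl ⟨k, by omega, rfl⟩),
              h (k + 1) _ (Or.inr ⟨k, by omega, rfl⟩)⟩
        have hanti : Antitone fun K => ⋂ i ∈ s K, X i := by
          intro K L hKL
          refine Set.biInter_subset_biInter_left fun i hi => ?_
          exact Finset.union_subset_union (Finset.image_subset_image (Finset.range_mono hKL))
            (Finset.image_subset_image (Finset.range_mono hKL)) hi
        rw [e, hanti.measure_iInter (fun K =>
          (Finset.measurableSet_biInter _ fun i _ => hX i).nullMeasurableSet)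
          ⟨0, measure_ne_top _ _⟩]
        exact le_iInf hs
    filter_upwards [this] with r hr
    obtain ⟨n, hn⟩ := Set.mem_iUnion.1 hr
    exact ⟨n, fun k => Set.mem_iInter.1 hn k⟩
  filter_upwards [hmono, hglue, hpoint, hbdd] with r h1 h2 h3 h4
  exact exists_compacts_of_missed (x := fun a b => r ∈ X (ε (a, b))) h1 h2 h3 h4

/-- The spectral measure of a vector `f`: the measure of `e(A)` is the squared norm of
`E(f | F_A)`. -/
theorem exists_vectorMeasure {f : Lp 𝕜 2 P} (hf : f ∈ lpMeas 𝕜 𝕜 N.fieldTop 2 P) :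
    ∃ μ : Measure (Compacts ℝ), IsFiniteMeasure μ ∧ ∀ A, HasFiniteCuts A →
      μ (compactsIn A) = ENNReal.ofReal (‖N.pr 𝕜 A f‖ ^ 2) := by
  classical
  obtain ⟨m, X, hfin, hX, hm⟩ := N.exists_missing_events hf
  have hae := N.ae_exists_compacts hf hX hm
  -- `Φ` sends `r` to the compact set specified by the events that contain `r`. It is redefined
  -- outside a measurable set `G` of full measure, where it may be non-measurable or undefined.
  set good : Set ℝ := {r | ∃ C : Compacts ℝ, ∀ a b : ℚ,
    C ∈ compactsIn (Set.Icc (a : ℝ) b)ᶜ ↔ r ∈ X (Denumerable.eqv (ℚ × ℚ) (a, b))} with hgood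
  set G : Set ℝ := (toMeasurable m goodᶜ)ᶜ with hG
  have hGm : MeasurableSet G := (measurableSet_toMeasurable _ _).compl
  have hGgood : G ⊆ good := Set.compl_subset_comm.1 (subset_toMeasurable m goodᶜ)
  have hGae : ∀ᵐ r ∂m, r ∈ G := by
    rw [ae_iff]
    have : {r | r ∉ G} = toMeasurable m goodᶜ := by ext r; simp [hG]
    rw [this, measure_toMeasurable]
    exact hae
  let Φ : ℝ → Compacts ℝ := fun r => if h : r ∈ G then (hGgood h).choose else ⊥
  have hΦ : ∀ r ∈ G, ∀ i, Φ r ∈ compactsIn (ratIcc i)ᶜ ↔ r ∈ X i := by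
    intro r hr i
    simp only [Φ, hr, dif_pos]
    obtain ⟨p, rfl⟩ := (Denumerable.eqv (ℚ × ℚ)).surjective i
    rw [show ratIcc (Denumerable.eqv (ℚ × ℚ) p) = Set.Icc (p.1 : ℝ) p.2 from ratIcc_eqv p.1 p.2]
    exact (hGgood hr).choose_spec p.1 p.2
  have hΦm : Measurable Φ := by
    rw [measurableSpace_compacts_eq]
    refine measurable_generateFrom ?_
    rintro _ ⟨p, rfl⟩
    have : Φ ⁻¹' compactsIn (Set.Icc (p.1 : ℝ) p.2)ᶜ =
        (G ∩ X (Denumerable.eqv (ℚ × ℚ) p)) ∪ Gᶜ := by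
      ext r
      by_cases hr : r ∈ G
      · have := hΦ r hr (Denumerable.eqv (ℚ × ℚ) p)
        rw [show ratIcc (Denumerable.eqv (ℚ × ℚ) p) = Set.Icc (p.1 : ℝ) p.2 from
          ratIcc_eqv p.1 p.2] at this
        simp [hr, this]
      · simp [Φ, hr, mem_compactsIn]
    rw [this]
    exact (hGm.inter (hX _)).union hGm.compl
  have hfinset : ∀ s : Finset ℕ, m.map Φ (compactsIn (⋂ i ∈ s, (ratIcc i)ᶜ)) =
      ENNReal.ofReal (‖N.pr 𝕜 (⋂ i ∈ s, (ratIcc i)ᶜ) f‖ ^ 2) := by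
    intro s
    rw [Measure.map_apply hΦm (measurableSet_compactsIn_iInter s), ← hm]
    refine measure_congr ?_
    filter_upwards [hGae] with r hr
    refine propext ?_
    change Φ r ∈ compactsIn _ ↔ r ∈ ⋂ i ∈ s, X i
    simp only [compactsIn_iInter, Set.mem_iInter, hΦ r hr]
  have hfin' : IsFiniteMeasure (m.map Φ) := inferInstance
  refine ⟨m.map Φ, hfin', fun A hA => ?_⟩
  -- By continuity of the noise at `t`, almost no set contains `t`.
  have hsing : ∀ t : ℝ, m.map Φ (compactsIn {t}ᶜ)ᶜ = 0 := by
    intro t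
    have htot : m.map Φ Set.univ = ENNReal.ofReal (‖f‖ ^ 2) := by
      have := hfinset ∅
      simpa [N.pr_univ hf, compactsIn_univ] using this
    refine le_antisymm (ENNReal.le_of_forall_pos_le_add fun δ hδ _ => ?_) (zero_le)
    obtain ⟨a, b, ha, hb, h⟩ := N.exists_rat_lt_norm_pr_sq hf t
      (show ‖f‖ ^ 2 - δ < ‖f‖ ^ 2 by have : (0 : ℝ) < δ := hδ; linarith)
    have h1 := hfinset {Denumerable.eqv (ℚ × ℚ) (a, b)}
    rw [Finset.set_biInter_singleton, ratIcc_eqv] at h1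
    have h2 : (compactsIn {t}ᶜ)ᶜ ⊆ (compactsIn (Set.Icc (a : ℝ) b)ᶜ)ᶜ :=
      Set.compl_subset_compl.2 fun C hC => Set.Subset.trans hC
        (Set.compl_subset_compl.2 (Set.singleton_subset_iff.2 ⟨ha.le, hb.le⟩))
    refine (measure_mono h2).trans ?_
    rw [measure_compl (measurableSet_compactsIn_compl_Icc _ _) (measure_ne_top _ _), htot, h1,
      ← ENNReal.ofReal_sub _ (by positivity), zero_add, ENNReal.ofReal_le_iff_le_toReal (by simp)]
    simp only [ENNReal.coe_toReal]
    linarith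
  -- The decreasing sets `e(outerApprox A k)` shrink to `e(A)` up to a negligible set.
  have hlim : Tendsto (fun k => m.map Φ (compactsIn (outerApprox A k))) atTop
      (nhds (m.map Φ (⋂ k, compactsIn (outerApprox A k)))) := by
    refine tendsto_measure_iInter_atTop (fun k =>
      (hasFiniteCuts_outerApprox A k).measurableSet_compactsIn.nullMeasurableSet) ?_
      ⟨0, measure_ne_top _ _⟩
    exact fun k l hkl C hC => Set.Subset.trans hC (outerApprox_antitone A hkl)
  have hlim' : Tendsto (fun k => m.map Φ (compactsIn (outerApprox A k))) atTop
      (nhds (ENNReal.ofReal (‖N.pr 𝕜 A f‖ ^ 2))) := by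
    have := ENNReal.tendsto_ofReal ((N.tendsto_pr_outerApprox hf hA).norm.pow 2)
    refine this.congr fun k => ?_
    rw [outerApprox_eq, hfinset]
  rw [← tendsto_nhds_unique hlim hlim']
  obtain ⟨T, hT⟩ := hA
  refine measure_congr ?_
  have hT0 : ∀ᵐ C ∂(m.map Φ), ∀ t ∈ T, C ∈ compactsIn {t}ᶜ := by
    rw [Finset.eventually_all]
    exact fun t _ => hsing t
  filter_upwards [hT0] with C hC
  refine propext ?_
  change C ∈ compactsIn A ↔ C ∈ ⋂ k, compactsIn (outerApprox A k)
  rw [← compactsIn_iInter]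
  refine ⟨fun h => Set.Subset.trans h (Set.subset_iInter fun k => subset_outerApprox A k),
    fun h x hx => ?_⟩
  rcases iInter_outerApprox_subset hT (h hx) with h' | h'
  · exact h'
  · exact absurd rfl (hC x h' hx)

end Noise

/-! ### Decomposition of a Hilbert space into cyclic subspaces -/

/-- Commuting projections `E i` of a Hilbert space, labelled by the sets `e i` of a π-system that
generates the σ-field of `X`, such that each vector `f` has a spectral measure on `X`, giving
measure `‖E i f‖²` to `e i`. -/
structure IsSpectralFamily {𝕜 H X ι : Type*} [RCLike 𝕜] [NormedAddCommGroup H]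
    [InnerProductSpace 𝕜 H] [mX : MeasurableSpace X] (e : ι → Set X) (E : ι → H →L[𝕜] H) :
    Prop where
  generateFrom_eq : mX = MeasurableSpace.generateFrom (Set.range e)
  idem : ∀ i f, E i (E i f) = E i f
  inner_left : ∀ i f g, inner 𝕜 (E i f) g = inner 𝕜 f (E i g)
  exists_inter : ∀ i j, ∃ k, e k = e i ∩ e j ∧ ∀ f, E i (E j f) = E k f
  exists_univ : ∃ k, e k = Set.univ ∧ ∀ f, E k f = f
  exists_measure : ∀ f, ∃ ν : Measure X, IsFiniteMeasure ν ∧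
    ∀ i, ν (e i) = ENNReal.ofReal (‖E i f‖ ^ 2)

namespace IsSpectralFamily

variable {𝕜 H X ι : Type*} [RCLike 𝕜] [NormedAddCommGroup H]
    [InnerProductSpace 𝕜 H] [mX : MeasurableSpace X] {e : ι → Set X} {E : ι → H →L[𝕜] H}

theorem measurableSet (hE : IsSpectralFamily e E) (i : ι) : MeasurableSet (e i) := by
  rw [hE.generateFrom_eq]
  exact MeasurableSpace.measurableSet_generateFrom ⟨i, rfl⟩

theorem isPiSystem (hE : IsSpectralFamily e E) : IsPiSystem (Set.range e) := by
  rintro _ ⟨i, rfl⟩ _ ⟨j, rfl⟩ -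
  obtain ⟨k, hk, -⟩ := hE.exists_inter i j
  exact ⟨k, hk⟩

/-- The indicator of `e i` as a square integrable function. -/
noncomputable def ind (hE : IsSpectralFamily e E) (ν : Measure X) [IsFiniteMeasure ν] (i : ι) :
    Lp 𝕜 2 ν := indicatorConstLp 2 (hE.measurableSet i) (measure_ne_top ν _) 1

theorem topologicalClosure_span_ind (hE : IsSpectralFamily e E) (ν : Measure X)
    [IsFiniteMeasure ν] :
    (Submodule.span 𝕜 (Set.range (hE.ind ν))).topologicalClosure = ⊤ := by
  rw [eq_top_iff]
  have hmem : ∀ i, hE.ind ν i ∈ (Submodule.span 𝕜 (Set.range (hE.ind ν))).topologicalClosure :=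
    fun i => Submodule.le_topologicalClosure _ (Submodule.subset_span ⟨i, rfl⟩)
  have h := lpMeas_le_of_isPiSystem (P := ν) (m := mX) le_rfl hE.generateFrom_eq hE.isPiSystem
    (Submodule.span 𝕜 (Set.range (hE.ind ν))).topologicalClosure
    (Submodule.isClosed_topologicalClosure _) (by
      obtain ⟨k, hk, -⟩ := hE.exists_univ
      have := hmem k
      simp only [ind, hk] at this
      exact this) (by
      rintro _ ⟨i, rfl⟩ _
      exact hmem i)
  exact fun f _ => h (mem_lpMeas_self ν f)

theorem eq_of_inner_ind_eq (hE : IsSpectralFamily e E) {ν : Measure X} [IsFiniteMeasure ν]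
    {u w : Lp 𝕜 2 ν} (h : ∀ i, inner 𝕜 (hE.ind ν i) u = inner 𝕜 (hE.ind ν i) w) : u = w := by
  rw [← sub_eq_zero]
  have h1 : u - w ∈ (Submodule.span 𝕜 (Set.range (hE.ind ν)))ᗮ := by
    rw [Submodule.mem_orthogonal]
    intro x hx
    induction hx using Submodule.span_induction with
    | mem x hx =>
      obtain ⟨i, rfl⟩ := hx
      rw [inner_sub_right, h, sub_self]
    | zero => simp
    | add x y _ _ hx hy => rw [inner_add_left, hx, hy, add_zero]
    | smul c x _ hx => rw [inner_smul_left, hx, mul_zero]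
  rw [← Submodule.orthogonal_closure, hE.topologicalClosure_span_ind,
    Submodule.top_orthogonal_eq_bot] at h1
  simpa using h1

theorem inner_apply_apply (hE : IsSpectralFamily e E) {f : H} {ν : Measure X} [IsFiniteMeasure ν]
    (hν : ∀ i, ν (e i) = ENNReal.ofReal (‖E i f‖ ^ 2)) (i j : ι) :
    inner 𝕜 (E i f) (E j f) = inner 𝕜 (hE.ind ν i) (hE.ind ν j) := by
  obtain ⟨k, hk, hk'⟩ := hE.exists_inter i j
  rw [ind, ind, inner_indicatorConstLp_indicatorConstLp, hE.inner_left, hk', ← hE.idem,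
    ← hE.inner_left, inner_self_eq_norm_sq_to_K, ← hk, Measure.real, hν,
    ENNReal.toReal_ofReal (by positivity)]
  push_cast
  rfl

/-- The cyclic subspace of a vector `f`: the closed linear span of all `E i f`. -/
noncomputable def cyclic (E : ι → H →L[𝕜] H) (f : H) : Submodule 𝕜 H :=
  (Submodule.span 𝕜 (Set.range fun i => E i f)).topologicalClosure

theorem cyclic_le_iff {f : H} {K : Submodule 𝕜 H} (hK : IsClosed (K : Set H)) :
    cyclic E f ≤ K ↔ ∀ i, E i f ∈ K := by
  refine ⟨fun h i => h (Submodule.le_topologicalClosure _ (Submodule.subset_span ⟨i, rfl⟩)),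
    fun h => Submodule.topologicalClosure_minimal _ (Submodule.span_le.2 ?_) hK⟩
  rintro _ ⟨i, rfl⟩
  exact h i

theorem mem_cyclic (hE : IsSpectralFamily e E) (f : H) : f ∈ cyclic E f := by
  obtain ⟨k, -, hk⟩ := hE.exists_univ
  have := (cyclic_le_iff (E := E) (f := f)
    (Submodule.isClosed_topologicalClosure _)).1 le_rfl k
  rwa [hk] at this

theorem cyclic_le_comap (hE : IsSpectralFamily e E) (i : ι) (f : H) :
    cyclic E f ≤ (cyclic E f).comap (E i).toLinearMap := by
  refine (cyclic_le_iff ((Submodule.isClosed_topologicalClosure _).preimage (E i).continuous)).2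
    fun j => ?_
  obtain ⟨k, -, hk⟩ := hE.exists_inter i j
  change E i (E j f) ∈ cyclic E f
  rw [hk]
  exact Submodule.le_topologicalClosure _ (Submodule.subset_span ⟨k, rfl⟩)

theorem mem_of_range_ind (hE : IsSpectralFamily e E) {f : H} {ν : Measure X}
    [IsFiniteMeasure ν] {V : Lp 𝕜 2 ν →ₗᵢ[𝕜] H} (hV : ∀ i, V (hE.ind ν i) = E i f)
    (x : Lp 𝕜 2 ν) : V x ∈ cyclic E f := by
  have h : (⊤ : Submodule 𝕜 (Lp 𝕜 2 ν)) ≤ (cyclic E f).comap V.toLinearMap := by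
    rw [← hE.topologicalClosure_span_ind ν]
    refine Submodule.topologicalClosure_minimal _ (Submodule.span_le.2 ?_)
      ((Submodule.isClosed_topologicalClosure _).preimage V.continuous)
    rintro _ ⟨i, rfl⟩
    change V (hE.ind ν i) ∈ cyclic E f
    rw [hV]
    exact Submodule.le_topologicalClosure _ (Submodule.subset_span ⟨i, rfl⟩)
  exact h trivial

variable [CompleteSpace H]

/-- The cyclic subspace of `f` is a copy of `L₂` of the spectral measure of `f`. -/
theorem exists_linearIsometry (hE : IsSpectralFamily e E) {f : H} {ν : Measure X}
    [IsFiniteMeasure ν] (hν : ∀ i, ν (e i) = ENNReal.ofReal (‖E i f‖ ^ 2)) :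
    ∃ V : Lp 𝕜 2 ν →ₗᵢ[𝕜] H, ∀ i, V (hE.ind ν i) = E i f := by
  let a : (ι →₀ 𝕜) →ₗ[𝕜] Lp 𝕜 2 ν := Finsupp.linearCombination 𝕜 (hE.ind ν)
  let b : (ι →₀ 𝕜) →ₗ[𝕜] H := Finsupp.linearCombination 𝕜 fun i => E i f
  have hab : ∀ c, ‖b c‖ = ‖a c‖ := by
    intro c
    have : inner 𝕜 (b c) (b c) = inner 𝕜 (a c) (a c) := by
      simp only [a, b, Finsupp.linearCombination_apply, Finsupp.sum, sum_inner, inner_sum,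
        inner_smul_left, inner_smul_right, hE.inner_apply_apply hν]
    rw [@norm_eq_sqrt_re_inner 𝕜, @norm_eq_sqrt_re_inner 𝕜 _ _ _ _ (a c), this]
  have hdense : DenseRange a := by
    have h := hE.topologicalClosure_span_ind ν
    rw [← Finsupp.range_linearCombination] at h
    exact Submodule.dense_iff_topologicalClosure_eq_top.2 h
  have hbound : ∃ C, ∀ x, ‖b x‖ ≤ C * ‖a x‖ := ⟨1, fun x => by rw [hab, one_mul]⟩
  have hV : ∀ c, b.extendOfNorm a (a c) = b c := LinearMap.extendOfNorm_eq hdense hbound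
  refine ⟨⟨(b.extendOfNorm a).toLinearMap, fun x => ?_⟩, fun i => ?_⟩
  · refine hdense.induction_on (p := fun x => ‖b.extendOfNorm a x‖ = ‖x‖) x
      (isClosed_eq (by fun_prop) (by fun_prop)) fun c => ?_
    rw [hV, hab]
  · have := hV (Finsupp.single i 1)
    simpa [a, b] using this

/-- The sum of the first `n` cyclic subspaces produced from the sequence `g` by the
Gram–Schmidt procedure (not closed in general). -/
noncomputable def cyclicSum (E : ι → H →L[𝕜] H) (g : ℕ → H) : ℕ → Submodule 𝕜 H
  | 0 => ⊥
  | n + 1 => cyclicSum E g n ⊔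
      cyclic E (g n - (cyclicSum E g n).topologicalClosure.starProjection (g n))

/-- The Gram–Schmidt procedure with cyclic subspaces: the component of `g n` orthogonal to the
cyclic subspaces produced so far. -/
noncomputable def cyclicVector (E : ι → H →L[𝕜] H) (g : ℕ → H) (n : ℕ) : H :=
  g n - (cyclicSum E g n).topologicalClosure.starProjection (g n)

theorem cyclicSum_succ (g : ℕ → H) (n : ℕ) :
    cyclicSum E g (n + 1) = cyclicSum E g n ⊔ cyclic E (cyclicVector E g n) := rfl

theorem cyclicSum_mono (g : ℕ → H) : Monotone (cyclicSum E g) :=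
  monotone_nat_of_le_succ fun _ => le_sup_left

/-- The cyclic sums are invariant under the projections; being self-adjoint, the projections
preserve the orthogonal complements, too. -/
theorem cyclicSum_le_comap (hE : IsSpectralFamily e E) (g : ℕ → H) (i : ι) (n : ℕ) :
    cyclicSum E g n ≤ (cyclicSum E g n).comap (E i).toLinearMap := by
  induction n with
  | zero => exact bot_le
  | succ n ih =>
    rw [cyclicSum_succ]
    exact sup_le (ih.trans (Submodule.comap_mono le_sup_left))
      ((hE.cyclic_le_comap i _).trans (Submodule.comap_mono le_sup_right))

theorem cyclic_cyclicVector_le (hE : IsSpectralFamily e E) (g : ℕ → H) (n : ℕ) :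
    cyclic E (cyclicVector E g n) ≤ (cyclicSum E g n)ᗮ := by
  refine (cyclic_le_iff (Submodule.isClosed_orthogonal _)).2 fun i => ?_
  rw [Submodule.mem_orthogonal]
  intro w hw
  rw [← hE.inner_left]
  have h1 : cyclicVector E g n ∈ (cyclicSum E g n)ᗮ := by
    rw [← Submodule.orthogonal_closure]
    exact Submodule.sub_starProjection_mem_orthogonal _
  exact (Submodule.mem_orthogonal _ _).1 h1 _ (hE.cyclicSum_le_comap g i n hw)

theorem inner_eq_zero_of_mem_cyclic (hE : IsSpectralFamily e E) (g : ℕ → H) {n k : ℕ}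
    (hnk : n ≠ k) {v w : H} (hv : v ∈ cyclic E (cyclicVector E g n))
    (hw : w ∈ cyclic E (cyclicVector E g k)) : inner 𝕜 v w = 0 := by
  wlog hlt : n < k generalizing n k v w
  · rw [← inner_conj_symm, this hnk.symm hw hv (lt_of_le_of_ne (not_lt.1 hlt) hnk.symm), map_zero]
  · refine (Submodule.mem_orthogonal _ _).1 (hE.cyclic_cyclicVector_le g k hw) v ?_
    refine cyclicSum_mono g (Nat.succ_le_of_lt hlt) ?_
    rw [cyclicSum_succ]
    exact (le_sup_right : _ ≤ cyclicSum E g n ⊔ _) hv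

theorem mem_topologicalClosure_iSup_cyclic (hE : IsSpectralFamily e E) (g : ℕ → H) (n : ℕ) :
    g n ∈ (⨆ k, cyclic E (cyclicVector E g k)).topologicalClosure := by
  have hle : ∀ n, cyclicSum E g n ≤ ⨆ k, cyclic E (cyclicVector E g k) := by
    intro n
    induction n with
    | zero => exact bot_le
    | succ n ih => exact sup_le ih (le_iSup (fun k => cyclic E (cyclicVector E g k)) n)
  have h1 : g n = cyclicVector E g n +
      (cyclicSum E g n).topologicalClosure.starProjection (g n) := by
    rw [cyclicVector, sub_add_cancel]
  rw [h1]
  refine Submodule.add_mem _ ?_ ?_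
  · exact Submodule.le_topologicalClosure _
      (le_iSup (fun k => cyclic E (cyclicVector E g k)) n (hE.mem_cyclic _))
  · exact Submodule.topologicalClosure_mono (hle n) (Submodule.starProjection_apply_mem _ _)

/-- Spectral theorem for a spectral family: the Hilbert space is a countable orthogonal sum of
spaces `L₂(X, ν n)`, on which `E i` acts as multiplication by the indicator of `e i`. -/
theorem exists_linearIsometryEquiv [SeparableSpace H] (hE : IsSpectralFamily e E) :
    ∃ (ν : ℕ → Measure X) (Φ : H ≃ₗᵢ[𝕜] lp (fun n => Lp 𝕜 2 (ν n)) 2),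
      (∀ n, IsFiniteMeasure (ν n)) ∧
      (∀ n, ∃ f, ∀ i, ν n (e i) = ENNReal.ofReal (‖E i f‖ ^ 2)) ∧
      ∀ i h n, (Φ (E i h) n : X → 𝕜) =ᵐ[ν n] (e i).indicator (Φ h n) := by
  set f : ℕ → H := cyclicVector E (denseSeq H) with hf
  choose ν hfin hν using fun n => hE.exists_measure (f n)
  choose V hV using fun n => hE.exists_linearIsometry (hν n)
  have hmem : ∀ n (x : Lp 𝕜 2 (ν n)), V n x ∈ cyclic E (f n) := fun n x =>
    hE.mem_of_range_ind (hV n) x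
  have hortho : OrthogonalFamily 𝕜 (fun n => Lp 𝕜 2 (ν n)) V := fun n k hnk x y =>
    hE.inner_eq_zero_of_mem_cyclic _ hnk (hmem n x) (hmem k y)
  have htotal : ⊤ ≤ (⨆ n, LinearMap.range (V n).toLinearMap).topologicalClosure := by
    have h1 : ∀ n, cyclic E (f n) ≤
        (⨆ n, LinearMap.range (V n).toLinearMap).topologicalClosure := fun n =>
      (cyclic_le_iff (Submodule.isClosed_topologicalClosure _)).2 fun i =>
        Submodule.le_topologicalClosure _
          ((le_iSup (fun n => LinearMap.range (V n).toLinearMap) n) ⟨hE.ind (ν n) i, hV n i⟩)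
    have h2 : (⨆ n, cyclic E (f n)).topologicalClosure ≤
        (⨆ n, LinearMap.range (V n).toLinearMap).topologicalClosure :=
      Submodule.topologicalClosure_minimal _ (iSup_le h1) (Submodule.isClosed_topologicalClosure _)
    refine le_trans (fun x _ => ?_) h2
    have h3 : Set.range (denseSeq H) ⊆
        ((⨆ n, cyclic E (f n)).topologicalClosure : Set H) := by
      rintro _ ⟨n, rfl⟩
      exact hE.mem_topologicalClosure_iSup_cyclic _ n
    exact (closure_minimal h3 (Submodule.isClosed_topologicalClosure _))
      (denseRange_denseSeq H x)
  have hsum := IsHilbertSum.mk hortho htotal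
  refine ⟨ν, hsum.linearIsometryEquiv, hfin, fun n => ⟨f n, hν n⟩, fun i h n => ?_⟩
  have hinner : ∀ j h, inner 𝕜 (hE.ind (ν n) j) (hsum.linearIsometryEquiv h n) =
      inner 𝕜 (E j (f n)) h := fun j h => by
    rw [← lp.inner_single_left (𝕜 := 𝕜) (G := fun n => Lp 𝕜 2 (ν n)),
      ← hsum.linearIsometryEquiv.symm.inner_map_map,
      hsum.linearIsometryEquiv_symm_apply_single, hV, LinearIsometryEquiv.symm_apply_apply]
  have hmemLp : MemLp ((e i).indicator (hsum.linearIsometryEquiv h n)) 2 (ν n) :=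
    (Lp.memLp _).indicator (hE.measurableSet i)
  suffices hs : hsum.linearIsometryEquiv (E i h) n = hmemLp.toLp _ by
    rw [hs]
    exact hmemLp.coeFn_toLp
  refine hE.eq_of_inner_ind_eq fun j => ?_
  obtain ⟨k, hk, hk'⟩ := hE.exists_inter i j
  rw [hinner, ← hE.inner_left, hk', ← hinner, ind, ind, L2.inner_indicatorConstLp_one,
    L2.inner_indicatorConstLp_one,
    setIntegral_congr_ae (hE.measurableSet j) (hmemLp.coeFn_toLp.mono fun x hx _ => hx),
    setIntegral_indicator (hE.measurableSet i), hk, Set.inter_comm]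

end IsSpectralFamily

/-! ### Square summable sequences -/

theorem memℓp_two_iff_tsum_enorm {α : Type*} {G : α → Type*} [∀ n, NormedAddCommGroup (G n)]
    {z : ∀ n, G n} : Memℓp z 2 ↔ ∑' n, ‖z n‖ₑ ^ 2 ≠ ∞ := by
  have h (n : α) : ‖z n‖ₑ ^ 2 = ((‖z n‖₊ ^ 2 : NNReal) : ℝ≥0∞) := by simp [enorm]
  rw [memℓp_gen_iff (by norm_num)]
  simp only [h, ENNReal.tsum_coe_ne_top_iff_summable, ← NNReal.summable_coe]
  simp

theorem tsum_enorm_sq {α : Type*} {G : α → Type*} [∀ n, NormedAddCommGroup (G n)]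
    (z : lp G 2) : ∑' n, ‖z n‖ₑ ^ 2 = ‖z‖ₑ ^ 2 := by
  have h := lp.hasSum_norm (p := 2) (by norm_num) z
  simp only [ENNReal.toReal_ofNat, Real.rpow_ofNat] at h
  have h' (x : ℝ) (hx : 0 ≤ x) : ENNReal.ofReal x ^ 2 = ENNReal.ofReal (x ^ 2) :=
    (ENNReal.ofReal_pow hx 2).symm
  simp only [← ofReal_norm, h' _ (norm_nonneg _)]
  rw [← h.tsum_eq, ENNReal.ofReal_tsum_of_nonneg (fun n => sq_nonneg _) h.summable]

/-- The square summable sequences that vanish wherever `a` does. -/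
def supportedSeq (𝕜 : Type) [RCLike 𝕜] (a : ℕ → ℝ) : Submodule 𝕜 (lp (fun _ : ℕ => 𝕜) 2) where
  carrier := {z | ∀ n, a n = 0 → z n = 0}
  add_mem' {z z'} h h' n hn := by simp [h n hn, h' n hn]
  zero_mem' n _ := rfl
  smul_mem' c z h n hn := by simp [h n hn]

namespace supportedSeq

variable {𝕜 : Type} [RCLike 𝕜] {a : ℕ → ℝ}

instance completeSpace : CompleteSpace (supportedSeq 𝕜 a) := by
  have h : IsClosed (supportedSeq 𝕜 a : Set (lp (fun _ : ℕ => 𝕜) 2)) := by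
    have h' : (supportedSeq 𝕜 a : Set (lp (fun _ : ℕ => 𝕜) 2)) =
        ⋂ (n : ℕ) (_ : a n = 0), {z | z n = 0} := by
      ext z
      simp only [Set.mem_iInter]
      rfl
    rw [h']
    refine isClosed_iInter fun n => isClosed_iInter fun _ => ?_
    exact isClosed_eq (lp.lipschitzWith_one_eval 2 n).continuous continuous_const
  exact h.completeSpace_coe

variable (𝕜 a) in
/-- The `n`-th unit vector, or zero where `a n = 0` forbids it. -/
noncomputable def unit (n : ℕ) : supportedSeq 𝕜 a :=
  ⟨if a n = 0 then 0 else lp.single 2 n 1, fun k hk => by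
    split_ifs with h
    · rfl
    · have hkn : k ≠ n := by
        rintro rfl
        exact h hk
      rw [lp.single_apply_ne _ _ _ hkn]⟩

theorem inner_unit (n : ℕ) (z : supportedSeq 𝕜 a) :
    inner 𝕜 (unit 𝕜 a n) z = (z : lp (fun _ : ℕ => 𝕜) 2) n := by
  rw [Submodule.coe_inner]
  by_cases h : a n = 0
  · simp [unit, h, z.2 n h]
  · simp only [unit, h, if_false]
    rw [lp.inner_single_left]
    simp

theorem topologicalClosure_span_unit :
    (Submodule.span 𝕜 (Set.range (unit 𝕜 a))).topologicalClosure = ⊤ := by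
  rw [Submodule.topologicalClosure_eq_top_iff, Submodule.eq_bot_iff]
  intro z hz
  ext n
  rw [← inner_unit]
  exact hz _ (Submodule.subset_span ⟨n, rfl⟩)

theorem measurable_unit {X : Type*} [MeasurableSpace X] {w : ℕ → X → ℝ}
    (hw : ∀ n, Measurable (w n)) (n k : ℕ) :
    Measurable fun x => (unit 𝕜 (fun n => w n x) n : lp (fun _ : ℕ => 𝕜) 2) k := by
  have h : (fun x => (unit 𝕜 (fun n => w n x) n : lp (fun _ : ℕ => 𝕜) 2) k) =
      fun x => if w n x = 0 then 0 else (lp.single 2 n 1 : lp (fun _ : ℕ => 𝕜) 2) k := by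
    funext x
    simp only [unit]
    split_ifs <;> rfl
  rw [h]
  exact Measurable.ite (hw n (measurableSet_singleton 0)) measurable_const measurable_const

end supportedSeq

/-! ### A direct sum of spaces of square integrable functions as a direct integral -/

section componentField

variable {X : Type u} [MeasurableSpace X] (𝕜 : Type) [RCLike 𝕜]

/-- The measurable field of Hilbert spaces over `(X, μ)` whose fibre at `x` consists of the square
summable sequences vanishing at all `n` with `w n x = 0`; measurability is componentwise. -/
noncomputable def componentField (μ : Measure X) {w : ℕ → X → ℝ} (hw : ∀ n, Measurable (w n)) :
    MeasurableHilbertField.{u, 0} 𝕜 μ :=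
  have hinner : ∀ ξ η : ∀ x, supportedSeq 𝕜 (fun n => w n x),
      (∀ n, AEMeasurable (fun x => (ξ x : lp (fun _ : ℕ => 𝕜) 2) n) μ) →
      (∀ n, AEMeasurable (fun x => (η x : lp (fun _ : ℕ => 𝕜) 2) n) μ) →
      AEMeasurable (fun x => inner 𝕜 (ξ x) (η x)) μ := fun ξ η hξ hη =>
    aemeasurable_of_tendsto_metrizable_ae atTop
      (f := fun k x => ∑ n ∈ Finset.range k, inner 𝕜 ((ξ x : lp (fun _ : ℕ => 𝕜) 2) n)
        ((η x : lp (fun _ : ℕ => 𝕜) 2) n))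
      (fun k => Finset.aemeasurable_fun_sum _ fun n _ => (hξ n).inner (hη n))
      (ae_of_all _ fun x => (lp.hasSum_inner _ _).tendsto_sum_nat)
  { fiber := fun x => supportedSeq 𝕜 (fun n => w n x)
    fields :=
      { carrier := {ξ | ∀ n, AEMeasurable (fun x => (ξ x : lp (fun _ : ℕ => 𝕜) 2) n) μ}
        add_mem' := fun h h' n => (h n).add (h' n)
        zero_mem' := fun n => aemeasurable_const
        smul_mem' := fun c ξ h n => (h n).const_smul c }
    aemeasurable_norm := fun ξ hξ => by
      simp only [norm_eq_sqrt_re_inner (𝕜 := 𝕜)]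
      exact (RCLike.measurable_re.comp_aemeasurable (hinner ξ ξ hξ hξ)).sqrt
    mem_of_aemeasurable_inner := fun η hη n => by
      have h := hη (fun x => supportedSeq.unit 𝕜 (fun n => w n x) n) fun k =>
        (supportedSeq.measurable_unit hw n k).aemeasurable
      simpa only [supportedSeq.inner_unit] using h
    exists_total := ⟨fun n x => supportedSeq.unit 𝕜 (fun n => w n x) n, fun n k =>
        (supportedSeq.measurable_unit hw n k).aemeasurable,
      fun x => supportedSeq.topologicalClosure_span_unit⟩ }

end componentField

namespace componentField

variable {X : Type u} [MeasurableSpace X] {𝕜 : Type} [RCLike 𝕜] {μ : Measure X}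
  {w : ℕ → X → ℝ} {ν : ℕ → Measure X}

open Classical in
/-- The value at `x` of the vector field that represents `z = (z n)`, whose components are
`w n x * z n x`; the value is zero when these are not square summable, which happens on a
negligible set only. -/
noncomputable def value (w : ℕ → X → ℝ) (z : lp (fun n => Lp 𝕜 2 (ν n)) 2) (x : X) :
    supportedSeq 𝕜 (fun n => w n x) :=
  if h : Memℓp (fun n => (w n x : 𝕜) * z n x) 2 then
    ⟨⟨fun n => (w n x : 𝕜) * z n x, h⟩, fun n hn => by
      change w n x = 0 at hn
      change (w n x : 𝕜) * z n x = 0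
      rw [hn, RCLike.ofReal_zero, zero_mul]⟩
  else 0

theorem measurable_mul (hw : ∀ n, Measurable (w n)) (z : lp (fun n => Lp 𝕜 2 (ν n)) 2) (n : ℕ) :
    Measurable fun x => (w n x : 𝕜) * z n x :=
  (RCLike.measurable_ofReal.comp (hw n)).mul (Lp.stronglyMeasurable _).measurable

theorem lintegral_enorm_mul_sq (hw : ∀ n, Measurable (w n))
    (hν : ∀ n, ν n = μ.withDensity fun x => ENNReal.ofReal (w n x ^ 2)) (n : ℕ) {u : X → 𝕜}
    (hu : AEMeasurable u μ) :
    ∫⁻ x, ‖(w n x : 𝕜) * u x‖ₑ ^ 2 ∂μ = ∫⁻ x, ‖u x‖ₑ ^ 2 ∂(ν n) := by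
  rw [hν, lintegral_withDensity_eq_lintegral_mul₀' ((hw n).pow_const 2).ennreal_ofReal.aemeasurable
    ((hu.enorm.pow_const 2).mono_ac (withDensity_absolutelyContinuous _ _))]
  refine lintegral_congr fun x => ?_
  rw [Pi.mul_apply, enorm_mul, mul_pow]
  congr 1
  rw [← ofReal_norm, RCLike.norm_ofReal, ← ENNReal.ofReal_pow (abs_nonneg _), sq_abs]

theorem eLpNorm_two_sq {E : Type*} [NormedAddCommGroup E] (u : X → E) (ν : Measure X) :
    eLpNorm u 2 ν ^ 2 = ∫⁻ x, ‖u x‖ₑ ^ 2 ∂ν := by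
  have h := eLpNorm_nnreal_pow_eq_lintegral (p := 2) (f := u) (μ := ν) (by norm_num)
  simpa only [NNReal.coe_ofNat, ENNReal.rpow_ofNat, ENNReal.coe_ofNat] using h

theorem enorm_sq_eq_lintegral {ν : Measure X} (u : Lp 𝕜 2 ν) :
    ‖u‖ₑ ^ 2 = ∫⁻ x, ‖u x‖ₑ ^ 2 ∂ν := by
  rw [Lp.enorm_def, eLpNorm_two_sq]

theorem lintegral_tsum_mul (hw : ∀ n, Measurable (w n))
    (hν : ∀ n, ν n = μ.withDensity fun x => ENNReal.ofReal (w n x ^ 2))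
    (z : lp (fun n => Lp 𝕜 2 (ν n)) 2) :
    ∫⁻ x, ∑' n, ‖(w n x : 𝕜) * z n x‖ₑ ^ 2 ∂μ = ‖z‖ₑ ^ 2 := by
  rw [lintegral_tsum fun n => ((measurable_mul hw z n).enorm.pow_const 2).aemeasurable,
    ← tsum_enorm_sq]
  congr 1
  funext n
  rw [lintegral_enorm_mul_sq hw hν n (Lp.stronglyMeasurable _).measurable.aemeasurable,
    enorm_sq_eq_lintegral]

theorem ae_value_apply (hw : ∀ n, Measurable (w n))
    (hν : ∀ n, ν n = μ.withDensity fun x => ENNReal.ofReal (w n x ^ 2))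
    (z : lp (fun n => Lp 𝕜 2 (ν n)) 2) :
    ∀ᵐ x ∂μ, ∀ n, (value w z x : lp (fun _ : ℕ => 𝕜) 2) n = (w n x : 𝕜) * z n x := by
  have h : ∀ᵐ x ∂μ, ∑' n, ‖(w n x : 𝕜) * z n x‖ₑ ^ 2 < ∞ := by
    refine ae_lt_top (Measurable.tsum fun n =>
      (measurable_mul hw z n).enorm.pow_const 2) ?_
    rw [lintegral_tsum_mul hw hν]
    simp
  filter_upwards [h] with x hx n
  rw [value, dif_pos (memℓp_two_iff_tsum_enorm.2 hx.ne)]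

/-- The map `z ↦ value w z` is isometric. -/
theorem lintegral_enorm_value (hw : ∀ n, Measurable (w n))
    (hν : ∀ n, ν n = μ.withDensity fun x => ENNReal.ofReal (w n x ^ 2))
    (z : lp (fun n => Lp 𝕜 2 (ν n)) 2) : ∫⁻ x, ‖value w z x‖ₑ ^ 2 ∂μ = ‖z‖ₑ ^ 2 := by
  rw [← lintegral_tsum_mul hw hν]
  refine lintegral_congr_ae ((ae_value_apply hw hν z).mono fun x hx => ?_)
  change ‖(value w z x : lp (fun _ : ℕ => 𝕜) 2)‖ₑ ^ 2 = _
  rw [← tsum_enorm_sq]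
  simp only [hx]

/-- Values of square integrable functions matter only where the density is nonzero. -/
theorem ae_mul_eq (hw : ∀ n, Measurable (w n))
    (hν : ∀ n, ν n = μ.withDensity fun x => ENNReal.ofReal (w n x ^ 2)) {u u' : ℕ → X → 𝕜}
    (h : ∀ n, u n =ᵐ[ν n] u' n) :
    ∀ᵐ x ∂μ, ∀ n, (w n x : 𝕜) * u n x = (w n x : 𝕜) * u' n x := by
  refine ae_all_iff.2 fun n => ?_
  have h' := h n
  rw [hν, Filter.EventuallyEq,
    ae_withDensity_iff ((hw n).pow_const 2).ennreal_ofReal] at h'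
  filter_upwards [h'] with x hx
  by_cases h0 : w n x = 0
  · rw [h0, RCLike.ofReal_zero, zero_mul, zero_mul]
  · rw [hx]
    rw [Ne, ENNReal.ofReal_eq_zero, not_le]
    positivity

theorem ae_value_eq (hw : ∀ n, Measurable (w n))
    (hν : ∀ n, ν n = μ.withDensity fun x => ENNReal.ofReal (w n x ^ 2))
    (z : lp (fun n => Lp 𝕜 2 (ν n)) 2) {u : ℕ → X → 𝕜} (hu : ∀ n, z n =ᵐ[ν n] u n)
    (ξ : ∀ x, supportedSeq 𝕜 (fun n => w n x))
    (hξ : ∀ᵐ x ∂μ, ∀ n, (w n x : 𝕜) * u n x = (ξ x : lp (fun _ : ℕ => 𝕜) 2) n) :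
    ∀ᵐ x ∂μ, value w z x = ξ x := by
  filter_upwards [ae_value_apply hw hν z, ae_mul_eq hw hν hu, hξ] with x h1 h2 h3
  ext n
  rw [h1, h2, h3]

theorem value_mem (hw : ∀ n, Measurable (w n))
    (hν : ∀ n, ν n = μ.withDensity fun x => ENNReal.ofReal (w n x ^ 2))
    (z : lp (fun n => Lp 𝕜 2 (ν n)) 2) :
    (value w z : ∀ x, supportedSeq 𝕜 (fun n => w n x)) ∈ (componentField 𝕜 μ hw).fields :=
  fun n => (measurable_mul hw z n).aemeasurable.congr
    ((ae_value_apply hw hν z).mono fun _ hx => (hx n).symm)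

theorem ae_value_add (hw : ∀ n, Measurable (w n))
    (hν : ∀ n, ν n = μ.withDensity fun x => ENNReal.ofReal (w n x ^ 2))
    (z z' : lp (fun n => Lp 𝕜 2 (ν n)) 2) :
    ∀ᵐ x ∂μ, value w (z + z') x = value w z x + value w z' x :=
  ae_value_eq hw hν (z + z') (fun n => Lp.coeFn_add (z n) (z' n))
    (fun x => value w z x + value w z' x) (by
      filter_upwards [ae_value_apply hw hν z, ae_value_apply hw hν z'] with x h h' n
      change _ = (value w z x : lp (fun _ : ℕ => 𝕜) 2) n + (value w z' x : lp (fun _ : ℕ => 𝕜) 2) n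
      rw [h, h', Pi.add_apply, mul_add])

theorem ae_value_smul (hw : ∀ n, Measurable (w n))
    (hν : ∀ n, ν n = μ.withDensity fun x => ENNReal.ofReal (w n x ^ 2)) (c : 𝕜)
    (z : lp (fun n => Lp 𝕜 2 (ν n)) 2) :
    ∀ᵐ x ∂μ, value w (c • z) x = c • value w z x :=
  ae_value_eq hw hν (c • z) (fun n => Lp.coeFn_smul c (z n)) (fun x => c • value w z x) (by
    filter_upwards [ae_value_apply hw hν z] with x h n
    change _ = c • (value w z x : lp (fun _ : ℕ => 𝕜) 2) n
    rw [h, Pi.smul_apply, smul_eq_mul, smul_eq_mul, mul_left_comm])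

theorem memLp_norm_value (hw : ∀ n, Measurable (w n))
    (hν : ∀ n, ν n = μ.withDensity fun x => ENNReal.ofReal (w n x ^ 2))
    (z : lp (fun n => Lp 𝕜 2 (ν n)) 2) : MemLp (fun x => ‖value w z x‖) 2 μ := by
  refine ⟨((componentField 𝕜 μ hw).aemeasurable_norm _ (value_mem hw hν z)).aestronglyMeasurable,
    ?_⟩
  have h : eLpNorm (fun x => ‖value w z x‖) 2 μ ^ 2 ≠ ∞ := by
    simp only [eLpNorm_two_sq, enorm_norm, lintegral_enorm_value hw hν]
    simp
  exact lt_top_iff_ne_top.2 fun hc => h (by rw [hc, ENNReal.top_pow two_ne_zero])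

theorem norm_sq_eq_integral (hw : ∀ n, Measurable (w n))
    (hν : ∀ n, ν n = μ.withDensity fun x => ENNReal.ofReal (w n x ^ 2))
    (z : lp (fun n => Lp 𝕜 2 (ν n)) 2) : ‖z‖ ^ 2 = ∫ x, ‖value w z x‖ ^ 2 ∂μ := by
  rw [integral_eq_lintegral_of_nonneg_ae (ae_of_all _ fun _ => sq_nonneg _)
    ((memLp_norm_value hw hν z).1.pow 2)]
  have h : ∀ x, ENNReal.ofReal (‖value w z x‖ ^ 2) = ‖value w z x‖ₑ ^ 2 := fun x => by
    rw [ENNReal.ofReal_pow (norm_nonneg _), ofReal_norm]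
  simp only [h, lintegral_enorm_value hw hν]
  simp

/-- The map `z ↦ value w z` preserves norms, hence inner products, by polarization. -/
theorem inner_eq_integral (hw : ∀ n, Measurable (w n))
    (hν : ∀ n, ν n = μ.withDensity fun x => ENNReal.ofReal (w n x ^ 2))
    (z z' : lp (fun n => Lp 𝕜 2 (ν n)) 2) :
    inner 𝕜 z z' = ∫ x, inner 𝕜 (value w z x) (value w z' x) ∂μ := by
  have hint : ∀ y : lp (fun n => Lp 𝕜 2 (ν n)) 2,
      Integrable (fun x => ((‖value w y x‖ : ℝ) : 𝕜) ^ 2) μ := fun y => by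
    have := (memLp_norm_value hw hν y).integrable_sq.ofReal (𝕜 := 𝕜)
    simpa using this
  have hnorm : ∀ y : lp (fun n => Lp 𝕜 2 (ν n)) 2,
      ((‖y‖ : ℝ) : 𝕜) ^ 2 = ∫ x, ((‖value w y x‖ : ℝ) : 𝕜) ^ 2 ∂μ := fun y => by
    rw [← RCLike.ofReal_pow, norm_sq_eq_integral hw hν, ← integral_ofReal]
    simp
  have hsub : ∀ y y' : lp (fun n => Lp 𝕜 2 (ν n)) 2,
      ∀ᵐ x ∂μ, value w (y - y') x = value w y x - value w y' x := fun y y' => by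
    filter_upwards [ae_value_add hw hν y (-y'), ae_value_smul hw hν (-1) y'] with x h h'
    rw [sub_eq_add_neg, h, ← neg_one_smul 𝕜 y', h', neg_one_smul, sub_eq_add_neg]
  have key : ∀ᵐ x ∂μ, inner 𝕜 (value w z x) (value w z' x) =
      (((‖value w (z + z') x‖ : ℝ) : 𝕜) ^ 2 - ((‖value w (z - z') x‖ : ℝ) : 𝕜) ^ 2 +
        (((‖value w (z - (RCLike.I : 𝕜) • z') x‖ : ℝ) : 𝕜) ^ 2 -
          ((‖value w (z + (RCLike.I : 𝕜) • z') x‖ : ℝ) : 𝕜) ^ 2) * (RCLike.I : 𝕜)) / 4 := by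
    filter_upwards [ae_value_add hw hν z z', hsub z z',
      ae_value_add hw hν z ((RCLike.I : 𝕜) • z'), hsub z ((RCLike.I : 𝕜) • z'),
      ae_value_smul hw hν (RCLike.I : 𝕜) z'] with x h1 h2 h3 h4 h5
    rw [h1, h2, h3, h4, h5, inner_eq_sum_norm_sq_div_four]
  have hdiff : ∀ y y' : lp (fun n => Lp 𝕜 2 (ν n)) 2, Integrable
      (fun x => ((‖value w y x‖ : ℝ) : 𝕜) ^ 2 - ((‖value w y' x‖ : ℝ) : 𝕜) ^ 2) μ :=
    fun y y' => (hint y).sub (hint y')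
  rw [integral_congr_ae key, integral_div, integral_add (hdiff _ _)
    ((hdiff _ _).mul_const _), integral_mul_const, integral_sub (hint _) (hint _),
    integral_sub (hint _) (hint _), ← hnorm, ← hnorm, ← hnorm, ← hnorm,
    inner_eq_sum_norm_sq_div_four]

/-- Every square integrable measurable field is represented: divide its components by `w n`. -/
theorem exists_value_eq (hw : ∀ n, Measurable (w n))
    (hν : ∀ n, ν n = μ.withDensity fun x => ENNReal.ofReal (w n x ^ 2))
    {ξ : ∀ x, supportedSeq 𝕜 (fun n => w n x)}
    (hξ : ∀ n, AEMeasurable (fun x => (ξ x : lp (fun _ : ℕ => 𝕜) 2) n) μ)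
    (hfin : MemLp (fun x => ‖ξ x‖) 2 μ) :
    ∃ z : lp (fun n => Lp 𝕜 2 (ν n)) 2, ∀ᵐ x ∂μ, value w z x = ξ x := by
  set u : ℕ → X → 𝕜 := fun n x => ((w n x)⁻¹ : ℝ) * (ξ x : lp (fun _ : ℕ => 𝕜) 2) n with hu_def
  have hwu : ∀ n x, (w n x : 𝕜) * u n x = (ξ x : lp (fun _ : ℕ => 𝕜) 2) n := fun n x => by
    by_cases h0 : w n x = 0
    -- Here `(w n x)⁻¹` is the junk value `0`, and the component of `ξ x` vanishes as well.
    · rw [h0, (ξ x).2 n h0, RCLike.ofReal_zero, zero_mul]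
    · rw [hu_def, ← mul_assoc, ← RCLike.ofReal_mul, mul_inv_cancel₀ h0, RCLike.ofReal_one, one_mul]
  have hu : ∀ n, AEMeasurable (u n) μ := fun n =>
    (RCLike.measurable_ofReal.comp (hw n).inv).aemeasurable.mul (hξ n)
  have hsum : ∑' n, ∫⁻ x, ‖u n x‖ₑ ^ 2 ∂(ν n) ≠ ∞ := by
    simp only [← lintegral_enorm_mul_sq hw hν _ (hu _), hwu]
    rw [← lintegral_tsum fun n => (hξ n).enorm.pow_const 2]
    simp only [tsum_enorm_sq]
    have h := ENNReal.pow_ne_top (n := 2) hfin.2.ne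
    simp only [eLpNorm_two_sq, enorm_norm] at h
    exact h
  have hmem : ∀ n, MemLp (u n) 2 (ν n) := fun n => by
    refine ⟨((hu n).mono_ac ?_).aestronglyMeasurable, ?_⟩
    · rw [hν]
      exact withDensity_absolutelyContinuous _ _
    have h := ENNReal.ne_top_of_tsum_ne_top hsum n
    rw [← eLpNorm_two_sq] at h
    exact lt_top_iff_ne_top.2 fun hc => h (by simp [hc])
  have hmem' : Memℓp (fun n => (hmem n).toLp (u n)) 2 := by
    rw [memℓp_two_iff_tsum_enorm]
    convert hsum using 3 with n
    rw [enorm_sq_eq_lintegral]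
    exact lintegral_congr_ae ((hmem n).coeFn_toLp.mono fun x hx => by
      beta_reduce
      rw [hx])
  exact ⟨⟨fun n => (hmem n).toLp _, hmem'⟩, ae_value_eq hw hν _ (fun n => (hmem n).coeFn_toLp) ξ
    (ae_of_all _ fun x n => hwu n x)⟩

/-- A unitary map of `K` onto the direct sum of the spaces `L₂(ν n)`, as a decomposition of `K`
into a direct integral. -/
noncomputable def decomposition {K : Type*} [NormedAddCommGroup K] [InnerProductSpace 𝕜 K]
    (Φ : K ≃ₗᵢ[𝕜] lp (fun n => Lp 𝕜 2 (ν n)) 2) (hw : ∀ n, Measurable (w n))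
    (hν : ∀ n, ν n = μ.withDensity fun x => ENNReal.ofReal (w n x ^ 2)) :
    DirectIntegralDecomposition 𝕜 (componentField 𝕜 μ hw) K where
  coord f := value w (Φ f)
  coord_mem f := value_mem hw hν _
  memLp_coord f := memLp_norm_value hw hν _
  coord_add f g := by
    rw [map_add]
    exact ae_value_add hw hν _ _
  coord_smul c f := by
    rw [map_smul]
    exact ae_value_smul hw hν _ _
  inner_eq f g := by
    rw [← Φ.inner_map_map]
    exact inner_eq_integral hw hν _ _
  surjective ξ hξ hfin := by
    obtain ⟨z, hz⟩ := exists_value_eq hw hν hξ hfin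
    exact ⟨Φ.symm z, by rwa [Φ.apply_symm_apply]⟩

end componentField

theorem supportedSeq.nontrivial {𝕜 : Type} [RCLike 𝕜] {a : ℕ → ℝ} {n : ℕ} (hn : a n ≠ 0) :
    Nontrivial (supportedSeq 𝕜 a) := by
  refine ⟨unit 𝕜 a n, 0, fun h => ?_⟩
  have h1 := congrArg (fun z : supportedSeq 𝕜 a => (z : lp (fun _ : ℕ => 𝕜) 2) n) h
  simp [unit, hn] at h1

/-! ### Existence of a spectral measure -/

/-- A countable family of finite measures, not all zero, has densities with respect to a
probability measure whose null sets are exactly the common null sets of the family. -/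
theorem exists_isProbabilityMeasure_withDensity {X : Type*} [MeasurableSpace X]
    (ν : ℕ → Measure X) [∀ n, IsFiniteMeasure (ν n)] (hne : ∃ n, ν n ≠ 0) :
    ∃ (μ : Measure X) (w : ℕ → X → ℝ), IsProbabilityMeasure μ ∧
      (∀ s, (∀ n, ν n s = 0) → μ s = 0) ∧ (∀ n, Measurable (w n)) ∧
      ∀ n, ν n = μ.withDensity fun x => ENNReal.ofReal (w n x ^ 2) := by
  have hne' : NeZero (Measure.sum ν) := ⟨by
    obtain ⟨n, hn⟩ := hne
    rw [Ne, Measure.sum_eq_zero]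
    exact fun h => hn (h n)⟩
  have hac : ∀ n, ν n ≪ (Measure.sum ν).toFinite := fun n =>
    (Measure.absolutelyContinuous_sum_right n Measure.AbsolutelyContinuous.rfl).trans
      (absolutelyContinuous_toFinite _)
  refine ⟨(Measure.sum ν).toFinite,
    fun n x => √((ν n).rnDeriv (Measure.sum ν).toFinite x).toReal, inferInstance, fun s hs => ?_,
    fun n => (Measure.measurable_rnDeriv _ _).ennreal_toReal.sqrt, fun n => ?_⟩
  · rw [toFinite_apply_eq_zero_iff, Measure.sum_apply_eq_zero]
    exact hs
  · conv_lhs => rw [← Measure.withDensity_rnDeriv_eq _ _ (hac n)]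
    refine withDensity_congr_ae ((Measure.rnDeriv_lt_top (ν n) _).mono fun x hx => ?_)
    beta_reduce
    rw [Real.sq_sqrt ENNReal.toReal_nonneg, ENNReal.ofReal_toReal hx.ne]

/-- A family of commuting projections with spectral measures is diagonalized by a direct integral
decomposition, over a measure whose null sets are null for all spectral measures. -/
theorem IsSpectralFamily.exists_decomposition {𝕜 : Type} [RCLike 𝕜] {H ι : Type*}
    [NormedAddCommGroup H] [InnerProductSpace 𝕜 H] [CompleteSpace H] [SeparableSpace H]
    [Nontrivial H] {X : Type u} [MeasurableSpace X] {e : ι → Set X} {E : ι → H →L[𝕜] H}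
    (hE : IsSpectralFamily e E) :
    ∃ μ : Measure X, IsProbabilityMeasure μ ∧
      (∀ s, (∀ (f : H) (ν : Measure X), IsFiniteMeasure ν →
        (∀ i, ν (e i) = ENNReal.ofReal (‖E i f‖ ^ 2)) → ν s = 0) → μ s = 0) ∧
      ∃ (F : MeasurableHilbertField.{u, 0} 𝕜 μ) (D : DirectIntegralDecomposition 𝕜 F H),
        (∀ᵐ x ∂μ, Nontrivial (F.fiber x)) ∧
        ∀ i f, ∀ᵐ x ∂μ, D.coord (E i f) x =
          (e i).indicator (fun _ => (1 : 𝕜)) x • D.coord f x := by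
  obtain ⟨ν, Φ, hfin, hν, hΦ⟩ := hE.exists_linearIsometryEquiv
  have hne : ∃ n, ν n ≠ 0 := by
    by_contra! h0
    obtain ⟨f, hf⟩ := exists_ne (0 : H)
    have hsub : ∀ n, ∀ u : Lp 𝕜 2 (ν n), u = 0 := fun n => by
      rw [h0 n]
      exact fun u => Lp.ext (by rw [EventuallyEq, ae_zero]; exact eventually_bot)
    refine hf (Φ.injective ?_)
    rw [map_zero]
    exact Subtype.ext (funext fun n => hsub n _)
  obtain ⟨μ, w, hμ, hnull, hw, hνw⟩ := exists_isProbabilityMeasure_withDensity ν hne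
  refine ⟨μ, hμ, fun s hs => hnull s fun n => ?_, componentField 𝕜 μ hw,
    componentField.decomposition Φ hw hνw, ?_, fun i f => ?_⟩
  · obtain ⟨f, hf⟩ := hν n
    exact hs f _ (hfin n) hf
  · have hs : μ {x | ∀ n, w n x = 0} = 0 := by
      refine hnull _ fun n => ?_
      rw [hνw, withDensity_apply_eq_zero ((hw n).pow_const 2).ennreal_ofReal]
      convert measure_empty (μ := μ)
      ext x
      simp only [Set.mem_inter_iff, Set.mem_ofPred_eq, Set.mem_empty_iff_false, iff_false, not_and]
      intro h h'
      exact h (by rw [h' n]; simp)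
    rw [measure_eq_zero_iff_ae_notMem] at hs
    filter_upwards [hs] with x hx
    simp only [not_forall] at hx
    obtain ⟨n, hn⟩ := hx
    exact supportedSeq.nontrivial hn
  · refine componentField.ae_value_eq hw hνw (Φ (E i f)) (fun n => hΦ i f n)
      (fun x => (e i).indicator (fun _ => (1 : 𝕜)) x • componentField.value w (Φ f) x) ?_
    filter_upwards [componentField.ae_value_apply hw hνw (Φ f)] with x hx n
    change _ = (e i).indicator (fun _ => (1 : 𝕜)) x •
      (componentField.value w (Φ f) x : lp (fun _ : ℕ => 𝕜) 2) n
    rw [hx]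
    by_cases hxi : x ∈ e i <;> simp [hxi]

namespace Noise

variable {Ω : Type u} [mΩ : MeasurableSpace Ω] {P : Measure Ω} (N : Noise P)
  {𝕜 : Type} [RCLike 𝕜] [IsProbabilityMeasure P]

variable (𝕜) in
/-- The conditional expectation given `F_A`, as an operator on `L₂(Ω, F_{-∞, ∞}, P)`. -/
noncomputable def prTop (A : Set ℝ) : N.L2 𝕜 →L[𝕜] N.L2 𝕜 :=
  (N.pr 𝕜 A ∘L (N.L2 𝕜).subtypeL).codRestrict (N.L2 𝕜) 
    fun f : N.L2 𝕜 => N.pr_mem_fieldTop A (f : Lp 𝕜 2 P)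

theorem condExpL2_eq_prTop (A : Set ℝ) (f : N.L2 𝕜) : N.condExpL2 A f = N.prTop 𝕜 A f :=
  Subtype.ext (N.coe_condExpL2 A f)

theorem prTop_prTop (A : Set ℝ) {B : Set ℝ} (hB : HasFiniteCuts B) (f : N.L2 𝕜) :
    N.prTop 𝕜 B (N.prTop 𝕜 A f) = N.prTop 𝕜 (B ∩ A) f := by
  refine Subtype.ext ?_
  rw [Set.inter_comm]
  exact N.pr_pr A hB (f : Lp 𝕜 2 P)

theorem inner_prTop_left (A : Set ℝ) (f g : N.L2 𝕜) :
    inner 𝕜 (N.prTop 𝕜 A f) g = inner 𝕜 f (N.prTop 𝕜 A g) :=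
  N.inner_pr_left A (f : Lp 𝕜 2 P) (g : Lp 𝕜 2 P)

theorem prTop_univ (f : N.L2 𝕜) : N.prTop 𝕜 Set.univ f = f :=
  Subtype.ext (N.pr_univ f.2)

theorem prTop_compl_singleton (t : ℝ) (f : N.L2 𝕜) : N.prTop 𝕜 {t}ᶜ f = f :=
  Subtype.ext (N.pr_compl_singleton f.2 t)

theorem isSpectralFamily_prTop [MeasureTheory.IsSeparable P] :
    IsSpectralFamily (fun A : {A : Set ℝ // HasFiniteCuts A} => compactsIn A.1)
      (fun A => N.prTop 𝕜 A.1) where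
  generateFrom_eq := by
    refine le_antisymm ?_ (MeasurableSpace.generateFrom_le ?_)
    · rw [measurableSpace_compacts_eq]
      refine MeasurableSpace.generateFrom_mono ?_
      rintro _ ⟨p, rfl⟩
      exact ⟨⟨_, (hasFiniteCuts_of_ordConnected Set.ordConnected_Icc).compl⟩, rfl⟩
    · rintro _ ⟨A, rfl⟩
      exact A.2.measurableSet_compactsIn
  idem A f := by rw [N.prTop_prTop A.1 A.2, Set.inter_self]
  inner_left A f g := N.inner_prTop_left A.1 f g
  exists_inter A B := ⟨⟨A.1 ∩ B.1, A.2.inter B.2⟩, compactsIn_inter _ _, fun f =>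
    N.prTop_prTop B.1 A.2 f⟩
  exists_univ := ⟨⟨Set.univ, hasFiniteCuts_univ⟩, compactsIn_univ, N.prTop_univ⟩
  exists_measure f := by
    obtain ⟨μ, hμ, h⟩ := N.exists_vectorMeasure f.2
    exact ⟨μ, hμ, fun A => h A.1 A.2⟩

instance nontrivial_L2 : Nontrivial (N.L2 𝕜) := by
  have hf : indicatorConstLp 2 MeasurableSet.univ (measure_ne_top P _) (1 : 𝕜) ∈ N.L2 𝕜 :=
    indicatorConstLp_mem_lpMeas (m := N.fieldTop) (s := Set.univ) MeasurableSet.univ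
      (@MeasurableSet.univ _ (aeClosure P N.fieldTop))
  have h0 : indicatorConstLp 2 MeasurableSet.univ (measure_ne_top P _) (1 : 𝕜) ≠ 0 := by
    rw [← norm_ne_zero_iff, norm_indicatorConstLp (by norm_num) (by norm_num)]
    simp
  exact ⟨⟨_, hf⟩, 0, fun h => h0 (congrArg Subtype.val h)⟩

theorem exists_isSpectralMeasure [MeasureTheory.IsSeparable P] :
    ∃ μ : Measure (Compacts ℝ), IsSpectralMeasure.{u, 0} 𝕜 N μ := by
  have htop : Fact ((2 : ℝ≥0∞) ≠ ∞) := ⟨by norm_num⟩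
  have hcomplete : CompleteSpace (N.L2 𝕜) := (isClosed_lpMeas N.fieldTop_le).completeSpace_coe
  obtain ⟨μ, hμ, hnull, F, D, hF, hD⟩ := (N.isSpectralFamily_prTop (𝕜 := 𝕜)).exists_decomposition
  refine ⟨μ, hμ, fun t => hnull _ fun f ν hν hf => ?_, F, D, hF, fun A hA f => ?_⟩
  · have h1 : {C : Compacts ℝ | t ∈ C} = (compactsIn {t}ᶜ)ᶜ := by
      ext C
      simp [mem_compactsIn, Set.subset_compl_singleton_iff]
    have h2 := hf ⟨{t}ᶜ, (hasFiniteCuts_of_ordConnected Set.ordConnected_singleton).compl⟩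
    have h3 := hf ⟨Set.univ, hasFiniteCuts_univ⟩
    simp only [compactsIn_univ] at h2 h3
    rw [h1, measure_compl (measurableSet_compactsIn_compl_singleton t) (measure_ne_top _ _), h2, h3,
      N.prTop_univ, N.prTop_compl_singleton, tsub_self]
  · rw [condExpL2_eq_prTop]
    exact hD ⟨A, hA.hasFiniteCuts⟩ f

end Noise

/-! ### Uniqueness of the spectral type -/

namespace MeasurableHilbertField

variable {𝕜 : Type} [RCLike 𝕜] {X : Type u} [MeasurableSpace X] {μ : Measure X}
  (F : MeasurableHilbertField.{u, v} 𝕜 μ)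

theorem aemeasurable_inner {ξ η : ∀ x, F.fiber x} (hξ : ξ ∈ F.fields) (hη : η ∈ F.fields) :
    AEMeasurable (fun x => inner 𝕜 (ξ x) (η x)) μ := by
  have h : ∀ ζ ∈ F.fields, AEMeasurable (fun x => ((‖ζ x‖ : ℝ) : 𝕜) ^ 2) μ := fun ζ hζ =>
    (RCLike.measurable_ofReal.comp_aemeasurable (F.aemeasurable_norm ζ hζ)).pow_const 2
  simp only [inner_eq_sum_norm_sq_div_four]
  have hI := F.fields.smul_mem (RCLike.I : 𝕜) hη
  exact (((h _ (F.fields.add_mem hξ hη)).sub (h _ (F.fields.sub_mem hξ hη))).add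
    (((h _ (F.fields.sub_mem hξ hI)).sub (h _ (F.fields.add_mem hξ hI))).mul_const _)).div_const 4

theorem smul_mem_of_aemeasurable {c : X → 𝕜} (hc : AEMeasurable c μ) {ξ : ∀ x, F.fiber x}
    (hξ : ξ ∈ F.fields) : (fun x => c x • ξ x) ∈ F.fields :=
  F.mem_of_aemeasurable_inner _ fun ζ hζ => by
    simp only [inner_smul_right]
    exact hc.mul (F.aemeasurable_inner hζ hξ)

end MeasurableHilbertField

namespace DirectIntegralDecomposition

variable {𝕜 : Type} [RCLike 𝕜] {X : Type u} [MeasurableSpace X] {μ : Measure X}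
  {F : MeasurableHilbertField.{u, v} 𝕜 μ} {K : Type*} [NormedAddCommGroup K]
  [InnerProductSpace 𝕜 K] (D : DirectIntegralDecomposition 𝕜 F K)

theorem aemeasurable_enorm_sq (f : K) : AEMeasurable (fun x => ‖D.coord f x‖ₑ ^ 2) μ := by
  simp only [← ofReal_norm]
  exact (F.aemeasurable_norm _ (D.coord_mem f)).ennreal_ofReal.pow_const 2

theorem lintegral_enorm_sq (f : K) :
    ∫⁻ x, ‖D.coord f x‖ₑ ^ 2 ∂μ = ENNReal.ofReal (‖f‖ ^ 2) := by
  have h := D.inner_eq f f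
  simp only [inner_self_eq_norm_sq_to_K, ← RCLike.ofReal_pow] at h
  rw [integral_ofReal, RCLike.ofReal_inj] at h
  rw [h, ofReal_integral_eq_lintegral_ofReal (D.memLp_coord f).integrable_sq
    (ae_of_all _ fun _ => sq_nonneg _)]
  refine lintegral_congr fun x => ?_
  rw [ENNReal.ofReal_pow (norm_nonneg _), ofReal_norm]

/-- The square integrable measurable fields are total in almost every fibre, so they cannot all
vanish on a set of positive measure. -/
theorem measure_eq_zero_of_coord_eq_zero [IsFiniteMeasure μ]
    (hF : ∀ᵐ x ∂μ, Nontrivial (F.fiber x)) {B : Set X}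
    (hB : ∀ f, ∀ᵐ x ∂μ, x ∈ B → D.coord f x = 0) : μ B = 0 := by
  obtain ⟨ξ, hξ, htotal⟩ := F.exists_total
  -- Rescaling makes the fields of a total sequence bounded, hence square integrable.
  have hpos : ∀ n x, 0 < 1 + ‖ξ n x‖ := fun n x => by positivity
  have hmem : ∀ n, (fun x => (((1 + ‖ξ n x‖)⁻¹ : ℝ) : 𝕜) • ξ n x) ∈ F.fields := fun n =>
    F.smul_mem_of_aemeasurable (RCLike.measurable_ofReal.comp_aemeasurable
      ((F.aemeasurable_norm _ (hξ n)).const_add 1).inv) (hξ n)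
  have hLp : ∀ n, MemLp (fun x => ‖(((1 + ‖ξ n x‖)⁻¹ : ℝ) : 𝕜) • ξ n x‖) 2 μ := fun n => by
    refine MemLp.of_bound (F.aemeasurable_norm _ (hmem n)).aestronglyMeasurable 1
      (ae_of_all _ fun x => ?_)
    rw [norm_norm, norm_smul, RCLike.norm_ofReal, abs_of_pos (inv_pos.2 (hpos n x)),
      inv_mul_le_one₀ (hpos n x)]
    linarith
  choose f hf using fun n => D.surjective _ (hmem n) (hLp n)
  rw [measure_eq_zero_iff_ae_notMem]
  filter_upwards [hF, ae_all_iff.2 hf, ae_all_iff.2 fun n => hB (f n)] with x hx h1 h2 hxB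
  have h3 : ∀ n, ξ n x = 0 := fun n => by
    have h := (h1 n).symm.trans (h2 n hxB)
    rw [smul_eq_zero, RCLike.ofReal_eq_zero] at h
    exact h.resolve_left (inv_pos.2 (hpos n x)).ne'
  have h4 : Submodule.span 𝕜 (Set.range fun n => ξ n x) = ⊥ := by
    rw [Submodule.span_eq_bot]
    rintro _ ⟨n, rfl⟩
    exact h3 n
  have h5 := htotal x
  rw [h4, (isClosed_singleton (x := (0 : F.fiber x))).submodule_topologicalClosure_eq] at h5
  exact bot_ne_top h5

end DirectIntegralDecomposition

theorem IsElementary.inter {A B : Set ℝ} (hA : IsElementary A) (hB : IsElementary B) :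
    IsElementary (A ∩ B) := by
  obtain ⟨S, hS, hS', rfl⟩ := hA
  obtain ⟨S', hfin, hord, rfl⟩ := hB
  refine ⟨Set.image2 (· ∩ ·) S S', hS.image2 _ hfin, ?_, ?_⟩
  · rintro _ ⟨I, hI, J, hJ, rfl⟩
    exact (hS' I hI).inter (hord J hJ)
  · ext x
    simp only [Set.mem_inter_iff, Set.mem_sUnion, Set.mem_image2]
    constructor
    · rintro ⟨⟨I, hI, hxI⟩, J, hJ, hxJ⟩
      exact ⟨_, ⟨I, hI, J, hJ, rfl⟩, hxI, hxJ⟩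
    · rintro ⟨_, ⟨I, hI, J, hJ, rfl⟩, hxI, hxJ⟩
      exact ⟨⟨I, hI, hxI⟩, J, hJ, hxJ⟩

theorem isElementary_univ : IsElementary Set.univ :=
  ⟨{Set.univ}, Set.finite_singleton _, fun _ hI => hI ▸ Set.ordConnected_univ,
    (Set.sUnion_singleton _).symm⟩

theorem isElementary_compl_Icc {a b : ℝ} : IsElementary (Set.Icc a b)ᶜ := by
  refine ⟨{Set.Iio a, Set.Ioi b}, Set.toFinite _, ?_, ?_⟩
  · rintro I (rfl | rfl)
    exacts [Set.ordConnected_Iio, Set.ordConnected_Ioi]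
  · ext x
    simp only [Set.mem_compl_iff, Set.mem_Icc, not_and_or, not_le, Set.sUnion_insert,
      Set.sUnion_singleton, Set.mem_union, Set.mem_Iio, Set.mem_Ioi]

theorem measurableSpace_compacts_eq_isElementary :
    instMeasurableSpaceCompactsReal =
      MeasurableSpace.generateFrom {s | ∃ A, IsElementary A ∧ compactsIn A = s} := by
  refine le_antisymm ?_ (MeasurableSpace.generateFrom_le ?_)
  · rw [measurableSpace_compacts_eq]
    refine MeasurableSpace.generateFrom_mono ?_
    rintro _ ⟨p, rfl⟩
    exact ⟨_, isElementary_compl_Icc, rfl⟩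
  · rintro _ ⟨A, hA, rfl⟩
    exact hA.hasFiniteCuts.measurableSet_compactsIn

namespace Noise

variable {Ω : Type u} [mΩ : MeasurableSpace Ω] {P : Measure Ω} {N : Noise P}
  {𝕜 : Type} [RCLike 𝕜] [IsProbabilityMeasure P]

/-- The spectral measure of a vector `f`, computed in a decomposition of `L₂`, gives measure
`‖E(f | F_A)‖²` to `e(A)`. -/
theorem setLIntegral_enorm_coord_sq {μ : Measure (Compacts ℝ)}
    {F : MeasurableHilbertField.{0, v} 𝕜 μ} (D : DirectIntegralDecomposition 𝕜 F (N.L2 𝕜))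
    {A : Set ℝ} (hA : HasFiniteCuts A) (f : N.L2 𝕜)
    (hD : ∀ᵐ C ∂μ, D.coord (N.condExpL2 A f) C =
        Set.indicator {C : Compacts ℝ | (C : Set ℝ) ⊆ A} (fun _ => (1 : 𝕜)) C • D.coord f C) :
    ∫⁻ C in compactsIn A, ‖D.coord f C‖ₑ ^ 2 ∂μ =
      ENNReal.ofReal (‖N.condExpL2 A f‖ ^ 2) := by
  rw [← D.lintegral_enorm_sq, ← lintegral_indicator hA.measurableSet_compactsIn]
  refine lintegral_congr_ae (hD.mono fun C hC => ?_)
  beta_reduce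
  rw [hC]
  by_cases h : C ∈ compactsIn A
  · rw [Set.indicator_of_mem h, Set.indicator_of_mem (s := {C : Compacts ℝ | (C : Set ℝ) ⊆ A}) h,
      one_smul]
  · rw [Set.indicator_of_notMem h,
      Set.indicator_of_notMem (s := {C : Compacts ℝ | (C : Set ℝ) ⊆ A}) h, zero_smul, enorm_zero,
      zero_pow two_ne_zero]

theorem _root_.IsSpectralMeasure.absolutelyContinuous {μ ν : Measure (Compacts ℝ)}
    (hμ : IsSpectralMeasure.{u, v} 𝕜 N μ) (hν : IsSpectralMeasure.{u, v} 𝕜 N ν) : μ ≪ ν := by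
  obtain ⟨hμ, -, F, D, hF, hD⟩ := hμ
  obtain ⟨hν, -, F', D', -, hD'⟩ := hν
  have heq : ∀ f, μ.withDensity (fun C => ‖D.coord f C‖ₑ ^ 2) =
      ν.withDensity (fun C => ‖D'.coord f C‖ₑ ^ 2) := fun f => by
    have hval : ∀ A, IsElementary A →
        μ.withDensity (fun C => ‖D.coord f C‖ₑ ^ 2) (compactsIn A) =
          ν.withDensity (fun C => ‖D'.coord f C‖ₑ ^ 2) (compactsIn A) := fun A hA => by
      have hm := hA.hasFiniteCuts.measurableSet_compactsIn
      rw [withDensity_apply _ hm, withDensity_apply _ hm,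
        setLIntegral_enorm_coord_sq D hA.hasFiniteCuts f (hD A hA f),
        setLIntegral_enorm_coord_sq D' hA.hasFiniteCuts f (hD' A hA f)]
    have hfin : IsFiniteMeasure (μ.withDensity fun C => ‖D.coord f C‖ₑ ^ 2) :=
      isFiniteMeasure_withDensity (by rw [D.lintegral_enorm_sq]; exact ENNReal.ofReal_ne_top)
    refine ext_of_generate_finite _ measurableSpace_compacts_eq_isElementary ?_ ?_ ?_
    · rintro _ ⟨A, hA, rfl⟩ _ ⟨B, hB, rfl⟩ -
      exact ⟨A ∩ B, hA.inter hB, compactsIn_inter A B⟩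
    · rintro _ ⟨A, hA, rfl⟩
      exact hval A hA
    · rw [← compactsIn_univ]
      exact hval _ isElementary_univ
  refine Measure.AbsolutelyContinuous.mk fun B hB hB0 =>
    D.measure_eq_zero_of_coord_eq_zero hF fun f => ?_
  have h : μ.withDensity (fun C => ‖D.coord f C‖ₑ ^ 2) B = 0 := by
    rw [heq]
    exact withDensity_absolutelyContinuous _ _ hB0
  rw [withDensity_apply _ hB, lintegral_eq_zero_iff' (D.aemeasurable_enorm_sq f).restrict,
    EventuallyEq, ae_restrict_iff' hB] at h
  filter_upwards [h] with C hC hCB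
  simpa using hC hCB

end Noise

theorem theorem2p3 {𝕜 : Type} [RCLike 𝕜] {Ω : Type u} [MeasurableSpace Ω] (P : Measure Ω)
    [IsProbabilityMeasure P] [MeasureTheory.IsSeparable P] (N : Noise P) :
    (∃ μ : Measure (Compacts ℝ), IsSpectralMeasure.{u, 0} 𝕜 N μ) ∧
    ∀ μ ν : Measure (Compacts ℝ), IsSpectralMeasure.{u, v} 𝕜 N μ →
      IsSpectralMeasure.{u, v} 𝕜 N ν → μ ≪ ν ∧ ν ≪ μ :=
  ⟨N.exists_isSpectralMeasure, fun _ _ hμ hν =>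
    ⟨hμ.absolutelyContinuous hν, hν.absolutelyContinuous hμ⟩⟩
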